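/- Let $M$ be a non-empty oriented Riemannian manifold (smooth, Hausdorff) of dimension $n+1$, $n\ge 0$, with a smooth metric linear connection $\nabla$ (for instance the Levi-Civita connection), and let $T_M$ be the total space of $\pi:TM\to M$, a manifold of dimension $2n+2$. Let $TT_M=H\oplus V$ be the splitting into the horizontal distribution of $\nabla$ and the vertical distribution $V=\ker \mathrm d\pi$; both summands are identified with $\pi^*TM$ through the horizontal and vertical lifts $w\mapsto w^h$, $w\mapsto w^v$. Let $\nabla^*=\pi^*\nabla\oplus\pi^\star\nabla$ be the induced connection on $T_M$, i.e. the direct sum of the two copies of the pull-back of $\nabla$. Let $\xi_u=u^v$ be the tautological vertical field, and for $s>0$ let $\mathcal S=\{u\in TM:\|u\|=s\}\subset T_M$ be the tangent sphere bundle of radius $s$, a manifold of dimension $2n+1$ with $T\mathcal S=\xi^\perp$ for the Sasaki metric (the metric for which $H\perp V$ and both lifts are isometric). A manifold $X$ has structure group $K\subset\mathrm{GL}(\mathbb R^{\dim X})$ through a family $P$ of tangent frames if $P$ is a smooth principal $K$-subbundle of the frame bundle of $X$. A linear connection on $X$ is reducible to $P$ if its connection matrix with respect to each smooth local section of $P$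 takes values in the Lie algebra of $K$. 1. $T_M$ has structure group $\mathrm{SO}(n+1)$, acting diagonally on $\mathbb R^{n+1}\oplus\mathbb R^{n+1}$, through the frames $(b_0^h,\dots,b_n^h,b_0^v,\dots,b_n^v)$ of $T_uT_M$ with $(b_0,\dots,b_n)$ an oriented orthonormal basis of $T_{\pi(u)}M$; and $\nabla^*$ is reducible to this $\mathrm{SO}(n+1)$-structure. 2. Let $n\ge1$. The open submanifold $T_M\setminus(\text{zero section})$ has structure group $\mathrm{SO}(n)$, acting on $(\mathbb R\oplus\mathbb R^n)\oplus(\mathbb R\oplus\mathbb R^n)$ trivially on the two lines and diagonally on $\mathbb R^n\oplus\mathbb R^n$, through the adapted frames: those frames in 1 with $b_0=u/\|u\|$. The connection $\nabla^*$ is not reducible to this $\mathrm{SO}(n)$-structure. 3. Let $n\ge1$ and $s>0$. The manifold $\mathcal S$ has structure group $\mathrm{SO}(n)$, acting on $(\mathbb R\oplus\mathbb R^n)\oplus\mathbb R^n$ trivially on the line and diagonally on $\mathbb R^n\oplus\mathbb R^n$, through the frames $(b_0^h,\dots,b_n^h,b_1^v,\dots,b_n^v)$ obtained from adapted frames by leaving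 out $b_0^v=\xi/\|\xi\|$. The $T\mathcal S$-valued correction of $\nabla^*$, i.e. $\nabla^*$ along $\mathcal S$ followed by the orthogonal projection onto $T\mathcal S=\xi^\perp$, is not reducible to this $\mathrm{SO}(n)$-structure. -/

import Mathlib

open Bundle Manifold ContDiff Topology Module

noncomputable section

namespace TangentManifold

set_option linter.unusedSectionVars false

/-! ### Structure groups and reducible connections -/

section StructureGroup

variable {κ : Type*} [Fintype κ] [DecidableEq κ] {K : Type*} [Group K]
  {F H X : Type*} [NormedAddCommGroup F] [NormedSpace ℝ F] [TopologicalSpace H]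
  (J : ModelWithCorners ℝ F H) [TopologicalSpace X] [ChartedSpace H X] [IsManifold J 1 X]

/-- The right action of matrices on `κ`-tuples of vectors: a frame `p`, seen as a linear map
`(κ → ℝ) → V`, is sent to `p ∘ A`. -/
def frameAct {V : Type*} [AddCommGroup V] [Module ℝ V] (p : κ → V) (A : Matrix κ κ ℝ) : κ → V :=
  fun j => ∑ i, A i j • p i

/-- `e` is a smooth local section over the open set `U` of the family `P` of sets of frames. -/
structure IsLocalSection (P : ∀ x : X, Set (κ → TangentSpace J x)) (U : Set X)
    (e : ∀ x : X, κ → TangentSpace J x) : Prop where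
  isOpen : IsOpen U
  contMDiffOn : ∀ j, ContMDiffOn J J.tangent ∞ (fun x => (⟨x, e x j⟩ : TangentBundle J X)) U
  mem : ∀ x ∈ U, e x ∈ P x

/-- `P` is a reduction, over the open submanifold `W` of `X`, of the bundle of tangent frames
to the group `K` acting on `κ → ℝ` through `ρ`: a smooth principal `K`-subbundle of the frame
bundle of `W`. In other words, `W` has structure group `K` through `ρ`, by means of the frames
in `P`. -/
structure IsGStructure (ρ : K →* Matrix κ κ ℝ) (P : ∀ x : X, Set (κ → TangentSpace J x))
    (W : Set X) : Prop where
  isOpen : IsOpen W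
  linearIndependent : ∀ x ∈ W, ∀ p ∈ P x, LinearIndependent ℝ p
  span_eq_top : ∀ x ∈ W, ∀ p ∈ P x, Submodule.span ℝ (Set.range p) = ⊤
  act_mem : ∀ x ∈ W, ∀ p ∈ P x, ∀ g : K, frameAct p (ρ g) ∈ P x
  existsUnique_act : ∀ x ∈ W, ∀ p ∈ P x, ∀ q ∈ P x, ∃! g : K, q = frameAct p (ρ g)
  exists_section : ∀ x ∈ W, ∃ U e, x ∈ U ∧ U ⊆ W ∧ IsLocalSection J P U e

/-- The Lie algebra of the matrix group `ρ K`. -/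
def lieAlgebra (ρ : K →* Matrix κ κ ℝ) : Set (Matrix κ κ ℝ) :=
  {A | ∀ t : ℝ, ∃ g : K, ρ g = NormedSpace.exp (t • A)}

/-- The linear connection `D` (where `D Z x y` is the covariant derivative of the vector field `Z`
at `x` in the direction `y`) is reducible over `W` to the reduction `P` of the frame bundle:
with respect to every local section of `P`, its connection 1-form takes values in the Lie algebra
of the structure group. -/
def IsReducible (D : (∀ x : X, TangentSpace J x) → ∀ x : X, TangentSpace J x → TangentSpace J x)
    (ρ : K →* Matrix κ κ ℝ) (P : ∀ x : X, Set (κ → TangentSpace J x)) (W : Set X) : Prop :=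
  ∀ U e, U ⊆ W → IsLocalSection J P U e → ∀ x ∈ U, ∀ y : TangentSpace J x,
    ∃ A ∈ lieAlgebra ρ, (fun j => D (fun z => e z j) x y) = frameAct (e x) A

end StructureGroup

/-! ### The representations of the structure groups -/

section Representations

/-- The special orthogonal group `SO(k)`. -/
abbrev SO (k : ℕ) : Submonoid (Matrix (Fin k) (Fin k) ℝ) := Matrix.specialOrthogonalGroup (Fin k) ℝ

/-- Block diagonal matrices. -/
def blockDiag (k l : Type*) [Fintype k] [DecidableEq k] [Fintype l] [DecidableEq l] :
    Matrix k k ℝ × Matrix l l ℝ →* Matrix (k ⊕ l) (k ⊕ l) ℝ where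
  toFun A := Matrix.fromBlocks A.1 0 0 A.2
  map_one' := Matrix.fromBlocks_one
  map_mul' A B := by simp [Matrix.fromBlocks_multiply]

/-- `A ↦ 1 ⊕ A`, acting trivially on the first basis vector of `ℝⁿ⁺¹`. -/
def fixFirst (n : ℕ) : Matrix (Fin n) (Fin n) ℝ →* Matrix (Fin (n + 1)) (Fin (n + 1)) ℝ where
  toFun A := Matrix.of (Fin.cons (Fin.cons 1 fun _ => 0) fun i => Fin.cons 0 fun j => A i j)
  map_one' := by
    ext i j
    refine Fin.cases (Fin.cases ?_ (fun _ => ?_) j) (fun i' => Fin.cases ?_ (fun j' => ?_) j) i <;>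
      simp [Matrix.one_apply, Fin.succ_ne_zero, (Fin.succ_ne_zero _).symm]
  map_mul' A B := by
    ext i j
    refine Fin.cases (Fin.cases ?_ (fun _ => ?_) j) (fun i' => Fin.cases ?_ (fun j' => ?_) j) i <;>
      simp [Matrix.mul_apply, Fin.sum_univ_succ]

/-- `SO(n+1)` acting diagonally on `ℝⁿ⁺¹ ⊕ ℝⁿ⁺¹`. -/
def rhoTangent (n : ℕ) :
    SO (n + 1) →* Matrix (Fin (n + 1) ⊕ Fin (n + 1)) (Fin (n + 1) ⊕ Fin (n + 1)) ℝ :=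
  (blockDiag _ _).comp ((SO (n + 1)).subtype.prod (SO (n + 1)).subtype)

/-- `SO(n)` acting on `(ℝ ⊕ ℝⁿ) ⊕ (ℝ ⊕ ℝⁿ)`: trivially on the lines, diagonally on `ℝⁿ ⊕ ℝⁿ`. -/
def rhoNonzero (n : ℕ) :
    SO n →* Matrix (Fin (n + 1) ⊕ Fin (n + 1)) (Fin (n + 1) ⊕ Fin (n + 1)) ℝ :=
  (blockDiag _ _).comp
    (((fixFirst n).comp (SO n).subtype).prod ((fixFirst n).comp (SO n).subtype))

/-- `SO(n)` acting on `(ℝ ⊕ ℝⁿ) ⊕ ℝⁿ`: trivially on the line, diagonally on `ℝⁿ ⊕ ℝⁿ`. -/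
def rhoSphere (n : ℕ) : SO n →* Matrix (Fin (n + 1) ⊕ Fin n) (Fin (n + 1) ⊕ Fin n) ℝ :=
  (blockDiag _ _).comp (((fixFirst n).comp (SO n).subtype).prod (SO n).subtype)

end Representations

/-! ### The tangent sphere bundle as a manifold -/

/-- If the charts of `S` with values in a manifold `N` have smooth changes of coordinates, then `S` is
a smooth manifold. -/
theorem isManifold_comp {F H N S : Type*} [NormedAddCommGroup F] [NormedSpace ℝ F]
    [TopologicalSpace H] (J : ModelWithCorners ℝ F H) [TopologicalSpace N] [ChartedSpace H N]
    [IsManifold J ∞ N] [TopologicalSpace S] [ChartedSpace N S]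
    (h : ∀ φ ∈ atlas N S, ∀ φ' ∈ atlas N S,
      ContMDiffOn J J ∞ (φ.symm.trans φ') (φ.symm.trans φ').source) :
    @IsManifold ℝ _ F _ _ H _ J ∞ S _ (ChartedSpace.comp H N S) := by
  let _ : ChartedSpace H S := ChartedSpace.comp H N S
  apply isManifold_of_contDiffOn
  rintro _ _ ⟨φ, hφ, c, hc, rfl⟩ ⟨φ', hφ', c', hc', rfl⟩
  have hc1 := OpenPartialHomeomorph.contMDiffOn_extend (I := J) (n := ∞)
    (IsManifold.subset_maximalAtlas hc')
  have hs := contMDiffOn_extend_symm (I := J) (n := ∞)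
    (IsManifold.subset_maximalAtlas hc)
  have h1 := hc1.comp' ((h φ hφ φ' hφ').comp' hs)
  rw [contMDiffOn_iff_contDiffOn] at h1
  refine (h1.mono ?_).congr ?_
  · rintro y ⟨hy, x, hy'⟩
    subst hy'
    simp only [mfld_simps, Set.mem_preimage] at hy ⊢
    refine ⟨⟨⟨x, hy.1.1, rfl⟩, hy.1.2, hy.2.1⟩, hy.2.2⟩
  · intro y hy
    simp [mfld_simps]

variable {n : ℕ}
/-- The radial projection `v ↦ v / ‖v‖` of `ℝⁿ⁺¹ ∖ {0}` onto the unit sphere (a junk value at `0`). -/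
def unitVec (v : EuclideanSpace ℝ (Fin (n + 1))) :
    Metric.sphere (0 : EuclideanSpace ℝ (Fin (n + 1))) 1 :=
  if h : v = 0 then ⟨EuclideanSpace.single 0 1, by simp⟩
  else ⟨‖v‖⁻¹ • v, by simp [norm_smul, h]⟩

theorem unitVec_coe {v : EuclideanSpace ℝ (Fin (n + 1))} (h : v ≠ 0) :
    (unitVec v : EuclideanSpace ℝ (Fin (n + 1))) = ‖v‖⁻¹ • v := by
  simp [unitVec, h]

theorem unitVec_smul_coe {c : ℝ} (hc : 0 < c)
    (w : Metric.sphere (0 : EuclideanSpace ℝ (Fin (n + 1))) 1) : unitVec (c • w.1) = w := by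
  have hw : ‖w.1‖ = 1 := by simp
  have h0 : w.1 ≠ 0 := by intro h; simp [h] at hw
  apply Subtype.ext
  rw [unitVec_coe (smul_ne_zero hc.ne' h0), norm_smul, hw, smul_smul]
  simp [abs_of_pos hc, hc.ne']

theorem continuousOn_unitVec : ContinuousOn (unitVec (n := n)) {0}ᶜ := by
  rw [Topology.IsInducing.subtypeVal.continuousOn_iff]
  have : ContinuousOn (fun v : EuclideanSpace ℝ (Fin (n + 1)) => ‖v‖⁻¹ • v) {0}ᶜ :=
    (continuousOn_id.norm.inv₀ (fun x hx => by simpa using hx)).smul continuousOn_id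
  exact this.congr fun v hv => unitVec_coe hv

theorem contMDiffOn_unitVec : ContMDiffOn (𝓡 (n + 1)) (𝓡 n) ∞ (unitVec (n := n)) {0}ᶜ := by
  let _ := Fact.mk (@finrank_euclideanSpace_fin ℝ _ (n + 1))
  rw [contMDiffOn_iff_target]
  refine ⟨continuousOn_unitVec, fun v => ?_⟩
  let U := (OrthonormalBasis.fromOrthogonalSpanSingleton (𝕜 := ℝ)
        n (ne_zero_of_mem_unit_sphere (-v))).repr
  have h : ContDiffOn ℝ ω _ Set.univ := U.contDiff.contDiffOn
  have H₁ := (h.comp_inter (contDiffOn_stereoToFun (v := ((-v : Metric.sphere _ _) : EuclideanSpace ℝ (Fin (n + 1)))))).contMDiffOn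
  have H₂ : ContMDiffOn (𝓡 (n + 1)) (𝓡 (n + 1)) ∞
      (fun v : EuclideanSpace ℝ (Fin (n + 1)) => ‖v‖⁻¹ • v) {0}ᶜ := by
    apply ContDiffOn.contMDiffOn
    intro x hx
    exact (((contDiffAt_norm ℝ hx).inv (by simpa using hx)).smul contDiffAt_id).contDiffWithinAt
  have H₃ := (H₁.of_le le_top).comp' H₂
  refine (H₃.mono ?_).congr ?_
  · rintro x ⟨hx, hx'⟩
    refine ⟨hx, ?_⟩
    have hx1 : ‖(unitVec x : EuclideanSpace ℝ (Fin (n + 1)))‖ = 1 := by simp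
    have e1 := unitVec_coe hx
    rw [Set.mem_preimage, ← e1]
    have hfxv : (unitVec x : EuclideanSpace ℝ (Fin (n + 1))) = -↑v ↔ Inner.inner ℝ (unitVec x : EuclideanSpace ℝ (Fin (n + 1))) (-↑v) = (1 : ℝ) := by
      rw [inner_eq_one_iff_of_norm_eq_one hx1]
      exact norm_eq_of_mem_sphere (-v)
    simp [chartAt, ChartedSpace.chartAt, Subtype.ext_iff, hfxv, real_inner_comm] at hx' ⊢
    exact hx'
  · intro x hx
    have e1 := unitVec_coe hx.1
    simp only [Function.comp_apply]
    rw [← e1]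
    rfl

section Sphere
variable {M : Type*} [TopologicalSpace M] [ChartedSpace (EuclideanSpace ℝ (Fin (n + 1))) M]
  [IsManifold (𝓡 (n + 1)) ∞ M] [RiemannianBundle (TangentSpace (𝓡 (n + 1)) : M → Type _)]

instance riemannianOne
    [h : IsContMDiffRiemannianBundle (𝓡 (n + 1)) ∞ (EuclideanSpace ℝ (Fin (n + 1)))
      (TangentSpace (𝓡 (n + 1)) : M → Type _)] :
    IsContMDiffRiemannianBundle (𝓡 (n + 1)) 1 (EuclideanSpace ℝ (Fin (n + 1)))
      (TangentSpace (𝓡 (n + 1)) : M → Type _) :=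
  h.of_le (by norm_cast)

theorem contMDiffOn_norm
    [IsContMDiffRiemannianBundle (𝓡 (n + 1)) ∞ (EuclideanSpace ℝ (Fin (n + 1)))
      (TangentSpace (𝓡 (n + 1)) : M → Type _)] :
    ContMDiffOn (𝓡 (n + 1)).tangent 𝓘(ℝ, ℝ) ∞ (fun u : TangentBundle (𝓡 (n + 1)) M => ‖u.2‖)
      {u | u.2 ≠ 0} := by
  have h : ContMDiffOn (𝓡 (n + 1)).tangent 𝓘(ℝ, ℝ) ∞
      (fun u : TangentBundle (𝓡 (n + 1)) M => Inner.inner ℝ u.2 u.2) {u | u.2 ≠ 0} :=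
    ContMDiffOn.inner_bundle (IB := 𝓡 (n + 1)) (F := EuclideanSpace ℝ (Fin (n + 1)))
      (E := (TangentSpace (𝓡 (n + 1)) : M → Type _))
      (b := fun u : TangentBundle (𝓡 (n + 1)) M => u.proj) (v := fun u => u.2) (w := fun u => u.2)
      contMDiffOn_id contMDiffOn_id
  intro u hu
  have h1 : ContDiffAt ℝ ∞ Real.sqrt (Inner.inner ℝ u.2 u.2) :=
    Real.contDiffAt_sqrt (by simpa using hu)
  refine (h1.contMDiffAt.comp_contMDiffWithinAt u (h u hu)).congr (fun v hv => ?_) ?_ <;>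
    simp [Real.sqrt_sq]

theorem contMDiffOn_smul {f : TangentBundle (𝓡 (n + 1)) M → ℝ}
    {s : Set (TangentBundle (𝓡 (n + 1)) M)}
    (hf : ContMDiffOn (𝓡 (n + 1)).tangent 𝓘(ℝ, ℝ) ∞ f s) :
    ContMDiffOn (𝓡 (n + 1)).tangent (𝓡 (n + 1)).tangent ∞
      (fun u : TangentBundle (𝓡 (n + 1)) M =>
        (⟨u.proj, f u • u.2⟩ : TangentBundle (𝓡 (n + 1)) M)) s := by
  intro u hu
  have h0 : ContMDiffWithinAt (𝓡 (n + 1)).tangent (𝓡 (n + 1)).tangent ∞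
    (fun u : TangentBundle (𝓡 (n + 1)) M => u) s u := contMDiffWithinAt_id
  rw [contMDiffWithinAt_totalSpace] at h0 ⊢
  refine ⟨h0.1, ((hf u hu).smul h0.2).congr_of_eventuallyEq ?_ ?_⟩
  · have hb : ∀ᶠ v : TangentBundle (𝓡 (n + 1)) M in 𝓝[s] u, v.proj ∈
        (trivializationAt (EuclideanSpace ℝ (Fin (n + 1))) (TangentSpace (𝓡 (n + 1)) : M → Type _)
          u.proj).baseSet :=
      (h0.1.continuousWithinAt).preimage_mem_nhdsWithin
        ((Trivialization.open_baseSet _).mem_nhds (FiberBundle.mem_baseSet_trivializationAt' _))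
    filter_upwards [hb] with v hv
    exact (Trivialization.linear ℝ _ hv).map_smul (f v) v.2
  · exact (Trivialization.linear ℝ _ (FiberBundle.mem_baseSet_trivializationAt' _)).map_smul _ _

variable (n M) in
/-- The sphere bundle of radius `s`, `𝒮 = {u ∈ TM : ‖u‖ = s}`. -/
def SphereBundle (s : ℝ) : Type _ := {u : TangentBundle (𝓡 (n + 1)) M // ‖u.2‖ = s}

instance (s : ℝ) : TopologicalSpace (SphereBundle n M s) := instTopologicalSpaceSubtype

/-- The radial projection `u ↦ s u / ‖u‖` of `T_M ∖ (zero section)` onto the sphere bundle (with the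
junk value `p` on the zero section). -/
def radial {s : ℝ} [Fact (0 < s)] (p : SphereBundle n M s) (u : TangentBundle (𝓡 (n + 1)) M) :
    SphereBundle n M s :=
  open Classical in
  if h : u.2 = 0 then p else ⟨⟨u.proj, (s / ‖u.2‖) • u.2⟩, by
    have hs : 0 < s := Fact.out
    have hu : ‖u.2‖ ≠ 0 := by simpa using h
    simp [norm_smul, abs_of_pos hs, hu]⟩

theorem radial_val {s : ℝ} [Fact (0 < s)] (p : SphereBundle n M s)
    {u : TangentBundle (𝓡 (n + 1)) M} (h : u.2 ≠ 0) :
    (radial p u).1 = ⟨u.proj, (s / ‖u.2‖) • u.2⟩ := by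
  simp [radial, h]

variable [IsContMDiffRiemannianBundle (𝓡 (n + 1)) ∞ (EuclideanSpace ℝ (Fin (n + 1)))
      (TangentSpace (𝓡 (n + 1)) : M → Type _)]

theorem contMDiffOn_radial {s : ℝ} [Fact (0 < s)] (p : SphereBundle n M s) :
    ContMDiffOn (𝓡 (n + 1)).tangent (𝓡 (n + 1)).tangent ∞
      (fun u : TangentBundle (𝓡 (n + 1)) M => (radial p u).1) {u | u.2 ≠ 0} := by
  have h1 : ContMDiffOn (𝓡 (n + 1)).tangent 𝓘(ℝ, ℝ) ∞
      (fun u : TangentBundle (𝓡 (n + 1)) M => s / ‖u.2‖) {u | u.2 ≠ 0} := by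
    intro u hu
    have h2 : ContDiffAt ℝ ∞ (fun t : ℝ => s / t) ‖u.2‖ :=
      contDiffAt_const.div contDiffAt_id (by simpa using hu)
    exact h2.contMDiffAt.comp_contMDiffWithinAt u (contMDiffOn_norm u hu)
  exact (contMDiffOn_smul h1).congr fun u hu => radial_val p hu

local notation "triv" => trivializationAt (EuclideanSpace ℝ (Fin (n + 1)))
  (TangentSpace (𝓡 (n + 1)) : M → Type _)

theorem triv_smul (x₀ : M) {x : M} (hx : x ∈ (triv x₀).baseSet) (c : ℝ)
    (v : TangentSpace (𝓡 (n + 1)) x) :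
    ((triv x₀) ⟨x, c • v⟩).2 = c • ((triv x₀) ⟨x, v⟩).2 :=
  (Trivialization.linear ℝ (triv x₀) hx).map_smul c v

theorem triv_symm_smul (x₀ : M) {x : M} (hx : x ∈ (triv x₀).baseSet) (c : ℝ)
    (w : EuclideanSpace ℝ (Fin (n + 1))) :
    (triv x₀).symm x (c • w) = c • (triv x₀).symm x w := by
  rw [← Trivialization.coe_symmₗ (R := ℝ) (triv x₀) hx]
  exact ((triv x₀).symmₗ ℝ x).map_smul c w

theorem triv_ne_zero (x₀ : M) {x : M} (hx : x ∈ (triv x₀).baseSet)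
    {v : TangentSpace (𝓡 (n + 1)) x} (hv : v ≠ 0) : ((triv x₀) ⟨x, v⟩).2 ≠ 0 := by
  intro h
  have h1 := (triv x₀).symm_apply_apply_mk hx v
  have h2 := triv_symm_smul x₀ hx 0 0
  rw [h] at h1
  rw [zero_smul, zero_smul, h1] at h2
  exact hv h2

theorem triv_symm_ne_zero (x₀ : M) {x : M} (hx : x ∈ (triv x₀).baseSet)
    {w : EuclideanSpace ℝ (Fin (n + 1))} (hw : w ≠ 0) : (triv x₀).symm x w ≠ 0 := by
  intro h
  have h1 := (triv x₀).apply_mk_symm hx w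
  have h2 := triv_smul x₀ hx 0 0
  rw [h] at h1
  rw [zero_smul, zero_smul, h1] at h2
  exact hw h2

theorem radial_smul {s : ℝ} [Fact (0 < s)] (p q : SphereBundle n M s) {c : ℝ} (hc : 0 < c) :
    radial p ⟨q.1.proj, c • q.1.2⟩ = q := by
  have hs : 0 < s := Fact.out
  obtain ⟨⟨x, v⟩, hv⟩ := q
  have hv : ‖v‖ = s := hv
  have h0 : v ≠ 0 := by
    rintro rfl
    simp [hs.ne] at hv
  apply Subtype.ext
  rw [radial_val p (smul_ne_zero hc.ne' h0)]
  have : (s / ‖c • v‖) • c • v = v := by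
    rw [norm_smul, hv, smul_smul, Real.norm_eq_abs, abs_of_pos hc]
    rw [show s / (c * s) * c = 1 by field_simp, one_smul]
  exact congrArg (fun v' => (⟨x, v'⟩ : TangentBundle (𝓡 (n + 1)) M)) this

theorem SphereBundle.ne_zero {s : ℝ} [Fact (0 < s)] (q : SphereBundle n M s) : q.1.2 ≠ 0 := by
  have hs : 0 < s := Fact.out
  have hq := q.2
  intro h
  simp [h, hs.ne] at hq

theorem sphere_ne_zero (w : Metric.sphere (0 : EuclideanSpace ℝ (Fin (n + 1))) 1) : w.1 ≠ 0 :=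
  ne_zero_of_mem_unit_sphere w

theorem contMDiffOn_triv_symm (x₀ : M) :
    ContMDiffOn ((𝓡 (n + 1)).prod (𝓡 (n + 1))) (𝓡 (n + 1)).tangent ∞
      (fun z : M × EuclideanSpace ℝ (Fin (n + 1)) =>
        (⟨z.1, (triv x₀).symm z.1 z.2⟩ : TangentBundle (𝓡 (n + 1)) M))
      ((triv x₀).baseSet ×ˢ Set.univ) := by
  have h := Trivialization.contMDiffOn_symm (n := ∞) (IB := 𝓡 (n + 1)) (triv x₀)
  rw [(triv x₀).target_eq] at h
  exact h.congr fun z hz => (triv x₀).mk_symm hz.1 z.2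

theorem contMDiffOn_sphereChart_symm {s : ℝ} [Fact (0 < s)] (p : SphereBundle n M s) (x₀ : M) :
    ContMDiffOn ((𝓡 (n + 1)).prod (𝓡 n)) (𝓡 (n + 1)).tangent ∞
      (fun z : M × Metric.sphere (0 : EuclideanSpace ℝ (Fin (n + 1))) 1 =>
        (radial p ⟨z.1, (triv x₀).symm z.1 z.2.1⟩).1)
      ((triv x₀).baseSet ×ˢ Set.univ) := by
  let _ := Fact.mk (@finrank_euclideanSpace_fin ℝ _ (n + 1))
  have h1 : ContMDiffOn ((𝓡 (n + 1)).prod (𝓡 n)) ((𝓡 (n + 1)).prod (𝓡 (n + 1))) ∞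
      (fun z : M × Metric.sphere (0 : EuclideanSpace ℝ (Fin (n + 1))) 1 => (z.1, z.2.1))
      ((triv x₀).baseSet ×ˢ Set.univ) :=
    (contMDiff_fst.prodMk (contMDiff_coe_sphere.comp contMDiff_snd)).contMDiffOn
  have h2 := (contMDiffOn_triv_symm x₀).comp h1 (fun z hz => ⟨hz.1, trivial⟩)
  exact (contMDiffOn_radial p).comp h2
    (fun z hz => triv_symm_ne_zero x₀ hz.1 (sphere_ne_zero z.2))

theorem contMDiffOn_sphereChart (x₀ : M) :
    ContMDiffOn (𝓡 (n + 1)).tangent ((𝓡 (n + 1)).prod (𝓡 n)) ∞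
      (fun u : TangentBundle (𝓡 (n + 1)) M => (u.proj, unitVec ((triv x₀) u).2))
      {u | u.proj ∈ (triv x₀).baseSet ∧ u.2 ≠ 0} := by
  have h := Trivialization.contMDiffOn (n := ∞) (IB := 𝓡 (n + 1)) (triv x₀)
  rw [(triv x₀).source_eq] at h
  have h1 : ContMDiffOn (𝓡 (n + 1)).tangent (𝓡 (n + 1)) ∞
      (fun u : TangentBundle (𝓡 (n + 1)) M => ((triv x₀) u).2)
      {u | u.proj ∈ (triv x₀).baseSet ∧ u.2 ≠ 0} :=
    contMDiff_snd.comp_contMDiffOn (h.mono fun u hu => hu.1)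
  exact (contMDiff_proj _).contMDiffOn.prodMk
    (contMDiffOn_unitVec.comp h1 fun u hu => triv_ne_zero x₀ hu.1 hu.2)

/-- The local trivialization of the sphere bundle over a trivialization `e` of `TM` around `π p`:
`q ↦ (π q, e q / ‖e q‖)`, with inverse `(x, w) ↦ s e⁻¹(x, w) / ‖e⁻¹(x, w)‖`. -/
def sphereChart {s : ℝ} [Fact (0 < s)] (p : SphereBundle n M s) :
    OpenPartialHomeomorph (SphereBundle n M s)
      (M × Metric.sphere (0 : EuclideanSpace ℝ (Fin (n + 1))) 1) where
  toFun q := (q.1.proj, unitVec (triv p.1.proj q.1).2)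
  invFun z := radial p ⟨z.1, (triv p.1.proj).symm z.1 z.2.1⟩
  source := {q | q.1.proj ∈ (triv p.1.proj).baseSet}
  target := (triv p.1.proj).baseSet ×ˢ Set.univ
  map_source' q hq := ⟨hq, trivial⟩
  map_target' z hz := by
    have := radial_val p (u := ⟨z.1, (triv p.1.proj).symm z.1 z.2.1⟩)
      (triv_symm_ne_zero _ hz.1 (sphere_ne_zero z.2))
    simpa [this] using hz.1
  left_inv' q hq := by
    have h0 := triv_ne_zero _ hq q.ne_zero
    have h1 : (triv p.1.proj).symm q.1.proj (unitVec (triv p.1.proj q.1).2).1 =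
        ‖(triv p.1.proj q.1).2‖⁻¹ • q.1.2 := by
      rw [unitVec_coe h0]
      rw [triv_symm_smul _ hq]
      congr 1
      exact (triv p.1.proj).symm_apply_apply_mk hq q.1.2
    rw [h1]
    exact radial_smul p q (inv_pos.2 (norm_pos_iff.2 h0))
  right_inv' z hz := by
    have hs : 0 < s := Fact.out
    have h0 := triv_symm_ne_zero _ hz.1 (sphere_ne_zero z.2)
    have h1 := radial_val p (u := ⟨z.1, (triv p.1.proj).symm z.1 z.2.1⟩) h0
    rw [h1]
    refine Prod.ext rfl ?_
    have h2 := (triv p.1.proj).apply_mk_symm hz.1 z.2.1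
    simp only
    rw [triv_smul _ hz.1, h2]
    exact unitVec_smul_coe (div_pos hs (norm_pos_iff.2 h0)) z.2
  open_source := (Trivialization.open_baseSet _).preimage
    ((FiberBundle.continuous_proj _ _).comp continuous_subtype_val)
  open_target := (Trivialization.open_baseSet _).prod isOpen_univ
  continuousOn_toFun := (contMDiffOn_sphereChart p.1.proj).continuousOn.comp
    continuous_subtype_val.continuousOn fun q hq => ⟨hq, q.ne_zero⟩
  continuousOn_invFun := Topology.IsInducing.subtypeVal.continuousOn_iff.2
    (contMDiffOn_sphereChart_symm p p.1.proj).continuousOn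

/-- The local trivializations of the sphere bundle as charts with values in `M × Sⁿ`. -/
instance sphereChartedProd {s : ℝ} [Fact (0 < s)] :
    ChartedSpace (M × Metric.sphere (0 : EuclideanSpace ℝ (Fin (n + 1))) 1)
      (SphereBundle n M s) where
  atlas := Set.range sphereChart
  chartAt := sphereChart
  mem_chart_source p := FiberBundle.mem_baseSet_trivializationAt
    (EuclideanSpace ℝ (Fin (n + 1))) (TangentSpace (𝓡 (n + 1)) : M → Type _) p.1.proj
  chart_mem_atlas p := ⟨p, rfl⟩

/-- The charts of the sphere bundle, obtained from the charts of `M × Sⁿ`. -/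
instance sphereCharted {s : ℝ} [Fact (0 < s)] :
    ChartedSpace (ModelProd (EuclideanSpace ℝ (Fin (n + 1))) (EuclideanSpace ℝ (Fin n)))
      (SphereBundle n M s) :=
  ChartedSpace.comp _ (M × Metric.sphere (0 : EuclideanSpace ℝ (Fin (n + 1))) 1) _

/-- The sphere bundle is a smooth manifold of dimension `2n + 1`. -/
instance {s : ℝ} [Fact (0 < s)] :
    IsManifold ((𝓡 (n + 1)).prod (𝓡 n)) ∞ (SphereBundle n M s) := by
  apply isManifold_comp
  intro φ hφ φ' hφ'
  obtain ⟨p, rfl⟩ : φ ∈ Set.range sphereChart := hφ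
  obtain ⟨p', rfl⟩ : φ' ∈ Set.range sphereChart := hφ'
  exact (contMDiffOn_sphereChart p'.1.proj).comp ((contMDiffOn_sphereChart_symm p p.1.proj).mono
    (fun z hz => hz.1)) (fun z hz => ⟨hz.2, SphereBundle.ne_zero _⟩)

/-- The sphere bundle is immersed in `T_M`: the inclusion is smooth. -/
theorem contMDiff_incl {s : ℝ} [Fact (0 < s)] :
    ContMDiff ((𝓡 (n + 1)).prod (𝓡 n)) (𝓡 (n + 1)).tangent ∞
      (fun q : SphereBundle n M s => q.1) := by
  intro p
  rw [contMDiffAt_iff_source]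
  have hp := FiberBundle.mem_baseSet_trivializationAt
    (EuclideanSpace ℝ (Fin (n + 1))) (TangentSpace (𝓡 (n + 1)) : M → Type _) p.1.proj
  have h1 := contMDiffWithinAt_extChartAt_symm_range_self (n := ∞)
    (I := (𝓡 (n + 1)).prod (𝓡 n)) (sphereChart p p)
  have h2 := (contMDiffOn_sphereChart_symm p p.1.proj).contMDiffAt
    (((triv p.1.proj).open_baseSet.prod isOpen_univ).mem_nhds
      (show sphereChart p p ∈ _ from ⟨hp, trivial⟩))
  have h3 : (extChartAt ((𝓡 (n + 1)).prod (𝓡 n)) (sphereChart p p)).symm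
      (extChartAt ((𝓡 (n + 1)).prod (𝓡 n)) (sphereChart p p) (sphereChart p p))
      = sphereChart p p := extChartAt_to_inv _
  have h4 := ContMDiffAt.comp_contMDiffWithinAt_of_eq h2 h1 h3
  exact h4

/-- The differential of the inclusion of the sphere bundle is injective. -/
theorem mfderiv_incl_injective {s : ℝ} [Fact (0 < s)] (p : SphereBundle n M s) :
    Function.Injective (mfderiv ((𝓡 (n + 1)).prod (𝓡 n)) (𝓡 (n + 1)).tangent
      (fun q : SphereBundle n M s => q.1) p) := by
  have hp := FiberBundle.mem_baseSet_trivializationAt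
    (EuclideanSpace ℝ (Fin (n + 1))) (TangentSpace (𝓡 (n + 1)) : M → Type _) p.1.proj
  have hcont : Continuous fun u : TangentBundle (𝓡 (n + 1)) M => (inner ℝ u.2 u.2 : ℝ) :=
    (ContMDiff.inner_bundle (IB := 𝓡 (n + 1)) (F := EuclideanSpace ℝ (Fin (n + 1))) (n := ∞)
      (E := (TangentSpace (𝓡 (n + 1)) : M → Type _)) (IM := (𝓡 (n + 1)).tangent)
      (b := fun u : TangentBundle (𝓡 (n + 1)) M => u.proj) (v := fun u => u.2) (w := fun u => u.2)
      contMDiff_id contMDiff_id).continuous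
  let G : TangentBundle (𝓡 (n + 1)) M → M × Metric.sphere (0 : EuclideanSpace ℝ (Fin (n + 1))) 1 :=
    fun u => (u.proj, unitVec ((triv p.1.proj) u).2)
  have hG : MDifferentiableAt (𝓡 (n + 1)).tangent ((𝓡 (n + 1)).prod (𝓡 n)) G p.1 := by
    have h1 := contMDiffOn_sphereChart p.1.proj p.1 ⟨hp, p.ne_zero⟩
    refine (h1.contMDiffAt ?_).mdifferentiableAt (by simp)
    have hU : {u : TangentBundle (𝓡 (n + 1)) M | u.2 ≠ 0} =
        (fun u : TangentBundle (𝓡 (n + 1)) M => (inner ℝ u.2 u.2 : ℝ)) ⁻¹' {0}ᶜ := by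
      ext u
      simp
    refine Filter.inter_mem ?_ ?_
    · exact ((triv p.1.proj).open_baseSet.preimage (FiberBundle.continuous_proj _ _)).mem_nhds hp
    · exact (hU ▸ isOpen_compl_singleton.preimage hcont).mem_nhds p.ne_zero
  have he : MDifferentiableAt ((𝓡 (n + 1)).prod (𝓡 n)) 𝓘(ℝ, _)
    (extChartAt ((𝓡 (n + 1)).prod (𝓡 n)) (sphereChart p p)) (G p.1) :=
    mdifferentiableAt_extChartAt (mem_chart_source _ _)
  have h4 := mfderiv_comp p (I' := (𝓡 (n + 1)).tangent) (he.comp _ hG)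
    (contMDiff_incl.mdifferentiableAt (x := p) (by simp))
  have h5 := isInvertible_mfderiv_extChartAt (I := (𝓡 (n + 1)).prod (𝓡 n)) (mem_extChartAt_source (I := (𝓡 (n + 1)).prod (𝓡 n)) p)
  have h6 : (extChartAt ((𝓡 (n + 1)).prod (𝓡 n)) p : SphereBundle n M s → _) =
    ((extChartAt ((𝓡 (n + 1)).prod (𝓡 n)) (sphereChart p p)) ∘ G) ∘ (fun q : SphereBundle n M s => q.1) := rfl
  rw [h6, h4] at h5
  exact Function.Injective.of_comp h5.injective

end Sphere


/-! ### Geometry of the tangent manifold -/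

section Geometry

variable {n : ℕ} {M : Type*} [TopologicalSpace M]
  [ChartedSpace (EuclideanSpace ℝ (Fin (n + 1))) M] [IsManifold (𝓡 (n + 1)) ∞ M]

/-- `o` is an orientation of the manifold `M`: an orientation of every tangent space such that
near every point there is a smooth frame which is everywhere positively oriented. -/
def IsManifoldOrientation
    (o : ∀ x : M, Orientation ℝ (TangentSpace (𝓡 (n + 1)) x) (Fin (n + 1))) : Prop :=
  ∀ x : M, ∃ U ∈ 𝓝 x, ∃ e : ∀ y : M, Fin (n + 1) → TangentSpace (𝓡 (n + 1)) y,
    (∀ i, ContMDiffOn (𝓡 (n + 1)) (𝓡 (n + 1)).tangent ∞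
      (fun y => (⟨y, e y i⟩ : TangentBundle (𝓡 (n + 1)) M)) U) ∧
    ∀ y ∈ U, ∃ b : Basis (Fin (n + 1)) ℝ (TangentSpace (𝓡 (n + 1)) y),
      (∀ i, b i = e y i) ∧ b.orientation = o y

/-- The differential of the projection `π : T_M → M`. Its kernel is the vertical space. -/
def dProj (u : TangentBundle (𝓡 (n + 1)) M) :
    TangentSpace (𝓡 (n + 1)).tangent u →L[ℝ] TangentSpace (𝓡 (n + 1)) u.proj :=
  mfderiv (𝓡 (n + 1)).tangent (𝓡 (n + 1)) (fun v : TangentBundle (𝓡 (n + 1)) M => v.proj) u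

/-- The inclusion of the fibre `T_xM` into `T_M` (as a type, `T_xM` is the model space). -/
def fibreIncl (x : M) (v : EuclideanSpace ℝ (Fin (n + 1))) : TangentBundle (𝓡 (n + 1)) M := ⟨x, v⟩

/-- The vertical lift `T_xM → T_u T_M`, where `x = π u`: the differential at `u` of the inclusion
of the fibre `T_xM` into `T_M`. -/
def vLift (u : TangentBundle (𝓡 (n + 1)) M) :
    TangentSpace (𝓡 (n + 1)) u.proj →L[ℝ] TangentSpace (𝓡 (n + 1)).tangent u :=
  mfderiv (𝓡 (n + 1)) (𝓡 (n + 1)).tangent (fibreIncl u.proj) u.2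

/-- A local vector field on `M` through `u`, constant in a trivialization of `TM` around `π u`. -/
def extendField (u : TangentBundle (𝓡 (n + 1)) M) : ∀ x : M, TangentSpace (𝓡 (n + 1)) x :=
  FiberBundle.extend (EuclideanSpace ℝ (Fin (n + 1))) u.2

/-- The differential at `π u` of `extendField u : M → T_M`. -/
def dExtendField (u : TangentBundle (𝓡 (n + 1)) M) :
    TangentSpace (𝓡 (n + 1)) u.proj →L[ℝ] TangentSpace (𝓡 (n + 1)).tangent u :=
  mfderiv (𝓡 (n + 1)) (𝓡 (n + 1)).tangent
    (fun x => (⟨x, extendField u x⟩ : TangentBundle (𝓡 (n + 1)) M)) u.proj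

/-- The differential at `u` of the fibre coordinate of `T_M` in the trivialization around `π u`. -/
def dFibreCoord (u : TangentBundle (𝓡 (n + 1)) M) :
    TangentSpace (𝓡 (n + 1)).tangent u →L[ℝ] EuclideanSpace ℝ (Fin (n + 1)) :=
  mfderiv (𝓡 (n + 1)).tangent (𝓡 (n + 1)) (fun v : TangentBundle (𝓡 (n + 1)) M =>
    (trivializationAt (EuclideanSpace ℝ (Fin (n + 1)))
      (TangentSpace (𝓡 (n + 1)) : M → Type _) u.proj v).2) u

section Connection

variable (cov : CovariantDerivative (𝓡 (n + 1)) (EuclideanSpace ℝ (Fin (n + 1)))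
  (TangentSpace (𝓡 (n + 1)) : M → Type _))

/-- The horizontal lift `T_xM → T_u T_M` of a linear connection `∇`, where `x = π u`:
`w^h = dσ(w) - (∇_w σ)^v` for a local vector field `σ` with `σ x = u` (it does not depend on
the choice of `σ`). -/
def hLift (u : TangentBundle (𝓡 (n + 1)) M) :
    TangentSpace (𝓡 (n + 1)) u.proj →L[ℝ] TangentSpace (𝓡 (n + 1)).tangent u :=
  dExtendField u - vLift u ∘L cov (extendField u) u.proj

/-- The connection map `T_u T_M → T_xM`, `x = π u`, of `∇`, that is `y ↦ π^⋆∇_y ξ`: the projection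
onto the vertical space along the horizontal one, followed by the inverse of the vertical lift.
In the trivialization of `TM` around `x`, it is the derivative of the fibre coordinate, corrected by
the derivative under `∇` of the vector field which is constant in that trivialization. -/
def connMap (u : TangentBundle (𝓡 (n + 1)) M) :
    TangentSpace (𝓡 (n + 1)).tangent u →L[ℝ] TangentSpace (𝓡 (n + 1)) u.proj :=
  (trivializationAt (EuclideanSpace ℝ (Fin (n + 1)))
      (TangentSpace (𝓡 (n + 1)) : M → Type _) u.proj).symmL ℝ u.proj ∘L dFibreCoord u
    + cov (extendField u) u.proj ∘L dProj u

section Along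

variable {F H N : Type*} [NormedAddCommGroup F] [NormedSpace ℝ F] [TopologicalSpace H]
  (J : ModelWithCorners ℝ F H) [TopologicalSpace N] [ChartedSpace H N]

/-- The pull-back of `∇` to sections of `f^* TM`, where `f = π ∘ u : N → M` and the section
`p ↦ u p ∈ T_{f p} M` is seen as a map `u : N → T_M`. -/
def pullbackCov (u : N → TangentBundle (𝓡 (n + 1)) M) (p : N) :
    TangentSpace J p →L[ℝ] TangentSpace (𝓡 (n + 1)) (u p).proj :=
  connMap cov (u p) ∘L mfderiv J (𝓡 (n + 1)).tangent u p

/-- The connection `∇^* = π^*∇ ⊕ π^⋆∇` on `T T_M = H ⊕ V`, acting on a vector field `Z` of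
`T_M` along a map `f : N → T_M`: both components of `Z` are sections of the pull-back of `TM`,
which are derived and lifted back, horizontally and vertically. -/
def nablaStarAlong (f : N → TangentBundle (𝓡 (n + 1)) M)
    (Z : ∀ p : N, TangentSpace (𝓡 (n + 1)).tangent (f p)) (p : N) :
    TangentSpace J p →L[ℝ] TangentSpace (𝓡 (n + 1)).tangent (f p) :=
  hLift cov (f p) ∘L pullbackCov cov J (fun q => ⟨(f q).proj, dProj (f q) (Z q)⟩) p
    + vLift (f p) ∘L pullbackCov cov J (fun q => ⟨(f q).proj, connMap cov (f q) (Z q)⟩) p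

end Along

/-- The connection `∇^* = π^*∇ ⊕ π^⋆∇` of the manifold `T_M`. -/
def nablaStar (Z : ∀ u : TangentBundle (𝓡 (n + 1)) M, TangentSpace (𝓡 (n + 1)).tangent u)
    (u : TangentBundle (𝓡 (n + 1)) M) (y : TangentSpace (𝓡 (n + 1)).tangent u) :
    TangentSpace (𝓡 (n + 1)).tangent u :=
  nablaStarAlong cov (𝓡 (n + 1)).tangent id Z u y

end Connection

section Lifts

local notation "triv" => trivializationAt (EuclideanSpace ℝ (Fin (n + 1)))
  (TangentSpace (𝓡 (n + 1)) : M → Type _)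

theorem triv_incl (x : M) (v) : (triv x (fibreIncl x v)).2 = (triv x).continuousLinearMapAt ℝ x v := by
  have hx := FiberBundle.mem_baseSet_trivializationAt
    (EuclideanSpace ℝ (Fin (n + 1))) (TangentSpace (𝓡 (n + 1)) : M → Type _) x
  exact ((triv x).continuousLinearMapAt_apply_of_mem (R := ℝ) hx v).symm

theorem fibre_incl (x : M) : ContMDiff (𝓡 (n + 1)) (𝓡 (n + 1)).tangent ∞ (fibreIncl (n := n) x) := by
  intro v
  have hx := FiberBundle.mem_baseSet_trivializationAt
    (EuclideanSpace ℝ (Fin (n + 1))) (TangentSpace (𝓡 (n + 1)) : M → Type _) x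
  refine (contMDiffAt_totalSpace).2 ⟨contMDiffAt_const, ?_⟩
  have := ContinuousLinearMap.contMDiff (E := EuclideanSpace ℝ (Fin (n + 1))) ((triv x).continuousLinearMapAt ℝ x) (n := ∞) (x := v)
  refine this.congr_of_eventuallyEq (Filter.Eventually.of_forall fun v => ?_)
  exact triv_incl x v

/-- Vertical lifts are vertical. -/
theorem dProj_vLift (u : TangentBundle (𝓡 (n + 1)) M) (w) : dProj u (vLift u w) = 0 := by
  have h := mfderiv_comp (I := 𝓡 (n + 1)) (I' := (𝓡 (n + 1)).tangent) (I'' := 𝓡 (n + 1))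
    (f := fibreIncl u.proj)
    (g := fun v : TangentBundle (𝓡 (n + 1)) M => v.proj) u.2
    ((contMDiff_proj _).mdifferentiableAt (n := ∞) (by simp)) ((fibre_incl u.proj).mdifferentiableAt (by simp))
  have h2 : (fun v : TangentBundle (𝓡 (n + 1)) M => v.proj) ∘ (fibreIncl u.proj) = fun _ => u.proj := rfl
  have h3 : ∀ v : EuclideanSpace ℝ (Fin (n + 1)), mfderiv (𝓡 (n + 1)) (𝓡 (n + 1)) ((fun v : TangentBundle (𝓡 (n + 1)) M => v.proj) ∘ (fibreIncl u.proj)) v = 0 := by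
    intro v
    rw [h2, mfderiv_const]
  exact (DFunLike.congr_fun (h.symm.trans (h3 _)) w)

theorem mdiff_coord (u : TangentBundle (𝓡 (n + 1)) M) : MDifferentiableAt (𝓡 (n + 1)).tangent (𝓡 (n + 1)) (fun v : TangentBundle (𝓡 (n + 1)) M => (triv u.proj v).2) u := by
        have hx := FiberBundle.mem_baseSet_trivializationAt
          (EuclideanSpace ℝ (Fin (n + 1))) (TangentSpace (𝓡 (n + 1)) : M → Type _) u.proj
        have h := Trivialization.contMDiffOn (n := ∞) (IB := 𝓡 (n + 1)) (triv u.proj)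
        have h1 := h.contMDiffAt (x := u) ((triv u.proj).open_source.mem_nhds ((triv u.proj).mem_source.2 hx))
        exact (contMDiffAt_snd.comp u h1).mdifferentiableAt (by simp)

theorem connMap_vLift (cov : CovariantDerivative (𝓡 (n + 1)) (EuclideanSpace ℝ (Fin (n + 1)))
  (TangentSpace (𝓡 (n + 1)) : M → Type _)) (u : TangentBundle (𝓡 (n + 1)) M) (w) : connMap cov u (vLift u w) = w := by
  have hx := FiberBundle.mem_baseSet_trivializationAt
    (EuclideanSpace ℝ (Fin (n + 1))) (TangentSpace (𝓡 (n + 1)) : M → Type _) u.proj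
  have h := mfderiv_comp (I := 𝓡 (n + 1)) (I' := (𝓡 (n + 1)).tangent) (I'' := 𝓡 (n + 1))
    (f := fibreIncl u.proj)
    (g := fun v : TangentBundle (𝓡 (n + 1)) M => (triv u.proj v).2) u.2
      (mdiff_coord u) ((fibre_incl u.proj).mdifferentiableAt (by simp))
  have h2 : (fun v : TangentBundle (𝓡 (n + 1)) M => (triv u.proj v).2) ∘ (fibreIncl u.proj) = (triv u.proj).continuousLinearMapAt ℝ u.proj := by
    ext1 v
    exact triv_incl u.proj v
  have h3 : ∀ v : EuclideanSpace ℝ (Fin (n + 1)), mfderiv (𝓡 (n + 1)) (𝓡 (n + 1)) ((fun v : TangentBundle (𝓡 (n + 1)) M => (triv u.proj v).2) ∘ (fibreIncl u.proj)) v = (triv u.proj).continuousLinearMapAt ℝ u.proj := by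
    intro v
    rw [h2]
    exact ContinuousLinearMap.mfderiv_eq (𝕜 := ℝ) (E := EuclideanSpace ℝ (Fin (n + 1))) (E' := EuclideanSpace ℝ (Fin (n + 1))) ((triv u.proj).continuousLinearMapAt ℝ u.proj) (x := v)
  have h5 := h.symm.trans (h3 _)
  have h4 : dFibreCoord u (vLift u w) = (triv u.proj).continuousLinearMapAt ℝ u.proj w := (DFunLike.congr_fun h5 w)
  unfold connMap
  rw [add_apply, ContinuousLinearMap.comp_apply, ContinuousLinearMap.comp_apply, dProj_vLift, map_zero, add_zero, h4]
  exact (triv u.proj).symmL_continuousLinearMapAt (R := ℝ) hx w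

theorem mdiff_extend (u : TangentBundle (𝓡 (n + 1)) M) : MDifferentiableAt (𝓡 (n + 1)) (𝓡 (n + 1)).tangent
      (fun x => (⟨x, extendField u x⟩ : TangentBundle (𝓡 (n + 1)) M)) u.proj :=
  FiberBundle.mdifferentiableAt_extend _ _ _

theorem extend_self (u : TangentBundle (𝓡 (n + 1)) M) : extendField u u.proj = u.2 :=
  FiberBundle.extend_apply_self _ _

theorem extend_self' (u : TangentBundle (𝓡 (n + 1)) M) : (⟨u.proj, extendField u u.proj⟩ : TangentBundle (𝓡 (n + 1)) M) = u :=
  congrArg (fun v => (⟨u.proj, v⟩ : TangentBundle (𝓡 (n + 1)) M)) (extend_self u)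

theorem dProj_dExt (u : TangentBundle (𝓡 (n + 1)) M) (w) : dProj u (dExtendField u w) = w := by
  have h := mfderiv_comp (I := 𝓡 (n + 1)) (I' := (𝓡 (n + 1)).tangent) (I'' := 𝓡 (n + 1))
    (f := (fun x => (⟨x, extendField u x⟩ : TangentBundle (𝓡 (n + 1)) M)))
    (g := fun v : TangentBundle (𝓡 (n + 1)) M => v.proj) u.proj
    ((contMDiff_proj _).mdifferentiableAt (n := ∞) (by simp)) (mdiff_extend u)
  have h2 : (fun v : TangentBundle (𝓡 (n + 1)) M => v.proj) ∘ (fun x => (⟨x, extendField u x⟩ : TangentBundle (𝓡 (n + 1)) M)) = id := rfl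
  rw [h2, mfderiv_id, extend_self] at h
  exact (DFunLike.congr_fun h w).symm

theorem dProj_hLift (cov : CovariantDerivative (𝓡 (n + 1)) (EuclideanSpace ℝ (Fin (n + 1)))
  (TangentSpace (𝓡 (n + 1)) : M → Type _)) (u : TangentBundle (𝓡 (n + 1)) M) (w) : dProj u (hLift cov u w) = w := by
  unfold hLift
  rw [sub_apply, ContinuousLinearMap.comp_apply, map_sub, dProj_vLift, sub_zero, dProj_dExt]

theorem dCoord_dExt (u : TangentBundle (𝓡 (n + 1)) M) (w) : dFibreCoord u (dExtendField u w) = 0 := by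
  have hx := FiberBundle.mem_baseSet_trivializationAt
    (EuclideanSpace ℝ (Fin (n + 1))) (TangentSpace (𝓡 (n + 1)) : M → Type _) u.proj
  have h := mfderiv_comp (I := 𝓡 (n + 1)) (I' := (𝓡 (n + 1)).tangent) (I'' := 𝓡 (n + 1))
    (f := (fun x => (⟨x, extendField u x⟩ : TangentBundle (𝓡 (n + 1)) M)))
    (g := fun v : TangentBundle (𝓡 (n + 1)) M => (triv u.proj v).2) u.proj
    (by rw [extend_self]; exact mdiff_coord u) (mdiff_extend u)
  have h2 : (fun v : TangentBundle (𝓡 (n + 1)) M => (triv u.proj v).2) ∘ (fun x => (⟨x, extendField u x⟩ : TangentBundle (𝓡 (n + 1)) M)) =ᶠ[𝓝 u.proj] fun _ => (triv u.proj u).2 := by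
    filter_upwards [(Trivialization.open_baseSet (triv u.proj)).mem_nhds hx] with x hx
    have := (triv u.proj).apply_mk_symm hx (triv u.proj u).2
    exact (congrArg Prod.snd this :)
  rw [h2.mfderiv_eq, mfderiv_const, extend_self] at h
  exact (DFunLike.congr_fun h w).symm

theorem connMap_hLift (cov : CovariantDerivative (𝓡 (n + 1)) (EuclideanSpace ℝ (Fin (n + 1)))
  (TangentSpace (𝓡 (n + 1)) : M → Type _)) (u : TangentBundle (𝓡 (n + 1)) M) (w) : connMap cov u (hLift cov u w) = 0 := by
  unfold hLift
  rw [sub_apply, ContinuousLinearMap.comp_apply, map_sub, connMap_vLift]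
  unfold connMap
  rw [add_apply, ContinuousLinearMap.comp_apply, ContinuousLinearMap.comp_apply, dCoord_dExt, dProj_dExt, map_zero]
  simp
end Lifts

section Riemannian

variable [RiemannianBundle (TangentSpace (𝓡 (n + 1)) : M → Type _)]
  [IsContMDiffRiemannianBundle (𝓡 (n + 1)) ∞ (EuclideanSpace ℝ (Fin (n + 1)))
    (TangentSpace (𝓡 (n + 1)) : M → Type _)]
  (o : ∀ x : M, Orientation ℝ (TangentSpace (𝓡 (n + 1)) x) (Fin (n + 1)))
  (cov : CovariantDerivative (𝓡 (n + 1)) (EuclideanSpace ℝ (Fin (n + 1)))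
    (TangentSpace (𝓡 (n + 1)) : M → Type _))

/-- The frames `e_0, …, e_n, e_0', …, e_n'` of `T_u T_M` in which `e_0, …, e_n` is a horizontal,
orthonormal and positively oriented frame (the horizontal lift of such a frame of `M`) and
`e_i'` is the vertical mirror of `e_i`. -/
def tangentFrames (u : TangentBundle (𝓡 (n + 1)) M) :
    Set (Fin (n + 1) ⊕ Fin (n + 1) → TangentSpace (𝓡 (n + 1)).tangent u) :=
  {p | ∃ b : OrthonormalBasis (Fin (n + 1)) ℝ (TangentSpace (𝓡 (n + 1)) u.proj),
    b.toBasis.orientation = o u.proj ∧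
    (∀ i, p (Sum.inl i) = hLift cov u (b i)) ∧ ∀ i, p (Sum.inr i) = vLift u (b i)}

/-- The adapted frames at `u ≠ 0`: those for which moreover `e_0` is the horizontal lift of
`u / ‖u‖`, so that `e_0'` is `ξ / ‖ξ‖`. -/
def adaptedFrames (u : TangentBundle (𝓡 (n + 1)) M) :
    Set (Fin (n + 1) ⊕ Fin (n + 1) → TangentSpace (𝓡 (n + 1)).tangent u) :=
  {p | ∃ b : OrthonormalBasis (Fin (n + 1)) ℝ (TangentSpace (𝓡 (n + 1)) u.proj),
    b.toBasis.orientation = o u.proj ∧ b 0 = ‖u.2‖⁻¹ • u.2 ∧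
    (∀ i, p (Sum.inl i) = hLift cov u (b i)) ∧ ∀ i, p (Sum.inr i) = vLift u (b i)}

/-- The Sasaki metric of `T_M`. -/
def sasaki (u : TangentBundle (𝓡 (n + 1)) M) (y z : TangentSpace (𝓡 (n + 1)).tangent u) : ℝ :=
  inner ℝ (dProj u y) (dProj u z) + inner ℝ (connMap cov u y) (connMap cov u z)

/-- The tautological vertical vector field. -/
def xi (u : TangentBundle (𝓡 (n + 1)) M) : TangentSpace (𝓡 (n + 1)).tangent u := vLift u u.2

/-- The Sasaki orthogonal projection of `T_u T_M` onto the hyperplane orthogonal to `ξ_u`. -/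
def projXiPerp (u : TangentBundle (𝓡 (n + 1)) M) (y : TangentSpace (𝓡 (n + 1)).tangent u) :
    TangentSpace (𝓡 (n + 1)).tangent u :=
  y - (sasaki cov u y (xi u) / sasaki cov u (xi u) (xi u)) • xi u

variable {s : ℝ} [Fact (0 < s)]

/-- The differential of the inclusion of the sphere bundle in `T_M`. -/
def dIncl (p : SphereBundle n M s) :
    TangentSpace ((𝓡 (n + 1)).prod (𝓡 n)) p →L[ℝ] TangentSpace (𝓡 (n + 1)).tangent p.1 :=
  mfderiv ((𝓡 (n + 1)).prod (𝓡 n)) (𝓡 (n + 1)).tangent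
    (fun q : SphereBundle n M s => q.1) p

/-- The frames `e_0, …, e_n, e_1', …, e_n'` of the sphere bundle `𝒮`, tangent to `𝒮`, obtained
from the adapted frames of `T_M` by leaving out the normal vector `ξ / ‖ξ‖`. -/
def sphereFrames (p : SphereBundle n M s) :
    Set (Fin (n + 1) ⊕ Fin n → TangentSpace ((𝓡 (n + 1)).prod (𝓡 n)) p) :=
  {e | ∃ e' ∈ adaptedFrames o cov p.1, (∀ i, dIncl p (e (Sum.inl i)) = e' (Sum.inl i)) ∧
    ∀ i : Fin n, dIncl p (e (Sum.inr i)) = e' (Sum.inr i.succ)}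

/-- The `T𝒮`-valued correction of `∇^*`: the vector field `Z` of `𝒮` is derived by `∇^*` as
a vector field along the inclusion in `T_M`, and the result is projected orthogonally to
`T𝒮 = ξ^⊥` (where it is read through the inverse of the injective differential of the inclusion). -/
def sphereCov (Z : ∀ p : SphereBundle n M s, TangentSpace ((𝓡 (n + 1)).prod (𝓡 n)) p)
    (p : SphereBundle n M s) (y : TangentSpace ((𝓡 (n + 1)).prod (𝓡 n)) p) :
    TangentSpace ((𝓡 (n + 1)).prod (𝓡 n)) p :=
  (dIncl p).toLinearMap.leftInverse
    (projXiPerp cov p.1 (nablaStarAlong cov ((𝓡 (n + 1)).prod (𝓡 n))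
      (fun q : SphereBundle n M s => q.1) (fun q => dIncl q (Z q)) p y))

end Riemannian

end Geometry

end TangentManifold

end

open TangentManifold

/-!
Everything is reduced to `M` by the splitting `T T_M = H ⊕ V`. The pull-back connection along a map
`f : N → M` (`covAlong`) satisfies the Leibniz rule, is local and is compatible with the metric
(`covAlong_smul`, `covAlong_congr`, `covAlong_metric`), and `∇^*` of a horizontal or a vertical lift
is the lift of the pull-back derivative (`nablaStarAlong_hLift`, `nablaStarAlong_vLift`). The last
two facts give the connection matrices of `∇^*` in all the frames considered.

*Structure groups.* A frame that lifts the oriented orthonormal basis `b` is transformed by a matrix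
`g ⊕ g` as `b` is by `g` (`IsLiftOf.frameAct`), and `SO(n+1)` acts simply transitively on the oriented
orthonormal bases. The matrices that preserve the first basis vector are those of the form `1 ⊕ h`
(`exists_fixFirst_of_col`), which gives the group `SO(n)` for the adapted frames. Smooth local
sections are lifts of local orthonormal frames of `M`, obtained by the Gram-Schmidt process
(`exists_orthonormal_fields`). An adapted one arises by rotating such a frame at `u` in the plane of
its first vector and `u / ‖u‖` (`exists_adapted_fields`); the rotation is an explicit matrix, smooth
as long as these two vectors are not opposite. Lifts of smooth families are smooth
(`contMDiffAt_hLift`, `contMDiffAt_vLift`). For the sphere bundle, the tangent space is identified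
with `ξ^⊥` by a count of dimensions, since `‖u‖²` is constant along it (`mem_range_dIncl_iff`), and
adapted frames are brought into it smoothly by the differential of the radial projection.

*Reducibility.* In a frame lifting `b`, the connection matrix of `∇^*` is `A ⊕ A`, where `A` is the
matrix of the pull-back of `∇` in `b`. It is skew-symmetric as `∇` is metric, and the exponential of
a skew-symmetric matrix is a rotation.

*Non-reducibility.* If the group fixes the `j`-th basis vector, its Lie algebra annihilates this
vector, so the `j`-th vector field of each section of the structure would be parallel
(`frameAct_eq_zero_of_col`). On the complement of the zero section, the vertical field `ξ / ‖ξ‖` has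
the derivative `w^v / ‖u‖ ≠ 0` along `w^v`, for `0 ≠ w ⊥ u`. On the sphere bundle, the horizontal
field `(u / s)^h` has the derivative `w^h / s` along the same vector; this derivative is tangent to
the sphere bundle and therefore not altered by the projection. Such a `w` exists because `dim M ≥ 2`.
-/

noncomputable section

namespace TangentManifold

set_option linter.unusedSectionVars false

/-! ### The pull-back connection -/

section PullbackCalculus

variable {n : ℕ} {M : Type*} [TopologicalSpace M]
  [ChartedSpace (EuclideanSpace ℝ (Fin (n + 1))) M] [IsManifold (𝓡 (n + 1)) ∞ M]
  {F H N : Type*} [NormedAddCommGroup F] [NormedSpace ℝ F] [TopologicalSpace H]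
  {J : ModelWithCorners ℝ F H} [TopologicalSpace N] [ChartedSpace H N]
  (cov : CovariantDerivative (𝓡 (n + 1)) (EuclideanSpace ℝ (Fin (n + 1)))
    (TangentSpace (𝓡 (n + 1)) : M → Type _))

local notation "triv" => trivializationAt (EuclideanSpace ℝ (Fin (n + 1)))
  (TangentSpace (𝓡 (n + 1)) : M → Type _)

/-- A section `a` of the pull-back `f^* TM`, as a map into the total space `T_M`. -/
abbrev alongMap (f : N → M) (a : ∀ q, TangentSpace (𝓡 (n + 1)) (f q)) :
    N → TangentBundle (𝓡 (n + 1)) M := fun q => ⟨f q, a q⟩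

variable (J) in
/-- The pull-back connection `f^*∇`, for a section `a` of `f^* TM`. -/
def covAlong (f : N → M) (a : ∀ q, TangentSpace (𝓡 (n + 1)) (f q)) (p : N) :
    TangentSpace J p →L[ℝ] TangentSpace (𝓡 (n + 1)) (f p) :=
  pullbackCov cov J (alongMap f a) p

/-- The coordinates of a section of `f^* TM` in the trivialization of `TM` around `x`. -/
def coordAlong (x : M) (f : N → M) (a : ∀ q, TangentSpace (𝓡 (n + 1)) (f q)) (q : N) :
    EuclideanSpace ℝ (Fin (n + 1)) :=
  ((triv x) (alongMap f a q)).2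

theorem mem_base (x : M) : x ∈ (triv x).baseSet :=
  FiberBundle.mem_baseSet_trivializationAt
    (EuclideanSpace ℝ (Fin (n + 1))) (TangentSpace (𝓡 (n + 1)) : M → Type _) x

variable {cov} {f : N → M} {a b : ∀ q, TangentSpace (𝓡 (n + 1)) (f q)} {p : N}

theorem mdifferentiableAt_alongMap_iff :
    MDifferentiableAt J (𝓡 (n + 1)).tangent (alongMap f a) p ↔
      MDifferentiableAt J (𝓡 (n + 1)) f p ∧
      MDifferentiableAt J 𝓘(ℝ, EuclideanSpace ℝ (Fin (n + 1))) (coordAlong (f p) f a) p :=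
  mdifferentiableAt_totalSpace _ _

theorem covAlong_apply (ha : MDifferentiableAt J (𝓡 (n + 1)).tangent (alongMap f a) p)
    (y : TangentSpace J p) :
    covAlong J cov f a p y = (triv (f p)).symmL ℝ (f p) (mvfderiv J (coordAlong (f p) f a) p y) +
      cov (extendField (alongMap f a p)) (f p) (mfderiv J (𝓡 (n + 1)) f p y) := by
  have h1 := mfderiv_comp (I := J) (I' := (𝓡 (n + 1)).tangent) (I'' := 𝓡 (n + 1)) p
    (f := alongMap f a) (g := fun v : TangentBundle (𝓡 (n + 1)) M => v.proj)
    ((contMDiff_proj _).mdifferentiableAt (n := ∞) (by simp)) ha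
  have h2 := mfderiv_comp (I := J) (I' := (𝓡 (n + 1)).tangent) (I'' := 𝓡 (n + 1)) p
    (f := alongMap f a) (g := fun v : TangentBundle (𝓡 (n + 1)) M => ((triv (f p)) v).2)
    (mdiff_coord (alongMap f a p)) ha
  have h1' := DFunLike.congr_fun h1 y
  have h2' := DFunLike.congr_fun h2 y
  exact (congrArg₂ (fun v w => (triv (f p)).symmL ℝ (f p) v +
    cov (extendField (alongMap f a p)) (f p) w) h2' h1').symm

theorem eventually_mem_base (hf : ContinuousAt f p) : ∀ᶠ q in 𝓝 p, f q ∈ (triv (f p)).baseSet :=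
  hf ((triv (f p)).open_baseSet.mem_nhds (mem_base (f p)))

theorem coordAlong_add {x : M} {q : N} (hq : f q ∈ (triv x).baseSet) :
    coordAlong x f (fun q => a q + b q) q = coordAlong x f a q + coordAlong x f b q :=
  (Trivialization.linear ℝ (triv x) hq).map_add (a q) (b q)

theorem coordAlong_smul {x : M} {q : N} (c : N → ℝ) (hq : f q ∈ (triv x).baseSet) :
    coordAlong x f (fun q => c q • a q) q = c q • coordAlong x f a q :=
  (Trivialization.linear ℝ (triv x) hq).map_smul (c q) (a q)

theorem mdifferentiableAt_alongMap_add
    (ha : MDifferentiableAt J (𝓡 (n + 1)).tangent (alongMap f a) p)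
    (hb : MDifferentiableAt J (𝓡 (n + 1)).tangent (alongMap f b) p) :
    MDifferentiableAt J (𝓡 (n + 1)).tangent (alongMap f fun q => a q + b q) p := by
  rw [mdifferentiableAt_alongMap_iff] at *
  refine ⟨ha.1, (ha.2.add hb.2).congr_of_eventuallyEq ?_⟩
  filter_upwards [eventually_mem_base (n := n) ha.1.continuousAt] with q hq using coordAlong_add hq

theorem mdifferentiableAt_alongMap_smul {c : N → ℝ} (hc : MDifferentiableAt J 𝓘(ℝ, ℝ) c p)
    (ha : MDifferentiableAt J (𝓡 (n + 1)).tangent (alongMap f a) p) :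
    MDifferentiableAt J (𝓡 (n + 1)).tangent (alongMap f fun q => c q • a q) p := by
  rw [mdifferentiableAt_alongMap_iff] at *
  refine ⟨ha.1, (hc.smul ha.2).congr_of_eventuallyEq ?_⟩
  filter_upwards [eventually_mem_base (n := n) ha.1.continuousAt] with q hq using coordAlong_smul c hq

theorem extendField_add {x : M} (v w : TangentSpace (𝓡 (n + 1)) x) :
    ∀ᶠ z in 𝓝 x, extendField ⟨x, v + w⟩ z = extendField ⟨x, v⟩ z + extendField ⟨x, w⟩ z := by
  filter_upwards [(triv x).open_baseSet.mem_nhds (mem_base x)] with z hz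
  have h1 := (Trivialization.linear ℝ (triv x) (mem_base x)).map_add v w
  change (triv x).symm z (((triv x) ⟨x, v + w⟩).2) = (triv x).symm z (((triv x) ⟨x, v⟩).2) +
    (triv x).symm z (((triv x) ⟨x, w⟩).2)
  rw [h1, ← Trivialization.coe_symmₗ (R := ℝ) (triv x) hz]
  exact ((triv x).symmₗ ℝ z).map_add _ _

theorem extendField_smul {x : M} (c : ℝ) (v : TangentSpace (𝓡 (n + 1)) x) :
    ∀ᶠ z in 𝓝 x, extendField ⟨x, c • v⟩ z = c • extendField ⟨x, v⟩ z := by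
  filter_upwards [(triv x).open_baseSet.mem_nhds (mem_base x)] with z hz
  change (triv x).symm z (((triv x) ⟨x, c • v⟩).2) = c • (triv x).symm z (((triv x) ⟨x, v⟩).2)
  have h1 := (Trivialization.linear ℝ (triv x) (mem_base x)).map_smul c v
  rw [h1, ← Trivialization.coe_symmₗ (R := ℝ) (triv x) hz]
  exact ((triv x).symmₗ ℝ z).map_smul _ _

theorem mdiff_extendField {x : M} (v : TangentSpace (𝓡 (n + 1)) x) :
    MDifferentiableAt (𝓡 (n + 1)) (𝓡 (n + 1)).tangent (alongMap (fun z => z) (extendField ⟨x, v⟩)) x :=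
  mdiff_extend ⟨x, v⟩

theorem cov_extendField_add {x : M} (v w : TangentSpace (𝓡 (n + 1)) x) :
    cov (extendField ⟨x, v + w⟩) x = cov (extendField ⟨x, v⟩) x + cov (extendField ⟨x, w⟩) x := by
  rw [← cov.isCovariantDerivativeOnUniv.add (mdiff_extendField v) (mdiff_extendField w)]
  exact cov.isCovariantDerivativeOnUniv.congr_of_eventuallyEq (mdiff_extendField (v + w))
    (mdifferentiableAt_alongMap_add (f := fun z => z) (mdiff_extendField v) (mdiff_extendField w)) Filter.univ_mem
    (extendField_add v w)

theorem cov_extendField_smul {x : M} (c : ℝ) (v : TangentSpace (𝓡 (n + 1)) x) :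
    cov (extendField ⟨x, c • v⟩) x = c • cov (extendField ⟨x, v⟩) x := by
  rw [← cov.isCovariantDerivativeOnUniv.smul_const c (mdiff_extendField v)]
  exact cov.isCovariantDerivativeOnUniv.congr_of_eventuallyEq (mdiff_extendField (c • v))
    (mdifferentiableAt_alongMap_smul (f := fun z => z) mdifferentiableAt_const (mdiff_extendField v)) Filter.univ_mem
    (extendField_smul c v)

theorem mvfderiv_congr {E' : Type*} [NormedAddCommGroup E'] [NormedSpace ℝ E'] {g g' : N → E'}
    (h : g =ᶠ[𝓝 p] g') (y : TangentSpace J p) : mvfderiv J g p y = mvfderiv J g' p y := 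
  DFunLike.congr_fun (h.mfderiv_eq (I := J) (I' := 𝓘(ℝ, E'))) y

/-- The pull-back connection is local. -/
theorem covAlong_congr (hb : MDifferentiableAt J (𝓡 (n + 1)).tangent (alongMap f b) p)
    (h : ∀ᶠ q in 𝓝 p, a q = b q) : covAlong J cov f a p = covAlong J cov f b p := by
  have h1 : alongMap f a =ᶠ[𝓝 p] alongMap f b := h.mono fun q hq => by simp only [alongMap, hq]
  have h2 : coordAlong (f p) f a =ᶠ[𝓝 p] coordAlong (f p) f b :=
    h.mono fun q hq => by simp only [coordAlong, alongMap, hq]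
  ext1 y
  rw [covAlong_apply hb, covAlong_apply (hb.congr_of_eventuallyEq h1), mvfderiv_congr h2]
  simp only [alongMap]
  rw [h.self_of_nhds]

theorem covAlong_add (ha : MDifferentiableAt J (𝓡 (n + 1)).tangent (alongMap f a) p)
    (hb : MDifferentiableAt J (𝓡 (n + 1)).tangent (alongMap f b) p) (y : TangentSpace J p) :
    covAlong J cov f (fun q => a q + b q) p y =
      covAlong J cov f a p y + covAlong J cov f b p y := by
  have hf := (mdifferentiableAt_alongMap_iff.1 ha).1
  have h : coordAlong (f p) f (fun q => a q + b q) =ᶠ[𝓝 p]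
      coordAlong (f p) f a + coordAlong (f p) f b := by
    filter_upwards [eventually_mem_base (n := n) hf.continuousAt] with q hq using coordAlong_add hq
  rw [covAlong_apply ha, covAlong_apply hb, covAlong_apply (mdifferentiableAt_alongMap_add ha hb),
    mvfderiv_congr h, mvfderiv_add (mdifferentiableAt_alongMap_iff.1 ha).2
      (mdifferentiableAt_alongMap_iff.1 hb).2]
  simp only [alongMap]
  rw [cov_extendField_add, add_apply, add_apply, map_add]
  abel

/-- The Leibniz rule for the pull-back connection. -/
theorem covAlong_smul {c : N → ℝ} (hc : MDifferentiableAt J 𝓘(ℝ, ℝ) c p)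
    (ha : MDifferentiableAt J (𝓡 (n + 1)).tangent (alongMap f a) p) (y : TangentSpace J p) :
    covAlong J cov f (fun q => c q • a q) p y =
      c p • covAlong J cov f a p y + mvfderiv J c p y • a p := by
  have hf := (mdifferentiableAt_alongMap_iff.1 ha).1
  have h : coordAlong (f p) f (fun q => c q • a q) =ᶠ[𝓝 p] c • coordAlong (f p) f a := by
    filter_upwards [eventually_mem_base (n := n) hf.continuousAt] with q hq using coordAlong_smul c hq
  rw [covAlong_apply ha, covAlong_apply (mdifferentiableAt_alongMap_smul hc ha),
    mvfderiv_congr h, mvfderiv_smul hc (mdifferentiableAt_alongMap_iff.1 ha).2]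
  simp only [alongMap]
  have h2 : (triv (f p)).symmL ℝ (f p) (coordAlong (f p) f a p) = a p := by
    rw [Trivialization.symmL_apply _ (mem_base (f p))]
    exact (triv (f p)).symm_apply_apply_mk (mem_base (f p)) (a p)
  rw [cov_extendField_smul, add_apply, ContinuousLinearMap.smulRight_apply, smul_apply, smul_apply,
    map_add, map_smul, map_smul, h2]
  module

/-- On vector fields of `M`, the connection `∇` is the derivative of the coordinates in the
trivialization around `x`, corrected by the derivative under `∇` of a vector field that is constant
in this trivialization. -/
theorem cov_eq_coord (σ : ∀ x : M, TangentSpace (𝓡 (n + 1)) x) {x : M}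
    (hσ : MDifferentiableAt (𝓡 (n + 1)) (𝓡 (n + 1)).tangent (alongMap (fun z => z) σ) x) :
    cov σ x = (triv x).symmL ℝ x ∘L mvfderiv (𝓡 (n + 1)) (coordAlong x (fun z => z) σ) x +
      cov (extendField ⟨x, σ x⟩) x := by
  -- the difference of two connections is tensorial
  have hT : TensorialAt (𝓡 (n + 1)) (EuclideanSpace ℝ (Fin (n + 1)))
      (fun σ : ∀ x : M, TangentSpace (𝓡 (n + 1)) x =>
        cov σ x - covAlong (𝓡 (n + 1)) cov (fun z => z) σ x) x := by
    constructor
    · intro g τ hg hτ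
      ext1 y
      have h1 := covAlong_smul (cov := cov) (f := fun z => z) hg hτ y
      have h2 := DFunLike.congr_fun (cov.isCovariantDerivativeOnUniv.leibniz hτ hg) y
      change cov (g • τ) x y - covAlong (𝓡 (n + 1)) cov (fun z => z) (fun q => g q • τ q) x y = _
      rw [h1, h2]
      simp only [add_apply, smul_apply, sub_apply, ContinuousLinearMap.smulRight_apply]
      module
    · intro τ τ' hτ hτ'
      ext1 y
      have h1 := covAlong_add (cov := cov) (f := fun z => z) hτ hτ' y
      have h2 := DFunLike.congr_fun (cov.isCovariantDerivativeOnUniv.add hτ hτ') y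
      change cov (τ + τ') x y - covAlong (𝓡 (n + 1)) cov (fun z => z) (fun q => τ q + τ' q) x y = _
      rw [h1, h2]
      simp only [add_apply, sub_apply]
      module
  have h1 := hT.pointwise hσ (mdiff_extendField (σ x)) (extend_self ⟨x, σ x⟩).symm
  have key : ∀ τ : ∀ x : M, TangentSpace (𝓡 (n + 1)) x,
      MDifferentiableAt (𝓡 (n + 1)) (𝓡 (n + 1)).tangent (alongMap (fun z => z) τ) x →
      covAlong (𝓡 (n + 1)) cov (fun z => z) τ x =
        (triv x).symmL ℝ x ∘L mvfderiv (𝓡 (n + 1)) (coordAlong x (fun z => z) τ) x +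
        cov (extendField ⟨x, τ x⟩) x := by
    intro τ hτ
    ext1 y
    have h := mfderiv_id (I := 𝓡 (n + 1)) (x := x)
    rw [covAlong_apply hτ]
    exact congrArg (fun L : TangentSpace (𝓡 (n + 1)) x →L[ℝ] TangentSpace (𝓡 (n + 1)) x =>
      (triv x).symmL ℝ x (mvfderiv (𝓡 (n + 1)) (coordAlong x (fun z => z) τ) x y) +
        cov (extendField ⟨x, τ x⟩) x (L y)) h
  have h2 : coordAlong x (fun z => z) (extendField ⟨x, σ x⟩) =ᶠ[𝓝 x] fun _ => ((triv x) ⟨x, σ x⟩).2 := by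
    filter_upwards [(triv x).open_baseSet.mem_nhds (mem_base x)] with z hz
    have h := congrArg Prod.snd ((triv x).apply_mk_symm hz ((triv x) ⟨x, σ x⟩).2)
    exact h
  have h3 : mvfderiv (𝓡 (n + 1)) (coordAlong x (fun z => z) (extendField ⟨x, σ x⟩)) x = 0 := by
    ext1 y
    rw [mvfderiv_congr h2, mvfderiv_const]
  rw [key σ hσ, key _ (mdiff_extendField (σ x)), h3, extend_self ⟨x, σ x⟩] at h1
  have h4 : (triv x).symmL ℝ x ∘L (0 : TangentSpace (𝓡 (n + 1)) x →L[ℝ] _) = 0 :=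
    ContinuousLinearMap.comp_zero _
  rw [h4, zero_add, sub_self] at h1
  exact sub_eq_zero.1 h1

/-- The pull-back connection on the pull-back of a vector field. -/
theorem covAlong_comp (σ : ∀ x : M, TangentSpace (𝓡 (n + 1)) x)
    (hf : MDifferentiableAt J (𝓡 (n + 1)) f p)
    (hσ : MDifferentiableAt (𝓡 (n + 1)) (𝓡 (n + 1)).tangent (alongMap (fun z => z) σ) (f p))
    (y : TangentSpace J p) :
    covAlong J cov f (fun q => σ (f q)) p y = cov σ (f p) (mfderiv J (𝓡 (n + 1)) f p y) := by
  have h1 : MDifferentiableAt J (𝓡 (n + 1)).tangent (alongMap f fun q => σ (f q)) p :=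
    hσ.comp p hf
  have h2 := mfderiv_comp_apply (I := J) p (mdifferentiableAt_alongMap_iff.1 hσ).2 hf y
  rw [covAlong_apply h1, cov_eq_coord σ hσ, add_apply]
  congr 1
  exact congrArg _ h2

theorem connMap_mfderiv_field (σ : ∀ x : M, TangentSpace (𝓡 (n + 1)) x) {x : M}
    (hσ : MDifferentiableAt (𝓡 (n + 1)) (𝓡 (n + 1)).tangent (alongMap (fun z => z) σ) x)
    (w : TangentSpace (𝓡 (n + 1)) x) :
    connMap cov ⟨x, σ x⟩ (mfderiv (𝓡 (n + 1)) (𝓡 (n + 1)).tangent (alongMap (fun z => z) σ) x w)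
      = cov σ x w := by
  have h := covAlong_comp (cov := cov) (J := 𝓡 (n + 1)) (f := fun z => z) (p := x) σ mdifferentiableAt_id hσ w
  have h2 := mfderiv_id (I := 𝓡 (n + 1)) (x := x)
  exact h.trans (congrArg (fun L : TangentSpace (𝓡 (n + 1)) x →L[ℝ] TangentSpace (𝓡 (n + 1)) x =>
    cov σ x (L w)) h2)

end PullbackCalculus

/-! ### Smooth sections of a vector bundle along a map -/

section SectionsAlongMaps

variable {FN HN N : Type*} [NormedAddCommGroup FN] [NormedSpace ℝ FN] [TopologicalSpace HN]
  {J : ModelWithCorners ℝ FN HN} [TopologicalSpace N] [ChartedSpace HN N]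
  {EB HB B : Type*} [NormedAddCommGroup EB] [NormedSpace ℝ EB] [TopologicalSpace HB]
  {IB : ModelWithCorners ℝ EB HB} [TopologicalSpace B] [ChartedSpace HB B]
  {F : Type*} [NormedAddCommGroup F] [NormedSpace ℝ F]
  {E : B → Type*} [TopologicalSpace (TotalSpace F E)]
  [∀ x, AddCommGroup (E x)] [∀ x, Module ℝ (E x)] [∀ x, TopologicalSpace (E x)]
  [FiberBundle F E] [VectorBundle ℝ F E]
  {f : N → B} {v w : ∀ q, E (f q)} {s : Set N} {p : N} {k : WithTop ℕ∞}

theorem _root_.ContMDiffWithinAt.eventually_mem_baseSet (hf : ContinuousWithinAt f s p) :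
    ∀ᶠ q in 𝓝[s] p, f q ∈ (trivializationAt F E (f p)).baseSet :=
  hf ((trivializationAt F E (f p)).open_baseSet.mem_nhds
    (FiberBundle.mem_baseSet_trivializationAt' (f p)))

/-- The sum of two smooth sections of a bundle along a map is smooth. -/
theorem _root_.ContMDiffWithinAt.add_along
    (hv : ContMDiffWithinAt J (IB.prod 𝓘(ℝ, F)) k (fun q => (⟨f q, v q⟩ : TotalSpace F E)) s p)
    (hw : ContMDiffWithinAt J (IB.prod 𝓘(ℝ, F)) k (fun q => (⟨f q, w q⟩ : TotalSpace F E)) s p) :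
    ContMDiffWithinAt J (IB.prod 𝓘(ℝ, F)) k
      (fun q => (⟨f q, v q + w q⟩ : TotalSpace F E)) s p := by
  rw [contMDiffWithinAt_totalSpace] at *
  refine ⟨hv.1, (hv.2.add hw.2).congr_of_eventuallyEq ?_ ?_⟩
  · filter_upwards [ContMDiffWithinAt.eventually_mem_baseSet (E := E) (F := F)
      hv.1.continuousWithinAt] with q hq
    exact (Trivialization.linear ℝ _ hq).map_add (v q) (w q)
  · exact (Trivialization.linear ℝ _ (FiberBundle.mem_baseSet_trivializationAt' _)).map_add _ _

/-- The product of a smooth function and a smooth section of a bundle along a map is smooth. -/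
theorem _root_.ContMDiffWithinAt.smul_along {c : N → ℝ} (hc : ContMDiffWithinAt J 𝓘(ℝ, ℝ) k c s p)
    (hv : ContMDiffWithinAt J (IB.prod 𝓘(ℝ, F)) k (fun q => (⟨f q, v q⟩ : TotalSpace F E)) s p) :
    ContMDiffWithinAt J (IB.prod 𝓘(ℝ, F)) k
      (fun q => (⟨f q, c q • v q⟩ : TotalSpace F E)) s p := by
  rw [contMDiffWithinAt_totalSpace] at *
  refine ⟨hv.1, (hc.smul hv.2).congr_of_eventuallyEq ?_ ?_⟩
  · filter_upwards [ContMDiffWithinAt.eventually_mem_baseSet (E := E) (F := F)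
      hv.1.continuousWithinAt] with q hq
    exact (Trivialization.linear ℝ _ hq).map_smul (c q) (v q)
  · exact (Trivialization.linear ℝ _ (FiberBundle.mem_baseSet_trivializationAt' _)).map_smul _ _

theorem _root_.ContMDiffWithinAt.zero_along (hf : ContMDiffWithinAt J IB k f s p) :
    ContMDiffWithinAt J (IB.prod 𝓘(ℝ, F)) k (fun q => (⟨f q, 0⟩ : TotalSpace F E)) s p := by
  rw [contMDiffWithinAt_totalSpace]
  refine ⟨hf, (contMDiffWithinAt_const (c := 0)).congr_of_eventuallyEq ?_ ?_⟩
  · filter_upwards [ContMDiffWithinAt.eventually_mem_baseSet (E := E) (F := F)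
      hf.continuousWithinAt] with q hq
    exact (Trivialization.linear ℝ _ hq).map_zero
  · exact (Trivialization.linear ℝ _ (FiberBundle.mem_baseSet_trivializationAt' _)).map_zero

theorem _root_.ContMDiffWithinAt.sum_along {ι : Type*} (t : Finset ι) {V : ι → ∀ q, E (f q)}
    (hf : ContMDiffWithinAt J IB k f s p)
    (hV : ∀ i ∈ t, ContMDiffWithinAt J (IB.prod 𝓘(ℝ, F)) k
      (fun q => (⟨f q, V i q⟩ : TotalSpace F E)) s p) :
    ContMDiffWithinAt J (IB.prod 𝓘(ℝ, F)) k
      (fun q => (⟨f q, ∑ i ∈ t, V i q⟩ : TotalSpace F E)) s p := by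
  classical
  induction t using Finset.induction_on with
  | empty => simpa using ContMDiffWithinAt.zero_along hf
  | insert a t ha ih =>
    simp only [Finset.sum_insert ha]
    exact (hV a (Finset.mem_insert_self _ _)).add_along
      (ih fun i hi => hV i (Finset.mem_insert_of_mem hi))

end SectionsAlongMaps

/-! ### The splitting of the tangent bundle of `T_M` -/

section Splitting

variable {n : ℕ} {M : Type*} [TopologicalSpace M]
  [ChartedSpace (EuclideanSpace ℝ (Fin (n + 1))) M] [IsManifold (𝓡 (n + 1)) ∞ M]
  (cov : CovariantDerivative (𝓡 (n + 1)) (EuclideanSpace ℝ (Fin (n + 1)))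
    (TangentSpace (𝓡 (n + 1)) : M → Type _))

/-- The splitting `T_xM × T_xM ≃ T_u T_M`, `(v, w) ↦ v^h + w^v`, where `x = π u`. -/
def liftEquiv (u : TangentBundle (𝓡 (n + 1)) M) :
    (TangentSpace (𝓡 (n + 1)) u.proj × TangentSpace (𝓡 (n + 1)) u.proj) ≃ₗ[ℝ]
      TangentSpace (𝓡 (n + 1)).tangent u := by
  haveI : FiniteDimensional ℝ (TangentSpace (𝓡 (n + 1)) u.proj) :=
    inferInstanceAs (FiniteDimensional ℝ (EuclideanSpace ℝ (Fin (n + 1))))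
  haveI : FiniteDimensional ℝ (TangentSpace (𝓡 (n + 1)).tangent u) :=
    inferInstanceAs (FiniteDimensional ℝ
      (EuclideanSpace ℝ (Fin (n + 1)) × EuclideanSpace ℝ (Fin (n + 1))))
  refine LinearEquiv.ofBijective
    ((hLift cov u).toLinearMap.coprod (vLift u).toLinearMap) ?_
  have hinj : Function.Injective ((hLift cov u).toLinearMap.coprod (vLift u).toLinearMap) := by
    rw [← LinearMap.ker_eq_bot, LinearMap.ker_eq_bot']
    rintro ⟨v, w⟩ h
    have h' : hLift cov u v + vLift u w = 0 := h
    have h1 := congrArg (dProj u) h'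
    have h2 := congrArg (connMap cov u) h'
    rw [map_add, dProj_hLift, dProj_vLift, add_zero, map_zero] at h1
    rw [map_add, connMap_hLift, connMap_vLift, zero_add, map_zero] at h2
    rw [h1, h2]
    rfl
  exact ⟨hinj, (LinearMap.injective_iff_surjective_of_finrank_eq_finrank rfl).1 hinj⟩

theorem liftEquiv_apply (u : TangentBundle (𝓡 (n + 1)) M) (v w : TangentSpace (𝓡 (n + 1)) u.proj) :
    liftEquiv cov u (v, w) = hLift cov u v + vLift u w := rfl

/-- Every tangent vector of `T_M` is the sum of a horizontal and a vertical lift. -/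
theorem hLift_add_vLift (u : TangentBundle (𝓡 (n + 1)) M)
    (y : TangentSpace (𝓡 (n + 1)).tangent u) :
    hLift cov u (dProj u y) + vLift u (connMap cov u y) = y := by
  obtain ⟨⟨v, w⟩, rfl⟩ := (liftEquiv cov u).surjective y
  rw [liftEquiv_apply, map_add (dProj u), map_add (connMap cov u), dProj_hLift, dProj_vLift,
    connMap_hLift, connMap_vLift, add_zero, zero_add]

theorem ext_dProj_connMap {u : TangentBundle (𝓡 (n + 1)) M}
    {y z : TangentSpace (𝓡 (n + 1)).tangent u} (h1 : dProj u y = dProj u z)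
    (h2 : connMap cov u y = connMap cov u z) : y = z := by
  rw [← hLift_add_vLift cov u y, ← hLift_add_vLift cov u z, h1, h2]

/-- The horizontal lift in terms of an arbitrary vector field through the given point. -/
theorem hLift_eq_of_field (σ : ∀ x : M, TangentSpace (𝓡 (n + 1)) x) {x : M}
    (hσ : MDifferentiableAt (𝓡 (n + 1)) (𝓡 (n + 1)).tangent (alongMap (fun z => z) σ) x)
    (w : TangentSpace (𝓡 (n + 1)) x) :
    hLift cov ⟨x, σ x⟩ w =
      mfderiv (𝓡 (n + 1)) (𝓡 (n + 1)).tangent (alongMap (fun z => z) σ) x w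
        - vLift ⟨x, σ x⟩ (cov σ x w) := by
  apply ext_dProj_connMap cov
  · rw [dProj_hLift, map_sub, dProj_vLift, sub_zero]
    have h := mfderiv_comp_apply (I := 𝓡 (n + 1)) (I' := (𝓡 (n + 1)).tangent) (I'' := 𝓡 (n + 1)) x
      (f := alongMap (fun z => z) σ) (g := fun v : TangentBundle (𝓡 (n + 1)) M => v.proj)
      ((contMDiff_proj _).mdifferentiableAt (n := ∞) (by simp)) hσ w
    have h2 := mfderiv_id (I := 𝓡 (n + 1)) (x := x)
    exact (DFunLike.congr_fun h2 w).symm.trans h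
  · have h := connMap_mfderiv_field (cov := cov) σ hσ w
    rw [connMap_hLift, map_sub, connMap_vLift]
    exact (sub_eq_zero.2 h).symm

end Splitting

/-! ### Smoothness of the lifts -/

section SmoothLifts

variable {n : ℕ} {M : Type*} [TopologicalSpace M]
  [ChartedSpace (EuclideanSpace ℝ (Fin (n + 1))) M] [IsManifold (𝓡 (n + 1)) ∞ M]
  {FN HN N : Type*} [NormedAddCommGroup FN] [NormedSpace ℝ FN] [TopologicalSpace HN]
  {J : ModelWithCorners ℝ FN HN} [TopologicalSpace N] [ChartedSpace HN N] [IsManifold J ∞ N]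
  {c : N → TangentBundle (𝓡 (n + 1)) M} {b : ∀ q, TangentSpace (𝓡 (n + 1)) (c q).proj} {p : N}

theorem tangentBundle_mk_congr {u v : TangentBundle (𝓡 (n + 1)) M} (h : u = v)
    {y z : EuclideanSpace ℝ (Fin (n + 1)) × EuclideanSpace ℝ (Fin (n + 1))} (hyz : y = z) :
    (⟨u, y⟩ : TangentBundle (𝓡 (n + 1)).tangent (TangentBundle (𝓡 (n + 1)) M)) = ⟨v, z⟩ := by
  rw [h, hyz]

theorem mfderiv_line_eq_vLift (u : TangentBundle (𝓡 (n + 1)) M) (w : TangentSpace (𝓡 (n + 1)) u.proj) :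
    mfderiv 𝓘(ℝ, ℝ) (𝓡 (n + 1)).tangent
      (fun t : ℝ => (⟨u.proj, u.2 + t • w⟩ : TangentBundle (𝓡 (n + 1)) M)) 0 (1 : ℝ) =
    (vLift u w : EuclideanSpace ℝ (Fin (n + 1)) × EuclideanSpace ℝ (Fin (n + 1))) := by
  let w' : EuclideanSpace ℝ (Fin (n + 1)) := w
  let u' : EuclideanSpace ℝ (Fin (n + 1)) := u.2
  have h1 : HasFDerivAt (fun t : ℝ => u' + t • w')
      ((ContinuousLinearMap.id ℝ ℝ).smulRight w') 0 :=
    ((hasFDerivAt_id (𝕜 := ℝ) (0 : ℝ)).smul_const w').const_add u'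
  have h2 := h1.hasMFDerivAt
  have h3 : u' + (0 : ℝ) • w' = u' := by rw [zero_smul, add_zero]
  have h4 : MDifferentiableAt (𝓡 (n + 1)) (𝓡 (n + 1)).tangent (fibreIncl u.proj) (u' + (0 : ℝ) • w') :=
    (fibre_incl u.proj).mdifferentiableAt (by simp)
  have h5 := mfderiv_comp_apply (I := 𝓘(ℝ, ℝ)) (0 : ℝ) h4 h2.mdifferentiableAt (1 : ℝ)
  rw [h2.mfderiv] at h5
  refine h5.trans ?_
  have h6 : ((ContinuousLinearMap.id ℝ ℝ).smulRight w') 1 = w' := by simp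
  exact congrArg₂ (fun v z : EuclideanSpace ℝ (Fin (n + 1)) =>
    (mfderiv (𝓡 (n + 1)) (𝓡 (n + 1)).tangent (fibreIncl u.proj) v z :
      EuclideanSpace ℝ (Fin (n + 1)) × EuclideanSpace ℝ (Fin (n + 1)))) h3 h6

/-- The vertical lift of a smooth family of tangent vectors of `M` is smooth. -/
theorem contMDiffAt_vLift (hc : ContMDiffAt J (𝓡 (n + 1)).tangent ∞ c p)
    (hb : ContMDiffAt J (𝓡 (n + 1)).tangent ∞ (alongMap (fun q => (c q).proj) b) p) :
    ContMDiffAt J (𝓡 (n + 1)).tangent.tangent ∞ (fun q => (⟨c q, vLift (c q) (b q)⟩ :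
      TangentBundle (𝓡 (n + 1)).tangent (TangentBundle (𝓡 (n + 1)) M))) p := by
  let G : N → ℝ → TangentBundle (𝓡 (n + 1)) M := fun q t => ⟨(c q).proj, (c q).2 + t • b q⟩
  have hG : ContMDiffAt (J.prod 𝓘(ℝ, ℝ)) (𝓡 (n + 1)).tangent ∞ (Function.uncurry G) (p, 0) := by
    have h1 : ContMDiffAt (J.prod 𝓘(ℝ, ℝ)) (𝓡 (n + 1)).tangent ∞
        (fun z : N × ℝ => (⟨(c z.1).proj, (c z.1).2⟩ : TangentBundle (𝓡 (n + 1)) M)) (p, 0) :=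
      ContMDiffAt.comp (p, (0 : ℝ)) (g := c) (f := Prod.fst) hc contMDiffAt_fst
    have h2 : ContMDiffAt (J.prod 𝓘(ℝ, ℝ)) (𝓡 (n + 1)).tangent ∞
        (fun z : N × ℝ => (⟨(c z.1).proj, b z.1⟩ : TangentBundle (𝓡 (n + 1)) M)) (p, 0) :=
      ContMDiffAt.comp (p, (0 : ℝ)) (g := alongMap (fun q => (c q).proj) b) (f := Prod.fst) hb contMDiffAt_fst
    have h3 : ContMDiffAt (J.prod 𝓘(ℝ, ℝ)) 𝓘(ℝ, ℝ) ∞ (fun z : N × ℝ => z.2) (p, 0) :=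
      contMDiffAt_snd
    exact ContMDiffWithinAt.add_along h1 (ContMDiffWithinAt.smul_along h3 h2)
  have h0 : ∀ q, G q 0 = c q := fun q => by simp [G]
  have h1 := ContMDiffAt.mfderiv (m := ∞) G (fun _ => (0 : ℝ)) hG contMDiffAt_const (by simp)
  have h2 : ContMDiffAt J 𝓘(ℝ, ℝ).tangent ∞ (fun _ : N => (⟨0, 1⟩ : TangentBundle 𝓘(ℝ, ℝ) ℝ)) p :=
    contMDiffAt_const
  have h3 : ContMDiffAt J (𝓡 (n + 1)).tangent ∞ (fun q => G q 0) p := by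
    simp only [h0]; exact hc
  have h4 := ContMDiffAt.clm_apply_of_inCoordinates (b₁ := fun _ : N => (0 : ℝ))
    (b₂ := fun q => G q 0) (ϕ := fun q => mfderiv 𝓘(ℝ, ℝ) (𝓡 (n + 1)).tangent (G q) 0)
    (v := fun _ : N => (1 : ℝ)) h1 h2 h3
  exact h4.congr_of_eventuallyEq (Filter.Eventually.of_forall fun q =>
    tangentBundle_mk_congr (h0 q).symm (mfderiv_line_eq_vLift (c q) (b q)).symm)

/-- The horizontal lift of a smooth family of tangent vectors of `M` is smooth. Locally the base
points are `c q = ∑ i, a i q • X i (π (c q))` for vector fields `X i`, so that `∑ i, a i q • X i` is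
a family of vector fields through the points `c q`, by which the lifts can be computed. -/
theorem contMDiffAt_hLift {cov : CovariantDerivative (𝓡 (n + 1)) (EuclideanSpace ℝ (Fin (n + 1)))
    (TangentSpace (𝓡 (n + 1)) : M → Type _)}
    (hcov : CovariantDerivative.ContMDiffCovariantDerivative cov ∞)
    {ι : Type*} [Fintype ι] {X : ι → ∀ x : M, TangentSpace (𝓡 (n + 1)) x}
    (hX : ∀ i, ContMDiff (𝓡 (n + 1)) (𝓡 (n + 1)).tangent ∞ (alongMap (fun z => z) (X i)))
    {a : ι → N → ℝ} (ha : ∀ i, ContMDiffAt J 𝓘(ℝ, ℝ) ∞ (a i) p)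
    (hca : ∀ᶠ q in 𝓝 p, (c q).2 = ∑ i, a i q • X i (c q).proj)
    (hc : ContMDiffAt J (𝓡 (n + 1)).tangent ∞ c p)
    (hb : ContMDiffAt J (𝓡 (n + 1)).tangent ∞ (alongMap (fun q => (c q).proj) b) p) :
    ContMDiffAt J (𝓡 (n + 1)).tangent.tangent ∞ (fun q => (⟨c q, hLift cov (c q) (b q)⟩ :
      TangentBundle (𝓡 (n + 1)).tangent (TangentBundle (𝓡 (n + 1)) M))) p := by
  have hπ : ContMDiffAt J (𝓡 (n + 1)) ∞ (fun q => (c q).proj) p :=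
    (contMDiff_proj _).contMDiffAt.comp p hc
  let σ : N → ∀ x : M, TangentSpace (𝓡 (n + 1)) x := fun q x => ∑ i, a i q • X i x
  let G : N → M → TangentBundle (𝓡 (n + 1)) M := fun q => alongMap (fun z => z) (σ q)
  have hG : ContMDiffAt (J.prod (𝓡 (n + 1))) (𝓡 (n + 1)).tangent ∞ (Function.uncurry G)
      (p, (c p).proj) := by
    refine ContMDiffWithinAt.sum_along _ contMDiffAt_snd fun i _ => ?_
    have h1 : ContMDiffAt (J.prod (𝓡 (n + 1))) 𝓘(ℝ, ℝ) ∞ (fun z : N × M => a i z.1)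
        (p, (c p).proj) :=
      ContMDiffAt.comp (p, (c p).proj) (g := a i) (f := Prod.fst) (ha i) contMDiffAt_fst
    have h2 : ContMDiffAt (J.prod (𝓡 (n + 1))) (𝓡 (n + 1)).tangent ∞
        (fun z : N × M => alongMap (fun z => z) (X i) z.2) (p, (c p).proj) :=
      ContMDiffAt.comp (p, (c p).proj) (f := Prod.snd) (hX i).contMDiffAt contMDiffAt_snd
    exact ContMDiffWithinAt.smul_along h1 h2
  have hσ : ∀ q x, MDifferentiableAt (𝓡 (n + 1)) (𝓡 (n + 1)).tangent
      (alongMap (fun z => z) (σ q)) x := fun q x => by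
    have h : ContMDiffAt (𝓡 (n + 1)) (𝓡 (n + 1)).tangent ∞ (alongMap (fun z => z) (σ q)) x :=
      ContMDiffWithinAt.sum_along _ contMDiffAt_id fun i _ =>
        ContMDiffWithinAt.smul_along contMDiffAt_const (hX i).contMDiffAt
    exact h.mdifferentiableAt (by simp)
  have hGc : ∀ᶠ q in 𝓝 p, G q (c q).proj = c q := hca.mono fun q hq =>
    (congrArg (fun v => (⟨(c q).proj, v⟩ : TangentBundle (𝓡 (n + 1)) M)) hq).symm
  have h1 := ContMDiffAt.mfderiv (m := ∞) G (fun q => (c q).proj) hG hπ (by simp)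
  have h3 : ContMDiffAt J (𝓡 (n + 1)).tangent ∞ (fun q => G q (c q).proj) p :=
    hc.congr_of_eventuallyEq hGc
  have h4 := ContMDiffAt.clm_apply_of_inCoordinates (b₁ := fun q => (c q).proj)
    (b₂ := fun q => G q (c q).proj)
    (ϕ := fun q => mfderiv (𝓡 (n + 1)) (𝓡 (n + 1)).tangent (G q) (c q).proj) (v := b) h1 hb h3
  -- the covariant derivative of the field `σ q` in the direction `b q`
  have hD : ∀ q, cov (σ q) (c q).proj (b q) = ∑ i, a i q • cov (X i) (c q).proj (b q) := by
    intro q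
    have hs : ∀ t : Finset ι, MDifferentiableAt (𝓡 (n + 1)) (𝓡 (n + 1)).tangent
        (alongMap (fun z => z) fun x => ∑ i ∈ t, a i q • X i x) (c q).proj ∧
        cov (fun x => ∑ i ∈ t, a i q • X i x) (c q).proj
        = ∑ i ∈ t, a i q • cov (X i) (c q).proj := by
      classical
      intro t
      induction t using Finset.induction_on with
      | empty =>
        simp only [Finset.sum_empty]
        exact ⟨mdifferentiableAt_zeroSection .., congrFun cov.zero _⟩
      | insert j t hj ih =>
        have hXj : MDifferentiableAt (𝓡 (n + 1)) (𝓡 (n + 1)).tangent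
            (alongMap (fun z => z) (X j)) (c q).proj :=
          (hX j).contMDiffAt.mdifferentiableAt (by simp)
        have hXj' := mdifferentiableAt_alongMap_smul (f := fun z => z)
          (c := fun _ => a j q) mdifferentiableAt_const hXj
        simp only [Finset.sum_insert hj]
        refine ⟨mdifferentiableAt_alongMap_add (f := fun z => z) hXj' ih.1, ?_⟩
        rw [← ih.2, ← cov.isCovariantDerivativeOnUniv.smul_const (a j q) hXj]
        exact cov.isCovariantDerivativeOnUniv.add hXj' ih.1
    have := DFunLike.congr_fun (hs Finset.univ).2 (b q)
    simpa using this
  have hDs : ContMDiffAt J (𝓡 (n + 1)).tangent ∞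
      (alongMap (fun q => (c q).proj) fun q => cov (σ q) (c q).proj (b q)) p := by
    simp only [hD]
    refine ContMDiffWithinAt.sum_along _ hπ fun i _ => ContMDiffWithinAt.smul_along (ha i) ?_
    have h5 := (hcov.contMDiff.contMDiff (σ := X i) ((hX i).contMDiffOn)).contMDiffAt
      (x := (c p).proj) Filter.univ_mem
    exact ContMDiffAt.clm_bundle_apply (b := fun q => (c q).proj)
      (ϕ := fun q => cov (X i) (c q).proj) (ContMDiffAt.comp p h5 hπ) hb
  have h6 := contMDiffAt_vLift hc hDs
  have h7 : ContMDiffAt J (𝓡 (n + 1)).tangent.tangent ∞ (fun q => (⟨c q,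
      mfderiv (𝓡 (n + 1)) (𝓡 (n + 1)).tangent (G q) (c q).proj (b q)⟩ :
      TangentBundle (𝓡 (n + 1)).tangent (TangentBundle (𝓡 (n + 1)) M))) p := by
    refine h4.congr_of_eventuallyEq (hGc.mono fun q hq => tangentBundle_mk_congr hq.symm rfl)
  have h8 := ContMDiffWithinAt.add_along h7
    (ContMDiffWithinAt.smul_along (contMDiffAt_const (c := (-1 : ℝ))) h6)
  refine ContMDiffAt.congr_of_eventuallyEq h8 (hca.mono fun q hq => ?_)
  refine congrArg (fun v => (⟨c q, v⟩ :
      TangentBundle (𝓡 (n + 1)).tangent (TangentBundle (𝓡 (n + 1)) M))) ?_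
  have h9 := hLift_eq_of_field cov (σ q) (hσ q (c q).proj) (b q)
  have h10 : (⟨(c q).proj, σ q (c q).proj⟩ : TangentBundle (𝓡 (n + 1)) M) = c q :=
    congrArg (fun v => (⟨(c q).proj, v⟩ : TangentBundle (𝓡 (n + 1)) M)) hq.symm
  have h11 := congrArg (fun u : TangentBundle (𝓡 (n + 1)) M =>
    (hLift cov u (b q : EuclideanSpace ℝ (Fin (n + 1))) :
      EuclideanSpace ℝ (Fin (n + 1)) × EuclideanSpace ℝ (Fin (n + 1)))) h10
  have h12 := congrArg (fun u : TangentBundle (𝓡 (n + 1)) M =>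
    (vLift u (cov (σ q) (c q).proj (b q) : EuclideanSpace ℝ (Fin (n + 1))) :
      EuclideanSpace ℝ (Fin (n + 1)) × EuclideanSpace ℝ (Fin (n + 1)))) h10
  refine (h11.symm.trans (h9.trans (congrArg (fun z => (mfderiv (𝓡 (n + 1)) (𝓡 (n + 1)).tangent
    (G q) (c q).proj (b q) : EuclideanSpace ℝ (Fin (n + 1)) × EuclideanSpace ℝ (Fin (n + 1))) - z)
      h12))).trans ?_
  exact (sub_eq_add_neg _ _).trans (congrArg _ (neg_one_smul ℝ _).symm)

end SmoothLifts

/-! ### Rotation matrices and their Lie algebras -/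

section MatrixGroups

variable {κ : Type*} [Fintype κ] [DecidableEq κ]

theorem frameAct_blockDiag_inl {k l V : Type*} [Fintype k] [DecidableEq k] [Fintype l]
    [DecidableEq l] [AddCommGroup V] [Module ℝ V] (p : k ⊕ l → V) (A : Matrix k k ℝ)
    (B : Matrix l l ℝ) (j : k) :
    frameAct p (blockDiag k l (A, B)) (Sum.inl j) = ∑ i, A i j • p (Sum.inl i) := by
  simp [frameAct, blockDiag]

theorem frameAct_blockDiag_inr {k l V : Type*} [Fintype k] [DecidableEq k] [Fintype l]
    [DecidableEq l] [AddCommGroup V] [Module ℝ V] (p : k ⊕ l → V) (A : Matrix k k ℝ)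
    (B : Matrix l l ℝ) (j : l) :
    frameAct p (blockDiag k l (A, B)) (Sum.inr j) = ∑ i, B i j • p (Sum.inr i) := by
  simp [frameAct, blockDiag]

section Exp

attribute [local instance] Matrix.linftyOpNormedRing Matrix.linftyOpNormedAlgebra

/-- The exponential of a skew-symmetric matrix is a rotation: its determinant is the square of
the determinant of the exponential of half the matrix. -/
theorem exp_mem_SO {k : ℕ} {A : Matrix (Fin k) (Fin k) ℝ} (hA : A.transpose = -A) :
    NormedSpace.exp A ∈ SO k := by
  have horth : ∀ B : Matrix (Fin k) (Fin k) ℝ, B.transpose = -B →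
      NormedSpace.exp B * (NormedSpace.exp B).transpose = 1 := by
    intro B hB
    rw [← Matrix.exp_transpose, hB, ← Matrix.exp_add_of_commute B (-B) (Commute.neg_right rfl),
      add_neg_cancel, NormedSpace.exp_zero]
  have h2 : NormedSpace.exp A =
      NormedSpace.exp ((1 / 2 : ℝ) • A) * NormedSpace.exp ((1 / 2 : ℝ) • A) := by
    rw [← Matrix.exp_add_of_commute _ _ rfl, ← add_smul]
    norm_num
  refine Matrix.mem_specialOrthogonalGroup_iff.2
    ⟨(Matrix.mem_orthogonalGroup_iff _ _).2 (horth A hA), ?_⟩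
  have h3 := congrArg Matrix.det (horth ((1 / 2 : ℝ) • A) (by rw [Matrix.transpose_smul, hA, smul_neg]))
  rw [Matrix.det_mul, Matrix.det_transpose, Matrix.det_one] at h3
  rw [h2, Matrix.det_mul, h3]

theorem blockDiag_mem_lieAlgebra_rhoTangent {n : ℕ} {A : Matrix (Fin (n + 1)) (Fin (n + 1)) ℝ}
    (hA : A.transpose = -A) : blockDiag _ _ (A, A) ∈ lieAlgebra (rhoTangent n) := by
  intro t
  refine ⟨⟨NormedSpace.exp (t • A), exp_mem_SO (by rw [Matrix.transpose_smul, hA, smul_neg])⟩, ?_⟩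
  let φ : Matrix (Fin (n + 1)) (Fin (n + 1)) ℝ →+*
      Matrix (Fin (n + 1) ⊕ Fin (n + 1)) (Fin (n + 1) ⊕ Fin (n + 1)) ℝ :=
    { toFun := fun B => Matrix.fromBlocks B 0 0 B
      map_one' := Matrix.fromBlocks_one
      map_mul' := fun B C => by simp [Matrix.fromBlocks_multiply]
      map_zero' := Matrix.fromBlocks_zero
      map_add' := fun B C => by simp [Matrix.fromBlocks_add] }
  have hφ : Continuous φ :=
    continuous_id.matrix_fromBlocks continuous_const continuous_const continuous_id
  have h := NormedSpace.map_exp φ hφ (t • A)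
  refine Eq.trans h (congrArg NormedSpace.exp ?_)
  change Matrix.fromBlocks (t • A) 0 0 (t • A) = t • Matrix.fromBlocks A 0 0 A
  rw [Matrix.fromBlocks_smul, smul_zero]

/-- If the group fixes a basis vector, then its Lie algebra annihilates this vector. -/
theorem lieAlgebra_col_eq_zero {K : Type*} [Group K] {ρ : K →* Matrix κ κ ℝ} {j : κ}
    (hρ : ∀ g i, ρ g i j = (1 : Matrix κ κ ℝ) i j) {A : Matrix κ κ ℝ} (hA : A ∈ lieAlgebra ρ)
    (i : κ) : A i j = 0 := by
  have h1 : HasDerivAt (fun t : ℝ => NormedSpace.exp (t • A)) A 0 := by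
    have h := hasDerivAt_exp_smul_const (𝕂 := ℝ) A 0
    rwa [zero_smul, NormedSpace.exp_zero, one_mul] at h
  have h2 : HasDerivAt (fun t : ℝ => NormedSpace.exp (t • A) i j) (A i j) 0 :=
    ((Matrix.entryLinearMap ℝ ℝ i j).toContinuousLinearMap.hasFDerivAt.comp_hasDerivAt 0 h1 :)
  have h3 : (fun t : ℝ => NormedSpace.exp (t • A) i j) = fun _ => (1 : Matrix κ κ ℝ) i j := by
    funext t
    obtain ⟨g, hg⟩ := hA t
    rw [← hg, hρ]
  rw [h3] at h2
  exact h2.unique (hasDerivAt_const 0 _)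

end Exp

theorem frameAct_eq_zero_of_col {K V : Type*} [Group K] [AddCommGroup V] [Module ℝ V]
    {ρ : K →* Matrix κ κ ℝ} {j : κ} (hρ : ∀ g i, ρ g i j = (1 : Matrix κ κ ℝ) i j)
    {A : Matrix κ κ ℝ} (hA : A ∈ lieAlgebra ρ) (p : κ → V) : frameAct p A j = 0 := by
  simp [frameAct, lieAlgebra_col_eq_zero hρ hA]

theorem fixFirst_zero_zero {n : ℕ} (A : Matrix (Fin n) (Fin n) ℝ) : fixFirst n A 0 0 = 1 := rfl
theorem fixFirst_zero_succ {n : ℕ} (A : Matrix (Fin n) (Fin n) ℝ) (j : Fin n) :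
    fixFirst n A 0 j.succ = 0 := rfl
theorem fixFirst_succ_zero {n : ℕ} (A : Matrix (Fin n) (Fin n) ℝ) (i : Fin n) :
    fixFirst n A i.succ 0 = 0 := rfl
theorem fixFirst_succ_succ {n : ℕ} (A : Matrix (Fin n) (Fin n) ℝ) (i j : Fin n) :
    fixFirst n A i.succ j.succ = A i j := rfl

theorem fixFirst_col_zero {n : ℕ} (A : Matrix (Fin n) (Fin n) ℝ) (i : Fin (n + 1)) :
    fixFirst n A i 0 = (1 : Matrix (Fin (n + 1)) (Fin (n + 1)) ℝ) i 0 := by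
  refine Fin.cases ?_ (fun i => ?_) i
  · rw [fixFirst_zero_zero, Matrix.one_apply_eq]
  · rw [fixFirst_succ_zero, Matrix.one_apply_ne (Fin.succ_ne_zero i)]

theorem rhoNonzero_col (n : ℕ) (g : SO n) (i : Fin (n + 1) ⊕ Fin (n + 1)) :
    rhoNonzero n g i (Sum.inr 0) =
      (1 : Matrix (Fin (n + 1) ⊕ Fin (n + 1)) (Fin (n + 1) ⊕ Fin (n + 1)) ℝ) i (Sum.inr 0) := by
  rcases i with i | i
  · simp [rhoNonzero, blockDiag]
  · have h := fixFirst_col_zero (g : Matrix (Fin n) (Fin n) ℝ) i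
    simp only [rhoNonzero, blockDiag, MonoidHom.comp_apply, MonoidHom.prod_apply, MonoidHom.coe_mk,
      OneHom.coe_mk, Matrix.fromBlocks_apply₂₂]
    refine h.trans ?_
    simp [Matrix.one_apply]

theorem rhoSphere_col (n : ℕ) (g : SO n) (i : Fin (n + 1) ⊕ Fin n) :
    rhoSphere n g i (Sum.inl 0) =
      (1 : Matrix (Fin (n + 1) ⊕ Fin n) (Fin (n + 1) ⊕ Fin n) ℝ) i (Sum.inl 0) := by
  rcases i with i | i
  · have h := fixFirst_col_zero (g : Matrix (Fin n) (Fin n) ℝ) i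
    simp only [rhoSphere, blockDiag, MonoidHom.comp_apply, MonoidHom.prod_apply, MonoidHom.coe_mk,
      OneHom.coe_mk, Matrix.fromBlocks_apply₁₁]
    refine h.trans ?_
    simp [Matrix.one_apply]
  · simp [rhoSphere, blockDiag]

theorem fixFirst_mul_transpose {n : ℕ} (A : Matrix (Fin n) (Fin n) ℝ) :
    fixFirst n A * (fixFirst n A).transpose = fixFirst n (A * A.transpose) := by
  ext i j
  refine Fin.cases (Fin.cases ?_ (fun _ => ?_) j) (fun i' => Fin.cases ?_ (fun j' => ?_) j) i <;>
    simp [Matrix.mul_apply, Fin.sum_univ_succ, fixFirst_zero_zero, fixFirst_zero_succ,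
      fixFirst_succ_zero, fixFirst_succ_succ]

theorem det_fixFirst {n : ℕ} (A : Matrix (Fin n) (Fin n) ℝ) : (fixFirst n A).det = A.det := by
  rw [Matrix.det_succ_column_zero, Fin.sum_univ_succ]
  simp only [fixFirst_zero_zero, fixFirst_succ_zero]
  have : (fixFirst n A).submatrix Fin.succ Fin.succ = A := by
    ext i j; exact fixFirst_succ_succ A i j
  simp [Fin.succAbove_zero, this]

theorem fixFirst_injective (n : ℕ) : Function.Injective (fixFirst n) := fun A B h => by
  ext i j
  rw [← fixFirst_succ_succ A, h, fixFirst_succ_succ]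

theorem fixFirst_mem_SO_iff {n : ℕ} {A : Matrix (Fin n) (Fin n) ℝ} :
    fixFirst n A ∈ SO (n + 1) ↔ A ∈ SO n := by
  rw [Matrix.mem_specialOrthogonalGroup_iff, Matrix.mem_specialOrthogonalGroup_iff, det_fixFirst,
    Matrix.mem_orthogonalGroup_iff, Matrix.mem_orthogonalGroup_iff]
  have : fixFirst n A * (fixFirst n A).transpose = 1 ↔ A * A.transpose = 1 := by
    rw [fixFirst_mul_transpose, ← map_one (fixFirst n)]
    exact (fixFirst_injective n).eq_iff
  exact and_congr_left fun _ => this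

/-- A rotation of `ℝⁿ⁺¹` that fixes the first basis vector is a rotation of `ℝⁿ`. -/
theorem exists_fixFirst_of_col {n : ℕ} {g : Matrix (Fin (n + 1)) (Fin (n + 1)) ℝ}
    (hg : g ∈ SO (n + 1)) (hcol : ∀ i, g i 0 = (1 : Matrix (Fin (n + 1)) (Fin (n + 1)) ℝ) i 0) :
    ∃ h ∈ SO n, g = fixFirst n h := by
  have h0 : g.transpose * g = 1 := by
    have := (Matrix.mem_specialOrthogonalGroup_iff.1 hg).1
    exact (Matrix.mem_orthogonalGroup_iff' _ _).1 this
  -- the first row of `g` is determined by the orthogonality to the first column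
  have hrow : ∀ j, g 0 j = (1 : Matrix (Fin (n + 1)) (Fin (n + 1)) ℝ) 0 j := by
    intro j
    have h1 := congrFun (congrFun h0 0) j
    rw [Matrix.mul_apply, Fin.sum_univ_succ] at h1
    simpa [hcol, Matrix.one_apply, Fin.succ_ne_zero] using h1
  have hgh : g = fixFirst n (g.submatrix Fin.succ Fin.succ) := by
    ext i j
    refine Fin.cases ?_ (fun j' => ?_) j
    · rw [hcol, fixFirst_col_zero]
    · refine Fin.cases ?_ (fun i' => ?_) i
      · rw [hrow, fixFirst_zero_succ, Matrix.one_apply_ne (Fin.succ_ne_zero j').symm]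
      · rw [fixFirst_succ_succ]
        rfl
  exact ⟨_, fixFirst_mem_SO_iff.1 (hgh ▸ hg), hgh⟩

end MatrixGroups

/-! ### Oriented orthonormal bases -/

section OrientedBases

variable {k : ℕ} {V : Type*} [NormedAddCommGroup V] [InnerProductSpace ℝ V]

/-- Rotating an orthonormal basis. -/
theorem exists_orthonormalBasis_rotate (b : OrthonormalBasis (Fin k) ℝ V)
    {g : Matrix (Fin k) (Fin k) ℝ} (hg : g ∈ SO k) :
    ∃ b' : OrthonormalBasis (Fin k) ℝ V, b'.toBasis.orientation = b.toBasis.orientation ∧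
      ∀ j, b' j = ∑ i, g i j • b i := by
  obtain ⟨hg1, hg2⟩ := Matrix.mem_specialOrthogonalGroup_iff.1 hg
  have hg3 : g.transpose * g = 1 := (Matrix.mem_orthogonalGroup_iff' _ _).1 hg1
  have : FiniteDimensional ℝ V := b.toBasis.finiteDimensional_of_finite
  have hon : Orthonormal ℝ fun j => ∑ i, g i j • b i := by
    rw [orthonormal_iff_ite]
    intro j l
    rw [b.orthonormal.inner_sum]
    have h := congrFun (congrFun hg3 j) l
    rw [Matrix.mul_apply, Matrix.one_apply] at h
    simpa using h
  have hsp := hon.linearIndependent.span_eq_top_of_card_eq_finrank'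
    (finrank_eq_card_basis b.toBasis).symm
  refine ⟨OrthonormalBasis.mk hon hsp.ge, ?_, fun j => by simp⟩
  symm
  rw [Basis.orientation_eq_iff_det_pos, Basis.det_apply]
  have : b.toBasis.toMatrix (OrthonormalBasis.mk hon hsp.ge).toBasis = g := by
    ext i j
    simp [Basis.toMatrix_apply]
  rw [this, hg2]
  exact one_pos

/-- Two orthonormal bases of the same orientation differ by a rotation. -/
theorem exists_rotation (b b' : OrthonormalBasis (Fin k) ℝ V)
    (h : b.toBasis.orientation = b'.toBasis.orientation) :
    ∃ g ∈ SO k, ∀ j, b' j = ∑ i, g i j • b i := by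
  refine ⟨b.toBasis.toMatrix b', Matrix.mem_specialOrthogonalGroup_iff.2
    ⟨b.toMatrix_orthonormalBasis_mem_orthogonal b', ?_⟩, fun j => ?_⟩
  · rw [← Basis.det_apply]
    exact b.det_to_matrix_orthonormalBasis_of_same_orientation b' h
  · have := b.toBasis.sum_toMatrix_smul_self b' j
    simpa using this.symm

theorem eq_of_sum_smul_eq (b : OrthonormalBasis (Fin k) ℝ V) {g h : Matrix (Fin k) (Fin k) ℝ}
    (hgh : ∀ j, ∑ i, g i j • b i = ∑ i, h i j • b i) : g = h := by
  ext i j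
  have h1 := congrArg (fun v => inner ℝ (b i) v) (hgh j)
  simpa [inner_sum, inner_smul_right, OrthonormalBasis.inner_eq_ite] using h1

end OrientedBases

/-! ### The rotation between two unit vectors -/

section RotationMatrix

variable {n : ℕ}

/-- For a unit vector `c ≠ -e₀` of `ℝⁿ⁺¹`, the rotation of the plane spanned by `e₀` and `c` that
sends `e₀` to `c`: the reflection in `e₀`, followed by the reflection in `w = e₀ + c`. -/
def rotTo (c : Fin (n + 1) → ℝ) : Matrix (Fin (n + 1)) (Fin (n + 1)) ℝ :=
  (1 - Matrix.vecMulVec ((1 + c 0)⁻¹ • (Pi.single 0 1 + c)) (Pi.single 0 1 + c)) *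
    (1 - Matrix.vecMulVec ((2 : ℝ) • (Pi.single 0 1 : Fin (n + 1) → ℝ)) (Pi.single 0 1))

theorem reflection_mul_self {c : ℝ} {w : Fin (n + 1) → ℝ} (h : c * (w ⬝ᵥ w) = 2) :
    (1 - Matrix.vecMulVec (c • w) w) * (1 - Matrix.vecMulVec (c • w) w).transpose = 1 ∧
      (1 - Matrix.vecMulVec (c • w) w).det = -1 := by
  constructor
  · have h1 : (Matrix.vecMulVec (c • w) w).transpose = Matrix.vecMulVec (c • w) w := by
      ext i j; simp [Matrix.vecMulVec_apply]; ring
    have h2 : Matrix.vecMulVec (c • w) w * Matrix.vecMulVec (c • w) w =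
        2 • Matrix.vecMulVec (c • w) w := by
      rw [Matrix.vecMulVec_mul_vecMulVec, dotProduct_smul, smul_eq_mul, h]
      ext i j; simp [Matrix.vecMulVec_apply]; ring
    rw [Matrix.transpose_sub, Matrix.transpose_one, h1, sub_mul, mul_sub, mul_sub, h2]
    simp [two_smul]
  · rw [Matrix.vecMulVec_eq Unit, sub_eq_add_neg, ← Matrix.neg_mul]
    have : -Matrix.replicateCol Unit (c • w) = Matrix.replicateCol Unit (-(c • w)) := rfl
    rw [this, Matrix.det_one_add_replicateCol_mul_replicateRow, dotProduct_neg, dotProduct_smul,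
      smul_eq_mul, h]
    norm_num

theorem rotTo_mem_SO {c : Fin (n + 1) → ℝ} (hc : c ⬝ᵥ c = 1) (h0 : c 0 ≠ -1) :
    rotTo c ∈ SO (n + 1) := by
  have h0' : 1 + c 0 ≠ 0 := fun h => h0 (by linarith)
  have h1 := reflection_mul_self (n := n) (c := (1 + c 0)⁻¹) (w := Pi.single 0 1 + c) (by
    simp only [add_dotProduct, dotProduct_add, hc]
    simp
    field_simp
    ring)
  have h2 := reflection_mul_self (n := n) (c := 2) (w := Pi.single 0 1) (by simp)
  rw [Matrix.mem_specialOrthogonalGroup_iff, Matrix.mem_orthogonalGroup_iff]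
  constructor
  · change rotTo c * (rotTo c).transpose = 1
    rw [rotTo, Matrix.transpose_mul, Matrix.mul_assoc, ← Matrix.mul_assoc _ _ (Matrix.transpose _),
      h2.1, Matrix.one_mul, h1.1]
  · rw [rotTo, Matrix.det_mul, h1.2, h2.2]
    norm_num

theorem rotTo_apply {c : Fin (n + 1) → ℝ} (i j : Fin (n + 1)) :
    rotTo c i j = (1 : Matrix (Fin (n + 1)) (Fin (n + 1)) ℝ) i j
      - (1 + c 0)⁻¹ * (Pi.single 0 1 + c : Fin (n + 1) → ℝ) i * (Pi.single 0 1 + c : Fin (n + 1) → ℝ) j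
      - 2 * (Pi.single 0 1 : Fin (n + 1) → ℝ) i * (Pi.single 0 1 : Fin (n + 1) → ℝ) j
      + 2 * (Pi.single 0 1 + c : Fin (n + 1) → ℝ) i * (Pi.single 0 1 : Fin (n + 1) → ℝ) j
        * ((1 + c 0)⁻¹ * (1 + c 0)) := by
  rw [rotTo, sub_mul, mul_sub, mul_sub, Matrix.vecMulVec_mul_vecMulVec]
  simp [Matrix.vecMulVec_apply]
  ring

theorem rotTo_col_zero {c : Fin (n + 1) → ℝ} (h0 : c 0 ≠ -1) (i : Fin (n + 1)) :
    rotTo c i 0 = c i := by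
  have h0' : 1 + c 0 ≠ 0 := fun h => h0 (by linarith)
  rw [rotTo_apply, inv_mul_cancel₀ h0']
  have h1 : (1 : Matrix (Fin (n + 1)) (Fin (n + 1)) ℝ) i 0 = (Pi.single 0 1 : Fin (n + 1) → ℝ) i := by
    simp [Matrix.one_apply, Pi.single_apply]
  rw [h1]
  simp
  field_simp
  ring

end RotationMatrix

/-! ### Local orthonormal frames -/

section OrthonormalFrames

variable {n : ℕ} {M : Type*} [TopologicalSpace M]
  [ChartedSpace (EuclideanSpace ℝ (Fin (n + 1))) M] [IsManifold (𝓡 (n + 1)) ∞ M]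
  [RiemannianBundle (TangentSpace (𝓡 (n + 1)) : M → Type _)]
  [IsContMDiffRiemannianBundle (𝓡 (n + 1)) ∞ (EuclideanSpace ℝ (Fin (n + 1)))
    (TangentSpace (𝓡 (n + 1)) : M → Type _)]

/-- The Gram-Schmidt process preserves smoothness. -/
theorem contMDiffOn_gramSchmidt {U : Set M} {e : ∀ x : M, Fin (n + 1) → TangentSpace (𝓡 (n + 1)) x}
    (he : ∀ i, ContMDiffOn (𝓡 (n + 1)) (𝓡 (n + 1)).tangent ∞
      (alongMap (fun z => z) (fun x => e x i)) U)
    (hlin : ∀ x ∈ U, LinearIndependent ℝ (e x)) (i : Fin (n + 1)) :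
    ContMDiffOn (𝓡 (n + 1)) (𝓡 (n + 1)).tangent ∞
      (alongMap (fun z => z) (fun x => InnerProductSpace.gramSchmidt ℝ (e x) i)) U := by
  induction i using WellFoundedLT.induction with
  | ind i ih =>
  have h1 : ∀ x, InnerProductSpace.gramSchmidt ℝ (e x) i = e x i + (-1 : ℝ) • ∑ j ∈ Finset.Iio i,
      (inner ℝ (InnerProductSpace.gramSchmidt ℝ (e x) j) (e x i) *
        (inner ℝ (InnerProductSpace.gramSchmidt ℝ (e x) j)
          (InnerProductSpace.gramSchmidt ℝ (e x) j) : ℝ)⁻¹) •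
        InnerProductSpace.gramSchmidt ℝ (e x) j := by
    intro x
    have h := InnerProductSpace.gramSchmidt_def'' ℝ (e x) i
    rw [neg_one_smul, ← sub_eq_add_neg, eq_sub_iff_add_eq]
    refine Eq.trans ?_ h.symm
    simp only [real_inner_self_eq_norm_sq, div_eq_mul_inv]
    rfl
  simp only [h1]
  intro x hx
  refine ContMDiffWithinAt.add_along (he i x hx) (ContMDiffWithinAt.smul_along
    contMDiffWithinAt_const (ContMDiffWithinAt.sum_along _ contMDiffWithinAt_id fun j hj => ?_))
  have hj' := ih j (Finset.mem_Iio.1 hj) x hx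
  refine ContMDiffWithinAt.smul_along ?_ hj'
  have h2 := ContMDiffWithinAt.inner_bundle (IB := 𝓡 (n + 1)) hj' (he i x hx)
  have h3 := ContMDiffWithinAt.inner_bundle (IB := 𝓡 (n + 1)) hj' hj'
  have h4 : (inner ℝ (InnerProductSpace.gramSchmidt ℝ (e x) j)
      (InnerProductSpace.gramSchmidt ℝ (e x) j) : ℝ) ≠ 0 := by
    rw [inner_self_ne_zero]
    exact InnerProductSpace.gramSchmidt_ne_zero j (hlin x hx)
  have h5 : ContDiffAt ℝ ∞ (fun t : ℝ => t⁻¹) _ := contDiffAt_inv ℝ h4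
  exact h2.mul (h5.contMDiffAt.comp_contMDiffWithinAt x h3)

/-- The normed Gram-Schmidt process preserves smoothness. -/
theorem contMDiffOn_gramSchmidtNormed {U : Set M}
    {e : ∀ x : M, Fin (n + 1) → TangentSpace (𝓡 (n + 1)) x}
    (he : ∀ i, ContMDiffOn (𝓡 (n + 1)) (𝓡 (n + 1)).tangent ∞
      (alongMap (fun z => z) (fun x => e x i)) U)
    (hlin : ∀ x ∈ U, LinearIndependent ℝ (e x)) (i : Fin (n + 1)) :
    ContMDiffOn (𝓡 (n + 1)) (𝓡 (n + 1)).tangent ∞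
      (alongMap (fun z => z) (fun x => InnerProductSpace.gramSchmidtNormed ℝ (e x) i)) U := by
  intro x hx
  have h1 := contMDiffOn_gramSchmidt he hlin i x hx
  have h3 := ContMDiffWithinAt.inner_bundle (IB := 𝓡 (n + 1)) h1 h1
  have h4 : (inner ℝ (InnerProductSpace.gramSchmidt ℝ (e x) i)
      (InnerProductSpace.gramSchmidt ℝ (e x) i) : ℝ) ≠ 0 := by
    rw [inner_self_ne_zero]
    exact InnerProductSpace.gramSchmidt_ne_zero i (hlin x hx)
  have h5 : ContDiffAt ℝ ∞ (fun t : ℝ => (√t)⁻¹) (inner ℝ (InnerProductSpace.gramSchmidt ℝ (e x) i)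
      (InnerProductSpace.gramSchmidt ℝ (e x) i) : ℝ) :=
    (Real.contDiffAt_sqrt h4).inv (by
      rw [real_inner_self_eq_norm_sq, Real.sqrt_sq (norm_nonneg _), norm_ne_zero_iff]
      exact InnerProductSpace.gramSchmidt_ne_zero i (hlin x hx))
  have h6 := ContMDiffWithinAt.smul_along (h5.contMDiffAt.comp_contMDiffWithinAt x h3) h1
  refine h6.congr_of_eventuallyEq (Filter.Eventually.of_forall fun z => ?_) ?_ <;>
  · simp only [alongMap, InnerProductSpace.gramSchmidtNormed, Function.comp_apply,
      real_inner_self_eq_norm_sq, Real.sqrt_sq (norm_nonneg _)]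
    rfl

/-- Around each point there are vector fields, smooth on all of `M`, which form a positively oriented
orthonormal frame near this point. -/
theorem exists_orthonormal_fields [T2Space M]
    {o : ∀ x : M, Orientation ℝ (TangentSpace (𝓡 (n + 1)) x) (Fin (n + 1))}
    (ho : IsManifoldOrientation o) (x₀ : M) :
    ∃ (U : Set M) (X : Fin (n + 1) → ∀ x : M, TangentSpace (𝓡 (n + 1)) x), IsOpen U ∧ x₀ ∈ U ∧
      (∀ i, ContMDiff (𝓡 (n + 1)) (𝓡 (n + 1)).tangent ∞ (alongMap (fun z => z) (X i))) ∧
      ∀ x ∈ U, ∃ b : OrthonormalBasis (Fin (n + 1)) ℝ (TangentSpace (𝓡 (n + 1)) x),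
        b.toBasis.orientation = o x ∧ ∀ i, b i = X i x := by
  obtain ⟨U', hU', e, he, hb⟩ := ho x₀
  obtain ⟨U, hUU', hU, hx₀⟩ := mem_nhds_iff.1 hU'
  have hlin : ∀ x ∈ U, LinearIndependent ℝ (e x) := fun x hx => by
    obtain ⟨b, hb1, -⟩ := hb x (hUU' hx)
    rw [← funext hb1]
    exact b.linearIndependent
  have hsm := contMDiffOn_gramSchmidtNormed (e := e) (fun i => (he i).mono hUU') hlin
  obtain ⟨ψ, -, hψ⟩ := (SmoothBumpFunction.nhds_basis_tsupport (I := 𝓡 (n + 1)) x₀).mem_iff.1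
    (hU.mem_nhds hx₀)
  obtain ⟨W, hW1, hW, hx₀W⟩ := mem_nhds_iff.1 ψ.eventuallyEq_one
  refine ⟨U ∩ W, fun i x => ψ x • InnerProductSpace.gramSchmidtNormed ℝ (e x) i, hU.inter hW,
    ⟨hx₀, hx₀W⟩, fun i => ?_, fun x hx => ?_⟩
  · exact ContMDiffOn.smul_section_of_tsupport ψ.contMDiff.contMDiffOn hU hψ (hsm i)
  · obtain ⟨b, hb1, hb2⟩ := hb x (hUU' hx.1)
    have : FiniteDimensional ℝ (TangentSpace (𝓡 (n + 1)) x) := b.finiteDimensional_of_finite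
    have hfr := finrank_eq_card_basis b
    have hne : ∀ i, InnerProductSpace.gramSchmidtNormed ℝ (e x) i ≠ 0 := fun i h => by
      have := InnerProductSpace.gramSchmidtNormed_unit_length (𝕜 := ℝ) i (hlin x hx.1)
      rw [h, norm_zero] at this
      exact zero_ne_one this
    have hap := fun i => InnerProductSpace.gramSchmidtOrthonormalBasis_apply hfr (hne i)
    refine ⟨InnerProductSpace.gramSchmidtOrthonormalBasis hfr (e x), ?_, fun i => ?_⟩
    · rw [← hb2, Basis.orientation_eq_iff_det_pos]
      have hbe : (b : Fin (n + 1) → _) = e x := funext hb1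
      rw [hbe, InnerProductSpace.gramSchmidtOrthonormalBasis_det]
      refine Finset.prod_pos fun i _ => ?_
      -- the normed Gram-Schmidt vector has a positive inner product with the original one
      have h1 : inner ℝ (InnerProductSpace.gramSchmidt ℝ (e x) i) (e x i) =
          ‖InnerProductSpace.gramSchmidt ℝ (e x) i‖ ^ 2 := by
        conv_lhs => rw [InnerProductSpace.gramSchmidt_def'' ℝ (e x) i]
        rw [inner_add_right, inner_sum, Finset.sum_eq_zero, add_zero, real_inner_self_eq_norm_sq]
        intro j hj
        rw [inner_smul_right, InnerProductSpace.gramSchmidt_orthogonal ℝ (e x)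
          (Finset.mem_Iio.1 hj).ne', mul_zero]
      have h2 : 0 < ‖InnerProductSpace.gramSchmidt ℝ (e x) i‖ :=
        norm_pos_iff.2 (InnerProductSpace.gramSchmidt_ne_zero i (hlin x hx.1))
      rw [hap, InnerProductSpace.gramSchmidtNormed, real_inner_smul_left, h1]
      simp only [RCLike.ofReal_real_eq_id, id]
      positivity
    · have hψx : ψ x = 1 := hW1 hx.2
      change _ = ψ x • InnerProductSpace.gramSchmidtNormed ℝ (e x) i
      rw [hap, hψx, one_smul]

end OrthonormalFrames

/-! ### Metric compatibility of the pull-back connection -/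

section MetricCompatibility

variable {n : ℕ} {M : Type*} [TopologicalSpace M]
  [ChartedSpace (EuclideanSpace ℝ (Fin (n + 1))) M] [IsManifold (𝓡 (n + 1)) ∞ M]
  {F H N : Type*} [NormedAddCommGroup F] [NormedSpace ℝ F] [TopologicalSpace H]
  {J : ModelWithCorners ℝ F H} [TopologicalSpace N] [ChartedSpace H N]
  {cov : CovariantDerivative (𝓡 (n + 1)) (EuclideanSpace ℝ (Fin (n + 1)))
    (TangentSpace (𝓡 (n + 1)) : M → Type _)}
  {f : N → M} {a b : ∀ q, TangentSpace (𝓡 (n + 1)) (f q)} {p : N}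

/-- The pull-back connection in a frame of vector fields of `M`. -/
theorem covAlong_sum {ι : Type*} {X : ι → ∀ x : M, TangentSpace (𝓡 (n + 1)) x}
    (hX : ∀ i, MDifferentiableAt (𝓡 (n + 1)) (𝓡 (n + 1)).tangent (alongMap (fun z => z) (X i)) (f p))
    {c : ι → N → ℝ} (hc : ∀ i, MDifferentiableAt J 𝓘(ℝ, ℝ) (c i) p)
    (hf : MDifferentiableAt J (𝓡 (n + 1)) f p) (t : Finset ι) :
    MDifferentiableAt J (𝓡 (n + 1)).tangent (alongMap f fun q => ∑ i ∈ t, c i q • X i (f q)) p ∧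
    ∀ y : TangentSpace J p, covAlong J cov f (fun q => ∑ i ∈ t, c i q • X i (f q)) p y =
      ∑ i ∈ t, (c i p • cov (X i) (f p) (mfderiv J (𝓡 (n + 1)) f p y)
        + mvfderiv J (c i) p y • X i (f p)) := by
  classical
  have hXf : ∀ i, MDifferentiableAt J (𝓡 (n + 1)).tangent (alongMap f fun q => X i (f q)) p :=
    fun i => (hX i).comp p hf
  induction t using Finset.induction_on with
  | empty =>
    simp only [Finset.sum_empty]
    have h0 : MDifferentiableAt J (𝓡 (n + 1)).tangent
        (alongMap f fun q => (0 : TangentSpace (𝓡 (n + 1)) (f q))) p :=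
      MDifferentiableAt.comp p (g := zeroSection (EuclideanSpace ℝ (Fin (n + 1)))
        (TangentSpace (𝓡 (n + 1)) : M → Type _)) (mdifferentiableAt_zeroSection ..) hf
    refine ⟨h0, fun y => ?_⟩
    have h := covAlong_smul (cov := cov) (c := fun _ => (0 : ℝ)) mdifferentiableAt_const h0 y
    simpa [mvfderiv_const] using h
  | insert j t hj ih =>
    simp only [Finset.sum_insert hj]
    have h1 := mdifferentiableAt_alongMap_smul (hc j) (hXf j)
    refine ⟨mdifferentiableAt_alongMap_add h1 ih.1, fun y => ?_⟩
    rw [covAlong_add h1 ih.1, ih.2, covAlong_smul (hc j) (hXf j), covAlong_comp (X j) hf (hX j)]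

variable [RiemannianBundle (TangentSpace (𝓡 (n + 1)) : M → Type _)]
  [IsContMDiffRiemannianBundle (𝓡 (n + 1)) ∞ (EuclideanSpace ℝ (Fin (n + 1)))
    (TangentSpace (𝓡 (n + 1)) : M → Type _)]

/-- The pull-back of a metric connection is metric. -/
theorem covAlong_metric [T2Space M]
    {o : ∀ x : M, Orientation ℝ (TangentSpace (𝓡 (n + 1)) x) (Fin (n + 1))}
    (ho : IsManifoldOrientation o) (hmetric : cov.IsMetricCompatible)
    (ha : MDifferentiableAt J (𝓡 (n + 1)).tangent (alongMap f a) p)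
    (hb : MDifferentiableAt J (𝓡 (n + 1)).tangent (alongMap f b) p) (y : TangentSpace J p) :
    mvfderiv J (fun q => (inner ℝ (a q) (b q) : ℝ)) p y =
      inner ℝ (covAlong J cov f a p y) (b p) + inner ℝ (a p) (covAlong J cov f b p y) := by
  obtain ⟨U, X, hU, hpU, hX, hfr⟩ := exists_orthonormal_fields ho (f p)
  have hf := (mdifferentiableAt_alongMap_iff.1 ha).1
  have hXd : ∀ i, MDifferentiableAt (𝓡 (n + 1)) (𝓡 (n + 1)).tangent
      (alongMap (fun z => z) (X i)) (f p) := fun i => (hX i).contMDiffAt.mdifferentiableAt (by simp)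
  have hXf : ∀ i, MDifferentiableAt J (𝓡 (n + 1)).tangent (alongMap f fun q => X i (f q)) p :=
    fun i => (hXd i).comp p hf
  have hev : ∀ᶠ q in 𝓝 p, f q ∈ U := hf.continuousAt (hU.mem_nhds hpU)
  -- the coefficients in the orthonormal frame
  have key : ∀ v : ∀ q, TangentSpace (𝓡 (n + 1)) (f q),
      MDifferentiableAt J (𝓡 (n + 1)).tangent (alongMap f v) p →
      (∀ i, MDifferentiableAt J 𝓘(ℝ, ℝ) (fun q => (inner ℝ (X i (f q)) (v q) : ℝ)) p) ∧
      covAlong J cov f v p y = ∑ i, ((inner ℝ (X i (f p)) (v p) : ℝ) •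
        cov (X i) (f p) (mfderiv J (𝓡 (n + 1)) f p y) +
        mvfderiv J (fun q => (inner ℝ (X i (f q)) (v q) : ℝ)) p y • X i (f p)) := by
    intro v hv
    have hc : ∀ i, MDifferentiableAt J 𝓘(ℝ, ℝ) (fun q => (inner ℝ (X i (f q)) (v q) : ℝ)) p :=
      fun i => MDifferentiableAt.inner_bundle (IB := 𝓡 (n + 1)) (hXf i) hv
    refine ⟨hc, ?_⟩
    have h := covAlong_sum (cov := cov) hXd hc hf Finset.univ
    rw [← h.2 y]
    refine DFunLike.congr_fun (covAlong_congr h.1 (hev.mono fun q hq => ?_)) y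
    obtain ⟨e, -, he⟩ := hfr (f q) hq
    simp only [← he]
    exact (e.sum_repr' (v q)).symm
  obtain ⟨hca, hcova⟩ := key a ha
  obtain ⟨hcb, hcovb⟩ := key b hb
  have hinner : (fun q => (inner ℝ (a q) (b q) : ℝ)) =ᶠ[𝓝 p]
      fun q => ∑ i, (inner ℝ (X i (f q)) (a q) : ℝ) * inner ℝ (X i (f q)) (b q) := by
    filter_upwards [hev] with q hq
    obtain ⟨e, -, he⟩ := hfr (f q) hq
    simp only [← he]
    rw [← e.sum_inner_mul_inner]
    simp only [real_inner_comm]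
  have hsum : ∀ t : Finset (Fin (n + 1)),
      MDifferentiableAt J 𝓘(ℝ, ℝ) (fun q => ∑ i ∈ t,
        (inner ℝ (X i (f q)) (a q) : ℝ) * inner ℝ (X i (f q)) (b q)) p ∧
      mvfderiv J (fun q => ∑ i ∈ t,
        (inner ℝ (X i (f q)) (a q) : ℝ) * inner ℝ (X i (f q)) (b q)) p y =
      ∑ i ∈ t, (inner ℝ (X i (f p)) (a p) * mvfderiv J (fun q => (inner ℝ (X i (f q)) (b q) : ℝ)) p y
        + inner ℝ (X i (f p)) (b p) * mvfderiv J (fun q => (inner ℝ (X i (f q)) (a q) : ℝ)) p y) := by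
    intro t
    induction t using Finset.induction_on with
    | empty => simp only [Finset.sum_empty, mvfderiv_const]; exact ⟨mdifferentiableAt_const, rfl⟩
    | insert j t hj ih =>
      simp only [Finset.sum_insert hj]
      have hm : MDifferentiableAt J 𝓘(ℝ, ℝ) (fun q =>
          (inner ℝ (X j (f q)) (a q) : ℝ) * inner ℝ (X j (f q)) (b q)) p := (hca j).mul (hcb j)
      refine ⟨hm.add ih.1, ?_⟩
      rw [mvfderiv_fun_add hm ih.1, add_apply, ih.2, mvfderiv_fun_mul (hca j) (hcb j)]
      rfl
  obtain ⟨e, -, he⟩ := hfr (f p) hpU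
  -- the connection matrix of the orthonormal frame is skew-symmetric
  have hskew : ∀ i j, (inner ℝ (cov (X i) (f p) (mfderiv J (𝓡 (n + 1)) f p y)) (e j) : ℝ) +
      inner ℝ (e i) (cov (X j) (f p) (mfderiv J (𝓡 (n + 1)) f p y)) = 0 := by
    intro i j
    have h1 := hmetric.mvfderiv_inner_eq
      (X := extendField ⟨f p, mfderiv J (𝓡 (n + 1)) f p y⟩) (hXd i) (hXd j)
    have h2 : (fun x => (inner ℝ (X i x) (X j x) : ℝ)) =ᶠ[𝓝 (f p)] fun _ => if i = j then 1 else 0 := by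
      filter_upwards [hU.mem_nhds hpU] with x hx
      obtain ⟨e', -, he'⟩ := hfr x hx
      rw [← he', ← he', e'.inner_eq_ite]
    rw [mvfderiv_congr h2, mvfderiv_const] at h1
    simp only [extend_self ⟨f p, mfderiv J (𝓡 (n + 1)) f p y⟩] at h1
    rw [he, he]
    exact h1.symm
  rw [mvfderiv_congr hinner, (hsum Finset.univ).2, hcova, hcovb]
  have hap : a p = ∑ j, (inner ℝ (e j) (a p) : ℝ) • e j := (e.sum_repr' (a p)).symm
  have hbp : b p = ∑ j, (inner ℝ (e j) (b p) : ℝ) • e j := (e.sum_repr' (b p)).symm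
  simp only [← he]
  generalize mfderiv J (𝓡 (n + 1)) f p y = w at *
  have hz : (∑ i, (inner ℝ (e i) (a p) : ℝ) * inner ℝ (cov (X i) (f p) w) (b p)) +
      ∑ i, (inner ℝ (e i) (b p) : ℝ) * inner ℝ (a p) (cov (X i) (f p) w) = 0 := by
    conv_lhs =>
      enter [1, 2, i, 2]
      rw [hbp]
    conv_lhs =>
      enter [2, 2, i, 2]
      rw [hap]
    simp only [inner_sum, sum_inner, inner_smul_left, inner_smul_right, Finset.mul_sum]
    rw [Finset.sum_comm (f := fun x i => (inner ℝ (e x) (b p) : ℝ) * _), ← Finset.sum_add_distrib]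
    refine Finset.sum_eq_zero fun i _ => ?_
    rw [← Finset.sum_add_distrib]
    refine Finset.sum_eq_zero fun j _ => ?_
    have := hskew i j
    simp only [RCLike.conj_to_real]
    linear_combination (inner ℝ (e i) (a p) * inner ℝ (e j) (b p) : ℝ) * this
  simp only [inner_sum, sum_inner, inner_add_left, inner_add_right, inner_smul_left,
    inner_smul_right, Finset.sum_add_distrib, RCLike.conj_to_real] at hz ⊢
  simp only [real_inner_comm (a p) (e _)] at hz ⊢
  have hcomm : ∀ i, (inner ℝ (a p) (e i) : ℝ) = inner ℝ (e i) (a p) := fun i => real_inner_comm _ _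
  simp only [hcomm] at hz ⊢
  have e1 : ∀ c d : Fin (n + 1) → ℝ, ∑ i, c i * d i = ∑ i, d i * c i := fun c d => by
    simp only [mul_comm]
  linarith [e1 (fun i => inner ℝ (e i) (a p))
      (fun i => mvfderiv J (fun q => (inner ℝ (X i (f q)) (b q) : ℝ)) p y),
    e1 (fun i => inner ℝ (e i) (b p))
      (fun i => mvfderiv J (fun q => (inner ℝ (X i (f q)) (a q) : ℝ)) p y)]

end MetricCompatibility

/-! ### Lifted frames and the connection `∇^*` -/

section LiftedFrames

variable {n : ℕ} {M : Type*} [TopologicalSpace M]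
  [ChartedSpace (EuclideanSpace ℝ (Fin (n + 1))) M] [IsManifold (𝓡 (n + 1)) ∞ M]
  {F H N : Type*} [NormedAddCommGroup F] [NormedSpace ℝ F] [TopologicalSpace H]
  {J : ModelWithCorners ℝ F H} [TopologicalSpace N] [ChartedSpace H N]
  {cov : CovariantDerivative (𝓡 (n + 1)) (EuclideanSpace ℝ (Fin (n + 1)))
    (TangentSpace (𝓡 (n + 1)) : M → Type _)}

theorem covAlong_eq_zero {f : N → M} {a : ∀ q, TangentSpace (𝓡 (n + 1)) (f q)} {p : N}
    (hf : MDifferentiableAt J (𝓡 (n + 1)) f p) (ha : ∀ᶠ q in 𝓝 p, a q = 0) :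
    covAlong J cov f a p = 0 := by
  have h := covAlong_sum (cov := cov) (f := f) (p := p) (J := J) (ι := Empty)
    (X := fun i => i.elim) (fun i => i.elim) (c := fun i => i.elim) (fun i => i.elim) hf Finset.univ
  simp only [Finset.univ_eq_empty, Finset.sum_empty] at h
  rw [covAlong_congr h.1 ha]
  ext1 y
  exact h.2 y

variable {f : N → TangentBundle (𝓡 (n + 1)) M} {p : N}
  {Z : ∀ q, TangentSpace (𝓡 (n + 1)).tangent (f q)} {a : ∀ q, TangentSpace (𝓡 (n + 1)) (f q).proj}

theorem mdifferentiableAt_proj_comp (hf : MDifferentiableAt J (𝓡 (n + 1)).tangent f p) :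
    MDifferentiableAt J (𝓡 (n + 1)) (fun q => (f q).proj) p :=
  MDifferentiableAt.comp p ((contMDiff_proj (n := ∞) _).mdifferentiableAt (by simp)) hf

/-- `∇^*` of a horizontal lift is the horizontal lift of the pull-back of `∇`. -/
theorem nablaStarAlong_hLift (hf : MDifferentiableAt J (𝓡 (n + 1)).tangent f p)
    (ha : MDifferentiableAt J (𝓡 (n + 1)).tangent (alongMap (fun q => (f q).proj) a) p)
    (hZ : ∀ᶠ q in 𝓝 p, Z q = hLift cov (f q) (a q)) (y : TangentSpace J p) :
    nablaStarAlong cov J f Z p y =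
      hLift cov (f p) (covAlong J cov (fun q => (f q).proj) a p y) := by
  change hLift cov (f p) (covAlong J cov (fun q => (f q).proj) (fun q => dProj (f q) (Z q)) p y) +
    vLift (f p) (covAlong J cov (fun q => (f q).proj) (fun q => connMap cov (f q) (Z q)) p y) = _
  have h1 := covAlong_congr (cov := cov) (a := fun q => dProj (f q) (Z q)) ha
    (hZ.mono fun q hq => by rw [hq, dProj_hLift])
  have h2 := covAlong_eq_zero (cov := cov) (a := fun q => connMap cov (f q) (Z q))
    (mdifferentiableAt_proj_comp hf) (hZ.mono fun q hq => by rw [hq, connMap_hLift])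
  rw [h1, h2, zero_apply, map_zero, add_zero]

/-- `∇^*` of a vertical lift is the vertical lift of the pull-back of `∇`. -/
theorem nablaStarAlong_vLift (hf : MDifferentiableAt J (𝓡 (n + 1)).tangent f p)
    (ha : MDifferentiableAt J (𝓡 (n + 1)).tangent (alongMap (fun q => (f q).proj) a) p)
    (hZ : ∀ᶠ q in 𝓝 p, Z q = vLift (f q) (a q)) (y : TangentSpace J p) :
    nablaStarAlong cov J f Z p y =
      vLift (f p) (covAlong J cov (fun q => (f q).proj) a p y) := by
  change hLift cov (f p) (covAlong J cov (fun q => (f q).proj) (fun q => dProj (f q) (Z q)) p y) +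
    vLift (f p) (covAlong J cov (fun q => (f q).proj) (fun q => connMap cov (f q) (Z q)) p y) = _
  have h1 := covAlong_congr (cov := cov) (a := fun q => connMap cov (f q) (Z q)) ha
    (hZ.mono fun q hq => by rw [hq, connMap_vLift])
  have h2 := covAlong_eq_zero (cov := cov) (a := fun q => dProj (f q) (Z q))
    (mdifferentiableAt_proj_comp hf) (hZ.mono fun q hq => by rw [hq, dProj_vLift])
  rw [h1, h2, zero_apply, map_zero, zero_add]

variable (cov) in
/-- The frame `p` of `T_u T_M` consists of the horizontal and of the vertical lifts of `b`. -/
def IsLiftOf (u : TangentBundle (𝓡 (n + 1)) M) (b : Fin (n + 1) → TangentSpace (𝓡 (n + 1)) u.proj)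
    (p : Fin (n + 1) ⊕ Fin (n + 1) → TangentSpace (𝓡 (n + 1)).tangent u) : Prop :=
  (∀ i, p (Sum.inl i) = hLift cov u (b i)) ∧ ∀ i, p (Sum.inr i) = vLift u (b i)

variable {u : TangentBundle (𝓡 (n + 1)) M} {b : Fin (n + 1) → TangentSpace (𝓡 (n + 1)) u.proj}
  {e : Fin (n + 1) ⊕ Fin (n + 1) → TangentSpace (𝓡 (n + 1)).tangent u}

theorem IsLiftOf.eq_basis (b : Basis (Fin (n + 1)) ℝ (TangentSpace (𝓡 (n + 1)) u.proj))
    (h : IsLiftOf cov u b e) : e = (b.prod b).map (liftEquiv cov u) := by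
  funext i
  rcases i with i | i
  · rw [h.1]
    simp [liftEquiv_apply]
  · rw [h.2]
    simp [liftEquiv_apply]

theorem IsLiftOf.frameAct (h : IsLiftOf cov u b e) (g : Matrix (Fin (n + 1)) (Fin (n + 1)) ℝ) :
    IsLiftOf cov u (fun j => ∑ i, g i j • b i) (frameAct e (blockDiag _ _ (g, g))) := by
  refine ⟨fun j => ?_, fun j => ?_⟩
  · rw [frameAct_blockDiag_inl, map_sum]
    simp only [map_smul, h.1]
  · rw [frameAct_blockDiag_inr, map_sum]
    simp only [map_smul, h.2]

theorem IsLiftOf.ext {e' : Fin (n + 1) ⊕ Fin (n + 1) → TangentSpace (𝓡 (n + 1)).tangent u}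
    (h : IsLiftOf cov u b e) (h' : IsLiftOf cov u b e') : e = e' := by
  funext i
  rcases i with i | i
  · rw [h.1, h'.1]
  · rw [h.2, h'.2]

theorem IsLiftOf.base_eq {b' : Fin (n + 1) → TangentSpace (𝓡 (n + 1)) u.proj}
    (h : IsLiftOf cov u b e) (h' : IsLiftOf cov u b' e) : b = b' := by
  funext i
  rw [← dProj_hLift cov u (b i), ← h.1, h'.1, dProj_hLift]

end LiftedFrames

/-! ### The `SO(n+1)`-structure of `T_M` -/

section TangentStructure

variable {n : ℕ} {M : Type*} [TopologicalSpace M] [T2Space M]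
  [ChartedSpace (EuclideanSpace ℝ (Fin (n + 1))) M] [IsManifold (𝓡 (n + 1)) ∞ M]
  [RiemannianBundle (TangentSpace (𝓡 (n + 1)) : M → Type _)]
  [IsContMDiffRiemannianBundle (𝓡 (n + 1)) ∞ (EuclideanSpace ℝ (Fin (n + 1)))
    (TangentSpace (𝓡 (n + 1)) : M → Type _)]
  {o : ∀ x : M, Orientation ℝ (TangentSpace (𝓡 (n + 1)) x) (Fin (n + 1))}
  {cov : CovariantDerivative (𝓡 (n + 1)) (EuclideanSpace ℝ (Fin (n + 1)))
    (TangentSpace (𝓡 (n + 1)) : M → Type _)}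

theorem contMDiffAt_self (u : TangentBundle (𝓡 (n + 1)) M) :
    ContMDiffAt (𝓡 (n + 1)).tangent (𝓡 (n + 1)).tangent ∞
      (alongMap (fun v : TangentBundle (𝓡 (n + 1)) M => v.proj) fun v => v.2) u := contMDiffAt_id

theorem contMDiff_field_proj {X : ∀ x : M, TangentSpace (𝓡 (n + 1)) x}
    (hX : ContMDiff (𝓡 (n + 1)) (𝓡 (n + 1)).tangent ∞ (alongMap (fun z => z) X)) :
    ContMDiff (𝓡 (n + 1)).tangent (𝓡 (n + 1)).tangent ∞
      (alongMap (fun v : TangentBundle (𝓡 (n + 1)) M => v.proj) fun v => X v.proj) :=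
  hX.comp (contMDiff_proj _)

/-- On `T_M`, the horizontal lift of a smooth section of `π^* TM` is smooth. -/
theorem contMDiffAt_hLift_self (ho : IsManifoldOrientation o)
    (hcov : CovariantDerivative.ContMDiffCovariantDerivative cov ∞)
    {b : ∀ v : TangentBundle (𝓡 (n + 1)) M, TangentSpace (𝓡 (n + 1)) v.proj}
    {u : TangentBundle (𝓡 (n + 1)) M}
    (hb : ContMDiffAt (𝓡 (n + 1)).tangent (𝓡 (n + 1)).tangent ∞ (alongMap (fun v => v.proj) b) u) :
    ContMDiffAt (𝓡 (n + 1)).tangent (𝓡 (n + 1)).tangent.tangent ∞ (fun v => (⟨v, hLift cov v (b v)⟩ :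
      TangentBundle (𝓡 (n + 1)).tangent (TangentBundle (𝓡 (n + 1)) M))) u := by
  obtain ⟨U, X, hU, hpU, hX, hfr⟩ := exists_orthonormal_fields ho u.proj
  refine contMDiffAt_hLift hcov hX (c := fun v => v)
    (a := fun i v => inner ℝ (X i v.proj) v.2) (fun i => ?_) ?_ contMDiffAt_id hb
  · exact ContMDiffAt.inner_bundle (IB := 𝓡 (n + 1)) (contMDiff_field_proj (hX i)).contMDiffAt
      (contMDiffAt_self u)
  · have hπ : ContinuousAt (fun v : TangentBundle (𝓡 (n + 1)) M => v.proj) u :=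
      (FiberBundle.continuous_proj _ _).continuousAt
    filter_upwards [hπ (hU.mem_nhds hpU)] with v hv
    obtain ⟨e, -, he⟩ := hfr v.proj hv
    simp only [← he]
    exact (e.sum_repr' v.2).symm

/-- The frames of `T_M` that lift a smooth family of bases along `π` form a smooth family. -/
theorem contMDiffAt_liftFrame (ho : IsManifoldOrientation o)
    (hcov : CovariantDerivative.ContMDiffCovariantDerivative cov ∞)
    {b : ∀ v : TangentBundle (𝓡 (n + 1)) M, Fin (n + 1) → TangentSpace (𝓡 (n + 1)) v.proj}
    {u : TangentBundle (𝓡 (n + 1)) M}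
    (hb : ∀ i, ContMDiffAt (𝓡 (n + 1)).tangent (𝓡 (n + 1)).tangent ∞
      (alongMap (fun v => v.proj) fun v => b v i) u) (j : Fin (n + 1) ⊕ Fin (n + 1)) :
    ContMDiffAt (𝓡 (n + 1)).tangent (𝓡 (n + 1)).tangent.tangent ∞
      (fun v => (⟨v, (Sum.elim (fun i => hLift cov v (b v i)) (fun i => vLift v (b v i)) j :
        TangentSpace (𝓡 (n + 1)).tangent v)⟩ :
      TangentBundle (𝓡 (n + 1)).tangent (TangentBundle (𝓡 (n + 1)) M))) u := by
  rcases j with j | j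
  · exact contMDiffAt_hLift_self ho hcov (hb j)
  · exact contMDiffAt_vLift (c := fun v => v) contMDiffAt_id (hb j)

theorem isGStructure_tangentFrames (ho : IsManifoldOrientation o)
    (hcov : CovariantDerivative.ContMDiffCovariantDerivative cov ∞) :
    IsGStructure (𝓡 (n + 1)).tangent (rhoTangent n) (tangentFrames o cov) Set.univ where
  isOpen := isOpen_univ
  linearIndependent := by
    rintro u - p ⟨b, -, hp⟩
    have hp' : IsLiftOf cov u b.toBasis p := by simpa [IsLiftOf] using hp
    rw [hp'.eq_basis]
    exact Basis.linearIndependent _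
  span_eq_top := by
    rintro u - p ⟨b, -, hp⟩
    have hp' : IsLiftOf cov u b.toBasis p := by simpa [IsLiftOf] using hp
    rw [hp'.eq_basis]
    exact Basis.span_eq _
  act_mem := by
    rintro u - p ⟨b, hb, hp⟩ g
    obtain ⟨b', hb', h⟩ := exists_orthonormalBasis_rotate b g.2
    have := IsLiftOf.frameAct hp g
    rw [← funext h] at this
    exact ⟨b', hb'.trans hb, this⟩
  existsUnique_act := by
    rintro u - p ⟨b, hb, hp⟩ q ⟨b', hb', hq⟩
    obtain ⟨g, hg, h⟩ := exists_rotation b b' (hb.trans hb'.symm)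
    refine ⟨⟨g, hg⟩, ?_, fun g' hg' => ?_⟩
    · have := IsLiftOf.frameAct hp g
      rw [← funext h] at this
      exact IsLiftOf.ext hq this
    · have h1 := IsLiftOf.frameAct hp g'
      have h2 : q = frameAct p (blockDiag _ _ (g'.1, g'.1)) := hg'
      rw [← h2] at h1
      have h3 := h1.base_eq hq
      exact Subtype.ext (eq_of_sum_smul_eq b fun j => (congrFun h3 j).trans (h j))
  exists_section := by
    intro u _
    obtain ⟨U, X, hU, hpU, hX, hfr⟩ := exists_orthonormal_fields ho u.proj
    refine ⟨(fun v : TangentBundle (𝓡 (n + 1)) M => v.proj) ⁻¹' U,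
      fun v => Sum.elim (fun i => hLift cov v (X i v.proj)) (fun i => vLift v (X i v.proj)),
      hpU, Set.subset_univ _, hU.preimage (FiberBundle.continuous_proj _ _), fun j v hv => ?_, ?_⟩
    · exact (contMDiffAt_liftFrame ho hcov (fun i => (contMDiff_field_proj (hX i)).contMDiffAt)
        j).contMDiffWithinAt
    · intro v hv
      obtain ⟨b, hb, hbX⟩ := hfr v.proj hv
      exact ⟨b, hb, fun i => by rw [hbX]; rfl, fun i => by rw [hbX]; rfl⟩

/-- The horizontal component of a smooth vector field on `T_M` is smooth. -/
theorem contMDiffOn_dProj {U : Set (TangentBundle (𝓡 (n + 1)) M)}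
    {Z : ∀ v : TangentBundle (𝓡 (n + 1)) M, TangentSpace (𝓡 (n + 1)).tangent v}
    (hZ : ContMDiffOn (𝓡 (n + 1)).tangent (𝓡 (n + 1)).tangent.tangent ∞ (fun v => (⟨v, Z v⟩ :
      TangentBundle (𝓡 (n + 1)).tangent (TangentBundle (𝓡 (n + 1)) M))) U) :
    ContMDiffOn (𝓡 (n + 1)).tangent (𝓡 (n + 1)).tangent ∞
      (alongMap (fun v => v.proj) fun v => dProj v (Z v)) U := by
  have h : ContMDiff (𝓡 (n + 1)).tangent.tangent (𝓡 (n + 1)).tangent ∞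
      (tangentMap (𝓡 (n + 1)).tangent (𝓡 (n + 1))
        (fun v : TangentBundle (𝓡 (n + 1)) M => v.proj)) :=
    (contMDiff_proj (n := ∞) _).contMDiff_tangentMap (by simp)
  exact h.comp_contMDiffOn hZ

/-- The connection matrix of `∇^*` in a lifted frame is `A ⊕ A`, where `A` is the matrix of the
pull-back of `∇`; it is skew-symmetric because `∇` is metric. -/
theorem isReducible_tangentFrames (ho : IsManifoldOrientation o) (hmetric : cov.IsMetricCompatible) :
    IsReducible (𝓡 (n + 1)).tangent (nablaStar cov) (rhoTangent n) (tangentFrames o cov)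
      Set.univ := by
  intro U e _ he u hu y
  let a : Fin (n + 1) → ∀ v : TangentBundle (𝓡 (n + 1)) M, TangentSpace (𝓡 (n + 1)) v.proj :=
    fun i v => dProj v (e v (Sum.inl i))
  have ha : ∀ v ∈ U, ∃ b : OrthonormalBasis (Fin (n + 1)) ℝ (TangentSpace (𝓡 (n + 1)) v.proj),
      (∀ i, b i = a i v) ∧ (∀ i, e v (Sum.inl i) = hLift cov v (a i v)) ∧
        ∀ i, e v (Sum.inr i) = vLift v (a i v) := by
    intro v hv
    obtain ⟨b, -, h1, h2⟩ := he.mem v hv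
    have h3 : ∀ i, b i = a i v := fun i => by simp only [a, h1, dProj_hLift]
    exact ⟨b, h3, fun i => by rw [h1, h3], fun i => by rw [h2, h3]⟩
  have had : ∀ i, MDifferentiableAt (𝓡 (n + 1)).tangent (𝓡 (n + 1)).tangent
      (alongMap (fun v => v.proj) (a i)) u := fun i =>
    ((contMDiffOn_dProj (he.contMDiffOn (Sum.inl i))).contMDiffAt
      (he.isOpen.mem_nhds hu)).mdifferentiableAt (by simp)
  have hU : ∀ᶠ v in 𝓝 u, v ∈ U := he.isOpen.mem_nhds hu
  obtain ⟨b, hb, hbl, hbr⟩ := ha u hu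
  let A : Matrix (Fin (n + 1)) (Fin (n + 1)) ℝ := fun i j =>
    inner ℝ (b i) (covAlong (𝓡 (n + 1)).tangent cov (fun v => v.proj) (a j) u y)
  have hA : A.transpose = -A := by
    ext i j
    have h1 := covAlong_metric ho hmetric (had i) (had j) y
    have h2 : (fun v => (inner ℝ (a i v) (a j v) : ℝ)) =ᶠ[𝓝 u] fun _ => if i = j then 1 else 0 := by
      filter_upwards [hU] with v hv
      obtain ⟨b', hb', -⟩ := ha v hv
      rw [← hb', ← hb', b'.inner_eq_ite]
    rw [mvfderiv_congr h2, mvfderiv_const, ← hb, ← hb, real_inner_comm] at h1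
    have h3 : (0 : ℝ) = A j i + A i j := h1
    simp only [Matrix.transpose_apply, Matrix.neg_apply]
    linarith
  have hexp : ∀ j, covAlong (𝓡 (n + 1)).tangent cov (fun v => v.proj) (a j) u y =
      ∑ i, A i j • b i := fun j => (b.sum_repr' _).symm
  refine ⟨_, blockDiag_mem_lieAlgebra_rhoTangent hA, funext fun j => ?_⟩
  rcases j with j | j
  · rw [frameAct_blockDiag_inl]
    refine (nablaStarAlong_hLift (cov := cov) (f := id) mdifferentiableAt_id (had j)
      (hU.mono fun v hv => ?_) y).trans ?_
    · exact (ha v hv).choose_spec.2.1 j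
    · refine (congrArg _ (hexp j)).trans ?_
      rw [map_sum]
      simp only [map_smul, hbl, hb]
      rfl
  · rw [frameAct_blockDiag_inr]
    refine (nablaStarAlong_vLift (cov := cov) (f := id) mdifferentiableAt_id (had j)
      (hU.mono fun v hv => ?_) y).trans ?_
    · exact (ha v hv).choose_spec.2.2 j
    · refine (congrArg _ (hexp j)).trans ?_
      rw [map_sum]
      simp only [map_smul, hbr, hb]
      rfl

end TangentStructure

/-! ### The `SO(n)`-structure off the zero section -/

/-- In dimension at least two, there is a diagonal rotation that changes the sign of the first vector. -/
theorem exists_diagonal_mem_SO {n : ℕ} (hn : 1 ≤ n) :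
    ∃ d : Fin (n + 1) → ℝ, d 0 = -1 ∧ Matrix.diagonal d ∈ SO (n + 1) := by
  obtain ⟨m, rfl⟩ : ∃ m, n = m + 1 := ⟨n - 1, by omega⟩
  let d : Fin (m + 1 + 1) → ℝ := Fin.cons (-1) (Fin.cons (-1) fun _ => 1)
  refine ⟨d, rfl, ?_⟩
  have hd : ∀ i, d i * d i = 1 := fun i => by
    refine Fin.cases ?_ (fun i => Fin.cases ?_ (fun i => ?_) i) i <;> simp [d]
  rw [Matrix.mem_specialOrthogonalGroup_iff, Matrix.mem_orthogonalGroup_iff]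
  constructor
  · rw [Matrix.diagonal_transpose, Matrix.diagonal_mul_diagonal]
    simp [hd]
  · rw [Matrix.det_diagonal, Fin.prod_univ_succ, Fin.prod_univ_succ]
    simp [d]

section AdaptedFrames

variable {n : ℕ} {M : Type*} [TopologicalSpace M] [T2Space M]
  [ChartedSpace (EuclideanSpace ℝ (Fin (n + 1))) M] [IsManifold (𝓡 (n + 1)) ∞ M]
  [RiemannianBundle (TangentSpace (𝓡 (n + 1)) : M → Type _)]
  [IsContMDiffRiemannianBundle (𝓡 (n + 1)) ∞ (EuclideanSpace ℝ (Fin (n + 1)))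
    (TangentSpace (𝓡 (n + 1)) : M → Type _)]
  {o : ∀ x : M, Orientation ℝ (TangentSpace (𝓡 (n + 1)) x) (Fin (n + 1))}
  {cov : CovariantDerivative (𝓡 (n + 1)) (EuclideanSpace ℝ (Fin (n + 1)))
    (TangentSpace (𝓡 (n + 1)) : M → Type _)}

theorem isOpen_ne_zero : IsOpen {u : TangentBundle (𝓡 (n + 1)) M | u.2 ≠ 0} := by
  have hcont : Continuous fun u : TangentBundle (𝓡 (n + 1)) M => (inner ℝ u.2 u.2 : ℝ) :=
    (ContMDiff.inner_bundle (IB := 𝓡 (n + 1)) (F := EuclideanSpace ℝ (Fin (n + 1))) (n := ∞)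
      (E := (TangentSpace (𝓡 (n + 1)) : M → Type _)) (IM := (𝓡 (n + 1)).tangent)
      (b := fun u : TangentBundle (𝓡 (n + 1)) M => u.proj) (v := fun u => u.2) (w := fun u => u.2)
      contMDiff_id contMDiff_id).continuous
  have hU : {u : TangentBundle (𝓡 (n + 1)) M | u.2 ≠ 0} =
      (fun u : TangentBundle (𝓡 (n + 1)) M => (inner ℝ u.2 u.2 : ℝ)) ⁻¹' {0}ᶜ := by
    ext u
    simp
  exact hU ▸ isOpen_compl_singleton.preimage hcont

/-- A local oriented orthonormal frame whose first vector, if `w` is a unit vector, differs from `-w`;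
in dimension at least two, this can be achieved by changing the sign of the first two vectors. -/
theorem exists_orthonormal_fields_inner_ne (ho : IsManifoldOrientation o) (hn : 1 ≤ n) (x₀ : M)
    (w : TangentSpace (𝓡 (n + 1)) x₀) :
    ∃ (U : Set M) (X : Fin (n + 1) → ∀ x : M, TangentSpace (𝓡 (n + 1)) x), IsOpen U ∧ x₀ ∈ U ∧
      (∀ i, ContMDiff (𝓡 (n + 1)) (𝓡 (n + 1)).tangent ∞ (alongMap (fun z => z) (X i))) ∧
      (∀ x ∈ U, ∃ b : OrthonormalBasis (Fin (n + 1)) ℝ (TangentSpace (𝓡 (n + 1)) x),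
        b.toBasis.orientation = o x ∧ ∀ i, b i = X i x) ∧ (inner ℝ (X 0 x₀) w : ℝ) ≠ -1 := by
  obtain ⟨U, X, hU, hpU, hX, hfr⟩ := exists_orthonormal_fields ho x₀
  by_cases hw : (inner ℝ (X 0 x₀) w : ℝ) = -1
  · obtain ⟨d, hd0, hd⟩ := exists_diagonal_mem_SO hn
    refine ⟨U, fun i x => d i • X i x, hU, hpU, fun i x => ?_, fun x hx => ?_, ?_⟩
    · exact ContMDiffWithinAt.smul_along contMDiffWithinAt_const (hX i x)
    · obtain ⟨b, hb, hbX⟩ := hfr x hx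
      obtain ⟨b', hb', h⟩ := exists_orthonormalBasis_rotate b hd
      refine ⟨b', hb'.trans hb, fun j => ?_⟩
      rw [h, Finset.sum_eq_single j]
      · rw [Matrix.diagonal_apply_eq, hbX]
      · intro i _ hi
        rw [Matrix.diagonal_apply_ne _ hi, zero_smul]
      · simp
    · rw [real_inner_smul_left, hw, hd0]
      norm_num
  · exact ⟨U, X, hU, hpU, hX, hfr, hw⟩

/-- The unit tautological section of `π^* TM` is smooth off the zero section. -/
theorem contMDiffAt_unitSelf {u : TangentBundle (𝓡 (n + 1)) M} (hu : u.2 ≠ 0) :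
    ContMDiffAt (𝓡 (n + 1)).tangent (𝓡 (n + 1)).tangent ∞
      (alongMap (fun v : TangentBundle (𝓡 (n + 1)) M => v.proj) fun v => ‖v.2‖⁻¹ • v.2) u := by
  have h1 := (contMDiffOn_norm (n := n) (M := M) u hu).contMDiffAt (isOpen_ne_zero.mem_nhds hu)
  have h2 : ContDiffAt ℝ ∞ (fun t : ℝ => t⁻¹) ‖u.2‖ := contDiffAt_inv ℝ (norm_ne_zero_iff.2 hu)
  exact ContMDiffWithinAt.smul_along (h2.contMDiffAt.comp u h1) (contMDiffAt_self u)

/-- Around `u₀ ≠ 0` there are smooth sections of `π^* TM` which form, at each `u`, an oriented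
orthonormal basis with first vector `u / ‖u‖`: a local frame of `M`, rotated by the smallest rotation
that brings its first vector to `u / ‖u‖`. -/
theorem exists_adapted_fields (ho : IsManifoldOrientation o) (hn : 1 ≤ n)
    {u₀ : TangentBundle (𝓡 (n + 1)) M} (hu₀ : u₀.2 ≠ 0) :
    ∃ (U : Set (TangentBundle (𝓡 (n + 1)) M))
      (a : ∀ v : TangentBundle (𝓡 (n + 1)) M, Fin (n + 1) → TangentSpace (𝓡 (n + 1)) v.proj),
      IsOpen U ∧ u₀ ∈ U ∧ U ⊆ {u | u.2 ≠ 0} ∧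
      (∀ i, ∀ v ∈ U, ContMDiffAt (𝓡 (n + 1)).tangent (𝓡 (n + 1)).tangent ∞
        (alongMap (fun v => v.proj) fun v => a v i) v) ∧
      ∀ v ∈ U, ∃ b : OrthonormalBasis (Fin (n + 1)) ℝ (TangentSpace (𝓡 (n + 1)) v.proj),
        b.toBasis.orientation = o v.proj ∧ b 0 = ‖v.2‖⁻¹ • v.2 ∧ ∀ i, b i = a v i := by
  obtain ⟨U, X, hU, hpU, hX, hfr, hne⟩ :=
    exists_orthonormal_fields_inner_ne ho hn u₀.proj (‖u₀.2‖⁻¹ • u₀.2)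
  let c : TangentBundle (𝓡 (n + 1)) M → Fin (n + 1) → ℝ :=
    fun v i => inner ℝ (X i v.proj) (‖v.2‖⁻¹ • v.2)
  have hc : ∀ v : TangentBundle (𝓡 (n + 1)) M, v.2 ≠ 0 → ∀ i,
      ContMDiffAt (𝓡 (n + 1)).tangent 𝓘(ℝ, ℝ) ∞ (fun v => c v i) v := fun v hv i =>
    ContMDiffAt.inner_bundle (IB := 𝓡 (n + 1)) (contMDiff_field_proj (hX i)).contMDiffAt
      (contMDiffAt_unitSelf hv)
  let V : Set (TangentBundle (𝓡 (n + 1)) M) := {u | u.2 ≠ 0} ∩ (fun v => c v 0) ⁻¹' {-1}ᶜ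
  have hV : IsOpen V := ContinuousOn.isOpen_inter_preimage
    (fun v hv => (hc v hv 0).continuousAt.continuousWithinAt) isOpen_ne_zero isOpen_compl_singleton
  refine ⟨(fun v : TangentBundle (𝓡 (n + 1)) M => v.proj) ⁻¹' U ∩ V,
    fun v j => ∑ i, rotTo (c v) i j • X i v.proj,
    (hU.preimage (FiberBundle.continuous_proj _ _)).inter hV, ⟨hpU, hu₀, hne⟩,
    fun v hv => hv.2.1, fun j v hv => ?_, fun v hv => ?_⟩
  · have hcv := hc v hv.2.1
    have h0 : ContDiffAt ℝ ∞ (fun t : ℝ => (1 + t)⁻¹) (c v 0) :=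
      (contDiffAt_const.add contDiffAt_id).inv fun h => hv.2.2
        (eq_neg_of_add_eq_zero_right h)
    have hinv : ContMDiffAt (𝓡 (n + 1)).tangent 𝓘(ℝ, ℝ) ∞ (fun v => (1 + c v 0)⁻¹) v :=
      h0.contMDiffAt.comp (g := fun t : ℝ => (1 + t)⁻¹) v (hcv 0)
    refine ContMDiffWithinAt.sum_along Finset.univ (contMDiff_proj _).contMDiffAt fun i _ =>
      ContMDiffWithinAt.smul_along ?_ (contMDiff_field_proj (hX i)).contMDiffAt
    simp only [rotTo_apply, Pi.add_apply]
    have hk : ∀ k, ContMDiffAt (𝓡 (n + 1)).tangent 𝓘(ℝ, ℝ) ∞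
      (fun v => (Pi.single 0 1 : Fin (n + 1) → ℝ) k + c v k) v := fun k =>
      contMDiffAt_const.add (hcv k)
    exact (((contMDiffAt_const.sub ((hinv.mul (hk i)).mul (hk j))).sub contMDiffAt_const).add
      (((contMDiffAt_const.mul (hk i)).mul contMDiffAt_const).mul
        (hinv.mul (contMDiffAt_const.add (hcv 0)))))
  · obtain ⟨b, hb, hbX⟩ := hfr v.proj hv.1
    have hv0 : ‖v.2‖ ≠ 0 := norm_ne_zero_iff.2 hv.2.1
    have hcb : ∀ i, c v i = inner ℝ (b i) (‖v.2‖⁻¹ • v.2) := fun i => by rw [hbX]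
    have hcc : c v ⬝ᵥ c v = 1 := by
      have h1 : ‖‖v.2‖⁻¹ • v.2‖ = 1 := by simp [norm_smul, hv0]
      have h2 := b.sum_inner_mul_inner (‖v.2‖⁻¹ • v.2) (‖v.2‖⁻¹ • v.2)
      rw [real_inner_self_eq_norm_sq, h1, one_pow] at h2
      rw [← h2, dotProduct]
      refine Finset.sum_congr rfl fun i _ => ?_
      rw [hcb, real_inner_comm (b i)]
    obtain ⟨b', hb', h⟩ := exists_orthonormalBasis_rotate b (rotTo_mem_SO hcc hv.2.2)
    refine ⟨b', hb'.trans hb, ?_, fun i => ?_⟩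
    · rw [h]
      simp only [rotTo_col_zero hv.2.2, hcb]
      exact b.sum_repr' _
    · simp only [h, hbX]

theorem isGStructure_adaptedFrames (ho : IsManifoldOrientation o)
    (hcov : CovariantDerivative.ContMDiffCovariantDerivative cov ∞) (hn : 1 ≤ n) :
    IsGStructure (𝓡 (n + 1)).tangent (rhoNonzero n) (adaptedFrames o cov)
      {u : TangentBundle (𝓡 (n + 1)) M | u.2 ≠ 0} where
  isOpen := isOpen_ne_zero
  linearIndependent := by
    rintro u - p ⟨b, hb, -, hp⟩
    exact (isGStructure_tangentFrames ho hcov).linearIndependent u trivial p ⟨b, hb, hp⟩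
  span_eq_top := by
    rintro u - p ⟨b, hb, -, hp⟩
    exact (isGStructure_tangentFrames ho hcov).span_eq_top u trivial p ⟨b, hb, hp⟩
  act_mem := by
    rintro u - p ⟨b, hb, hb0, hp⟩ g
    obtain ⟨b', hb', h⟩ := exists_orthonormalBasis_rotate b (fixFirst_mem_SO_iff.2 g.2)
    have := IsLiftOf.frameAct hp (fixFirst n g)
    rw [← funext h] at this
    refine ⟨b', hb'.trans hb, ?_, this⟩
    rw [h, ← hb0]
    simp only [fixFirst_col_zero, Matrix.one_apply, ite_smul, one_smul, zero_smul]
    simp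
  existsUnique_act := by
    rintro u - p ⟨b, hb, hb0, hp⟩ q ⟨b', hb', hb0', hq⟩
    obtain ⟨g, hg, h⟩ := exists_rotation b b' (hb.trans hb'.symm)
    have hcol : ∀ i, g i 0 = (1 : Matrix (Fin (n + 1)) (Fin (n + 1)) ℝ) i 0 := fun i => by
      have h1 := h 0
      rw [hb0', ← hb0] at h1
      have h2 := congrArg (fun v => inner ℝ (b i) v) h1
      simpa [inner_sum, inner_smul_right, OrthonormalBasis.inner_eq_ite, Matrix.one_apply]
        using h2.symm
    obtain ⟨k, hk, rfl⟩ := exists_fixFirst_of_col hg hcol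
    refine ⟨⟨k, hk⟩, ?_, fun g' hg' => ?_⟩
    · have := IsLiftOf.frameAct hp (fixFirst n k)
      rw [← funext h] at this
      exact IsLiftOf.ext hq this
    · have h1 := IsLiftOf.frameAct hp (fixFirst n g')
      have h2 : q = frameAct p (blockDiag _ _ (fixFirst n g'.1, fixFirst n g'.1)) := hg'
      rw [← h2] at h1
      have h3 := h1.base_eq hq
      exact Subtype.ext (fixFirst_injective n
        (eq_of_sum_smul_eq b fun j => (congrFun h3 j).trans (h j)))
  exists_section := by
    intro u hu
    obtain ⟨U, a, hU, huU, hU0, ha, hfr⟩ := exists_adapted_fields ho hn hu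
    refine ⟨U, fun v => Sum.elim (fun i => hLift cov v (a v i)) (fun i => vLift v (a v i)),
      huU, hU0, hU, fun j v hv => ?_, ?_⟩
    · exact (contMDiffAt_liftFrame ho hcov (fun i => ha i v hv) j).contMDiffWithinAt
    · intro v hv
      obtain ⟨b, hb, hb0, hba⟩ := hfr v hv
      exact ⟨b, hb, hb0, fun i => by rw [hba]; rfl, fun i => by rw [hba]; rfl⟩

/-- In dimension at least two, every tangent vector has a non-zero orthogonal vector. -/
theorem exists_orthogonal_ne_zero (ho : IsManifoldOrientation o) (hn : 1 ≤ n) {x : M}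
    (v : TangentSpace (𝓡 (n + 1)) x) :
    ∃ w : TangentSpace (𝓡 (n + 1)) x, w ≠ 0 ∧ (inner ℝ w v : ℝ) = 0 := by
  obtain ⟨U, X, -, hpU, -, hfr⟩ := exists_orthonormal_fields ho x
  obtain ⟨b, -⟩ := hfr x hpU
  have : FiniteDimensional ℝ (TangentSpace (𝓡 (n + 1)) x) := b.toBasis.finiteDimensional_of_finite
  have hd : finrank ℝ (TangentSpace (𝓡 (n + 1)) x) = n + 1 := by
    simpa using finrank_eq_card_basis b.toBasis
  have h1 : (ℝ ∙ v)ᗮ ≠ ⊥ := fun h => by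
    have h2 := Submodule.finrank_add_finrank_orthogonal (ℝ ∙ v)
    rw [h, finrank_bot, hd] at h2
    have h3 := finrank_span_le_card (R := ℝ) ({v} : Set (TangentSpace (𝓡 (n + 1)) x))
    simp at h3
    omega
  obtain ⟨w, hw, hw0⟩ := Submodule.exists_mem_ne_zero_of_ne_bot h1
  exact ⟨w, hw0, by rw [real_inner_comm]; exact Submodule.mem_orthogonal_singleton_iff_inner_right.1 hw⟩

theorem exists_tangent_ne_zero [Nonempty M] :
    ∃ u : TangentBundle (𝓡 (n + 1)) M, u.2 ≠ 0 := by
  obtain ⟨x⟩ := ‹Nonempty M›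
  obtain ⟨v, hv⟩ := exists_ne (0 : EuclideanSpace ℝ (Fin (n + 1)))
  exact ⟨⟨x, v⟩, hv⟩

/-- The vertical field `ξ / ‖ξ‖`, which belongs to all adapted frames, is not parallel: its derivative
along a vertical vector `w^v` with `w ⊥ u` is `w^v / ‖u‖`. -/
theorem not_isReducible_adaptedFrames [Nonempty M] (ho : IsManifoldOrientation o)
    (hcov : CovariantDerivative.ContMDiffCovariantDerivative cov ∞) (hn : 1 ≤ n) :
    ¬ IsReducible (𝓡 (n + 1)).tangent (nablaStar cov) (rhoNonzero n) (adaptedFrames o cov)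
      {u : TangentBundle (𝓡 (n + 1)) M | u.2 ≠ 0} := by
  intro hred
  obtain ⟨u, hu⟩ := exists_tangent_ne_zero (n := n) (M := M)
  obtain ⟨w, hw0, hw⟩ := exists_orthogonal_ne_zero ho hn u.2
  obtain ⟨U, e, huU, hU0, he⟩ := (isGStructure_adaptedFrames ho hcov hn).exists_section u hu
  obtain ⟨A, hA, h⟩ := hred U e hU0 he u huU (vLift u w)
  have h1 := congrFun h (Sum.inr 0)
  rw [frameAct_eq_zero_of_col (rhoNonzero_col n) hA] at h1
  have h2 : nablaStar cov (fun z => e z (Sum.inr 0)) u (vLift u w) = vLift u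
      (covAlong (𝓡 (n + 1)).tangent cov (fun v : TangentBundle (𝓡 (n + 1)) M => v.proj)
        (fun v => ‖v.2‖⁻¹ • v.2) u (vLift u w)) := by
    refine nablaStarAlong_vLift (cov := cov) (f := id) mdifferentiableAt_id
      ((contMDiffAt_unitSelf hu).mdifferentiableAt (by simp)) ?_ _
    filter_upwards [he.isOpen.mem_nhds huU] with v hv
    obtain ⟨b, -, hb0, -, hb⟩ := he.mem v hv
    exact (hb 0).trans (congrArg _ hb0)
  have hnorm : MDifferentiableAt (𝓡 (n + 1)).tangent 𝓘(ℝ, ℝ)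
      (fun v : TangentBundle (𝓡 (n + 1)) M => ‖v.2‖⁻¹) u := by
    have h1 := (contMDiffOn_norm (n := n) (M := M) u hu).contMDiffAt (isOpen_ne_zero.mem_nhds hu)
    have h2 : ContDiffAt ℝ ∞ (fun t : ℝ => t⁻¹) ‖u.2‖ := contDiffAt_inv ℝ (norm_ne_zero_iff.2 hu)
    exact (h2.contMDiffAt.comp u h1).mdifferentiableAt (by simp)
  have h3 : covAlong (𝓡 (n + 1)).tangent cov (fun v : TangentBundle (𝓡 (n + 1)) M => v.proj)
      (fun v => v.2) u (vLift u w) = w := by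
    refine Eq.trans ?_ (connMap_vLift cov u w)
    have := mfderiv_id (I := (𝓡 (n + 1)).tangent) (x := u)
    exact congrArg (fun L : TangentSpace (𝓡 (n + 1)).tangent u →L[ℝ]
      TangentSpace (𝓡 (n + 1)).tangent u => connMap cov u (L (vLift u w))) this
  rw [h2, covAlong_smul hnorm ((contMDiffAt_self u).mdifferentiableAt (by simp)), h3] at h1
  have h4 := congrArg (fun z => (inner ℝ w (connMap cov u z) : ℝ)) h1
  simp only [connMap_vLift, map_zero, inner_zero_right, inner_add_right, real_inner_smul_right] at h4
  rw [hw, mul_zero, add_zero, mul_eq_zero, inv_eq_zero, norm_eq_zero, inner_self_eq_zero] at h4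
  exact h4.elim hu hw0

end AdaptedFrames

/-! ### Tangent vectors and vector fields of the sphere bundle -/

section SphereManifold

variable {n : ℕ} {M : Type*} [TopologicalSpace M] [T2Space M]
  [ChartedSpace (EuclideanSpace ℝ (Fin (n + 1))) M] [IsManifold (𝓡 (n + 1)) ∞ M]
  [RiemannianBundle (TangentSpace (𝓡 (n + 1)) : M → Type _)]
  [IsContMDiffRiemannianBundle (𝓡 (n + 1)) ∞ (EuclideanSpace ℝ (Fin (n + 1)))
    (TangentSpace (𝓡 (n + 1)) : M → Type _)]
  {o : ∀ x : M, Orientation ℝ (TangentSpace (𝓡 (n + 1)) x) (Fin (n + 1))}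
  {cov : CovariantDerivative (𝓡 (n + 1)) (EuclideanSpace ℝ (Fin (n + 1)))
    (TangentSpace (𝓡 (n + 1)) : M → Type _)}
  {F H N : Type*} [NormedAddCommGroup F] [NormedSpace ℝ F] [TopologicalSpace H]
  {J : ModelWithCorners ℝ F H} [TopologicalSpace N] [ChartedSpace H N]
  {s : ℝ} [Fact (0 < s)]

/-- A map to the sphere bundle is smooth if it is smooth as a map to `T_M`. -/
theorem contMDiffAt_sphereBundle {g : N → SphereBundle n M s} {p : N}
    (hg : ContMDiffAt J (𝓡 (n + 1)).tangent ∞ (fun q => (g q).1) p) :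
    ContMDiffAt J ((𝓡 (n + 1)).prod (𝓡 n)) ∞ g p := by
  rw [contMDiffAt_iff_target]
  refine ⟨Topology.IsInducing.subtypeVal.continuousAt_iff.2 hg.continuousAt, ?_⟩
  have hp : (g p).1.proj ∈ (trivializationAt (EuclideanSpace ℝ (Fin (n + 1)))
      (TangentSpace (𝓡 (n + 1)) : M → Type _) (g p).1.proj).baseSet := mem_base (g p).1.proj
  have h1 := (contMDiffOn_sphereChart (g p).1.proj (g p).1 ⟨hp, (g p).ne_zero⟩).contMDiffAt
    (Filter.inter_mem (((trivializationAt (EuclideanSpace ℝ (Fin (n + 1)))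
      (TangentSpace (𝓡 (n + 1)) : M → Type _) (g p).1.proj).open_baseSet.preimage
        (FiberBundle.continuous_proj _ _)).mem_nhds hp) (isOpen_ne_zero.mem_nhds (g p).ne_zero))
  have h2 : ContMDiffAt ((𝓡 (n + 1)).prod (𝓡 n)) 𝓘(ℝ, _) ∞
      (extChartAt ((𝓡 (n + 1)).prod (𝓡 n)) (sphereChart (g p) (g p))) (sphereChart (g p) (g p)) :=
    contMDiffAt_extChartAt
  exact ContMDiffAt.comp p (f := fun q => (g q).1) (h2.comp (g p).1 h1) hg

theorem contMDiffAt_radial (p : SphereBundle n M s) {u : TangentBundle (𝓡 (n + 1)) M}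
    (hu : u.2 ≠ 0) :
    ContMDiffAt (𝓡 (n + 1)).tangent ((𝓡 (n + 1)).prod (𝓡 n)) ∞ (radial p) u :=
  contMDiffAt_sphereBundle ((contMDiffOn_radial p u hu).contMDiffAt (isOpen_ne_zero.mem_nhds hu))

theorem radial_self (p q : SphereBundle n M s) : radial p q.1 = q := by
  have h := radial_smul p q one_pos
  rwa [one_smul] at h

/-- The differential of the radial projection is a left inverse of that of the inclusion. -/
theorem mfderiv_radial_dIncl (p q : SphereBundle n M s)
    (y : TangentSpace ((𝓡 (n + 1)).prod (𝓡 n)) q) :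
    (mfderiv (𝓡 (n + 1)).tangent ((𝓡 (n + 1)).prod (𝓡 n)) (radial p) q.1 (dIncl q y) :
      EuclideanSpace ℝ (Fin (n + 1)) × EuclideanSpace ℝ (Fin n)) = y := by
  have h1 := mfderiv_comp_apply (I := (𝓡 (n + 1)).prod (𝓡 n)) q
    (g := radial p) (f := fun q : SphereBundle n M s => q.1)
    ((contMDiffAt_radial p q.ne_zero).mdifferentiableAt (by simp))
    (contMDiff_incl.mdifferentiableAt (x := q) (by simp)) y
  refine h1.symm.trans ?_
  have h2 : (radial p) ∘ (fun q : SphereBundle n M s => q.1) = fun q => q :=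
    funext (radial_self p)
  have h3 : (mfderiv ((𝓡 (n + 1)).prod (𝓡 n)) ((𝓡 (n + 1)).prod (𝓡 n))
      ((radial p) ∘ (fun q : SphereBundle n M s => q.1)) q y :
        EuclideanSpace ℝ (Fin (n + 1)) × EuclideanSpace ℝ (Fin n)) =
      (mfderiv ((𝓡 (n + 1)).prod (𝓡 n)) ((𝓡 (n + 1)).prod (𝓡 n))
        (fun q : SphereBundle n M s => q) q y :) := by rw [h2]
  refine h3.trans ?_
  have := mfderiv_id (I := (𝓡 (n + 1)).prod (𝓡 n)) (x := q)
  exact DFunLike.congr_fun this y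

theorem covAlong_incl (p : SphereBundle n M s) (y : TangentSpace ((𝓡 (n + 1)).prod (𝓡 n)) p) :
    covAlong ((𝓡 (n + 1)).prod (𝓡 n)) cov (fun q : SphereBundle n M s => q.1.proj)
      (fun q => q.1.2) p y = connMap cov p.1 (dIncl p y) := rfl

theorem mdifferentiableAt_incl (p : SphereBundle n M s) :
    MDifferentiableAt ((𝓡 (n + 1)).prod (𝓡 n)) (𝓡 (n + 1)).tangent
      (alongMap (fun q : SphereBundle n M s => q.1.proj) fun q => q.1.2) p :=
  contMDiff_incl.mdifferentiableAt (by simp)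

/-- The tangent space of the sphere bundle is the hyperplane orthogonal to `ξ`: it is contained in it
because `‖u‖²` is constant on the sphere bundle, and both have dimension `2n + 1`. -/
theorem mem_range_dIncl_iff (ho : IsManifoldOrientation o) (hmetric : cov.IsMetricCompatible)
    (p : SphereBundle n M s) (z : TangentSpace (𝓡 (n + 1)).tangent p.1) :
    (∃ y, dIncl p y = z) ↔ (inner ℝ (connMap cov p.1 z) p.1.2 : ℝ) = 0 := by
  have : FiniteDimensional ℝ (TangentSpace (𝓡 (n + 1)).tangent p.1) :=
    inferInstanceAs (FiniteDimensional ℝ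
      (EuclideanSpace ℝ (Fin (n + 1)) × EuclideanSpace ℝ (Fin (n + 1))))
  have hfr : finrank ℝ (TangentSpace (𝓡 (n + 1)).tangent p.1) = (n + 1) + (n + 1) :=
    (finrank_prod (R := ℝ) (M := EuclideanSpace ℝ (Fin (n + 1)))
      (M' := EuclideanSpace ℝ (Fin (n + 1)))).trans (by simp)
  have hfrS : finrank ℝ (TangentSpace ((𝓡 (n + 1)).prod (𝓡 n)) p) = (n + 1) + n :=
    (finrank_prod (R := ℝ) (M := EuclideanSpace ℝ (Fin (n + 1)))
      (M' := EuclideanSpace ℝ (Fin n))).trans (by simp)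
  let φ : TangentSpace (𝓡 (n + 1)).tangent p.1 →ₗ[ℝ] ℝ :=
    (innerₗ (TangentSpace (𝓡 (n + 1)) p.1.proj) p.1.2) ∘ₗ (connMap cov p.1).toLinearMap
  have hφ : ∀ z, φ z = inner ℝ (connMap cov p.1 z) p.1.2 := fun z => by
    rw [real_inner_comm]
    rfl
  have hle : LinearMap.range (dIncl p).toLinearMap ≤ LinearMap.ker φ := by
    rintro _ ⟨y, rfl⟩
    rw [LinearMap.mem_ker, hφ]
    have h1 := covAlong_metric (cov := cov) ho hmetric (mdifferentiableAt_incl p)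
      (mdifferentiableAt_incl p) y
    have h2 : (fun q : SphereBundle n M s => (inner ℝ q.1.2 q.1.2 : ℝ)) = fun _ => s ^ 2 :=
      funext fun q => by rw [real_inner_self_eq_norm_sq, q.2]
    rw [h2, mvfderiv_const, covAlong_incl, real_inner_comm p.1.2] at h1
    have h3 : (0 : ℝ) = inner ℝ p.1.2 (connMap cov p.1 (dIncl p y)) +
      inner ℝ p.1.2 (connMap cov p.1 (dIncl p y)) := h1
    have h4 : (inner ℝ (connMap cov p.1 (dIncl p y)) p.1.2 : ℝ) =
      inner ℝ p.1.2 (connMap cov p.1 (dIncl p y)) := real_inner_comm _ _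
    refine h4.trans ?_
    linarith
  have heq : LinearMap.range (dIncl p).toLinearMap = LinearMap.ker φ := by
    refine Submodule.eq_of_le_of_finrank_eq hle ?_
    have h1 : finrank ℝ (LinearMap.range (dIncl p).toLinearMap) = (n + 1) + n :=
      (LinearMap.finrank_range_of_inj (mfderiv_incl_injective p)).trans hfrS
    have h2 : φ ≠ 0 := fun h => by
      have h3 := DFunLike.congr_fun h (vLift p.1 p.1.2)
      rw [hφ, connMap_vLift, LinearMap.zero_apply, inner_self_eq_zero] at h3
      exact p.ne_zero h3
    have h3 := LinearMap.finrank_range_add_finrank_ker φ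
    rw [LinearMap.range_eq_top.2 (LinearMap.surjective h2), finrank_top, finrank_self, hfr] at h3
    omega
  have h := SetLike.ext_iff.1 heq z
  rw [LinearMap.mem_ker, hφ] at h
  exact h

/-- The differential of the radial projection, applied to a vector field of `T_M`, as a vector field
of the sphere bundle. -/
theorem contMDiffAt_mfderiv_radial (p₀ : SphereBundle n M s)
    {Z : ∀ v : TangentBundle (𝓡 (n + 1)) M, TangentSpace (𝓡 (n + 1)).tangent v}
    {p : SphereBundle n M s}
    (hZ : ContMDiffAt (𝓡 (n + 1)).tangent (𝓡 (n + 1)).tangent.tangent ∞ (fun v => (⟨v, Z v⟩ :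
      TangentBundle (𝓡 (n + 1)).tangent (TangentBundle (𝓡 (n + 1)) M))) p.1) :
    ContMDiffAt ((𝓡 (n + 1)).prod (𝓡 n)) ((𝓡 (n + 1)).prod (𝓡 n)).tangent ∞
      (fun q => (⟨q, mfderiv (𝓡 (n + 1)).tangent ((𝓡 (n + 1)).prod (𝓡 n)) (radial p₀) q.1 (Z q.1)⟩ :
        TangentBundle ((𝓡 (n + 1)).prod (𝓡 n)) (SphereBundle n M s))) p := by
  have h1 : ContMDiffOn (𝓡 (n + 1)).tangent ((𝓡 (n + 1)).prod (𝓡 n)) ∞ (radial p₀)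
      {u : TangentBundle (𝓡 (n + 1)) M | u.2 ≠ 0} :=
    fun u hu => (contMDiffAt_radial p₀ hu).contMDiffWithinAt
  have hop : IsOpen {u : TangentBundle (𝓡 (n + 1)) M | u.2 ≠ 0} := isOpen_ne_zero
  have h2 := h1.contMDiffOn_tangentMapWithin (m := ∞) (by simp) hop.uniqueMDiffOn
  have h3 := hZ.comp p (contMDiff_incl p)
  have h4 := (h2 ⟨p.1, Z p.1⟩ p.ne_zero).contMDiffAt
    ((hop.preimage (FiberBundle.continuous_proj _ _)).mem_nhds p.ne_zero)
  refine (h4.comp p h3).congr_of_eventuallyEq (Filter.Eventually.of_forall fun q => ?_)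
  have h5 : mfderivWithin (𝓡 (n + 1)).tangent ((𝓡 (n + 1)).prod (𝓡 n)) (radial p₀)
      {u : TangentBundle (𝓡 (n + 1)) M | u.2 ≠ 0} q.1 =
      mfderiv (𝓡 (n + 1)).tangent ((𝓡 (n + 1)).prod (𝓡 n)) (radial p₀) q.1 :=
    mfderivWithin_of_isOpen hop q.ne_zero
  have key : ∀ (q' : SphereBundle n M s) (_ : q' = q)
      (y y' : EuclideanSpace ℝ (Fin (n + 1)) × EuclideanSpace ℝ (Fin n)), y' = y →
      (⟨q, y⟩ : TangentBundle ((𝓡 (n + 1)).prod (𝓡 n)) (SphereBundle n M s)) = ⟨q', y'⟩ := by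
    rintro _ rfl _ _ rfl
    rfl
  exact key _ (radial_self p₀ q) _ _ (DFunLike.congr_fun h5 (Z q.1))

end SphereManifold

/-! ### The `SO(n)`-structure of the sphere bundle -/

section SphereStructure

variable {n : ℕ} {M : Type*} [TopologicalSpace M] [T2Space M]
  [ChartedSpace (EuclideanSpace ℝ (Fin (n + 1))) M] [IsManifold (𝓡 (n + 1)) ∞ M]
  [RiemannianBundle (TangentSpace (𝓡 (n + 1)) : M → Type _)]
  [IsContMDiffRiemannianBundle (𝓡 (n + 1)) ∞ (EuclideanSpace ℝ (Fin (n + 1)))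
    (TangentSpace (𝓡 (n + 1)) : M → Type _)]
  {o : ∀ x : M, Orientation ℝ (TangentSpace (𝓡 (n + 1)) x) (Fin (n + 1))}
  {cov : CovariantDerivative (𝓡 (n + 1)) (EuclideanSpace ℝ (Fin (n + 1)))
    (TangentSpace (𝓡 (n + 1)) : M → Type _)}
  {s : ℝ} [Fact (0 < s)]

theorem dIncl_injective (p : SphereBundle n M s) : Function.Injective (dIncl p) :=
  mfderiv_incl_injective p

/-- The frame `e` of the sphere bundle consists of the vectors of the frame `e'` of `T_M`, except for
the first vertical one. -/
def IsRestrictionOf (p : SphereBundle n M s)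
    (e' : Fin (n + 1) ⊕ Fin (n + 1) → TangentSpace (𝓡 (n + 1)).tangent p.1)
    (e : Fin (n + 1) ⊕ Fin n → TangentSpace ((𝓡 (n + 1)).prod (𝓡 n)) p) : Prop :=
  (∀ i, dIncl p (e (Sum.inl i)) = e' (Sum.inl i)) ∧
    ∀ i : Fin n, dIncl p (e (Sum.inr i)) = e' (Sum.inr i.succ)

variable {p : SphereBundle n M s}
  {e' f' : Fin (n + 1) ⊕ Fin (n + 1) → TangentSpace (𝓡 (n + 1)).tangent p.1}
  {e f : Fin (n + 1) ⊕ Fin n → TangentSpace ((𝓡 (n + 1)).prod (𝓡 n)) p}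

theorem IsRestrictionOf.frameAct (h : IsRestrictionOf p e' e) (g : SO n) :
    IsRestrictionOf p (frameAct e' (rhoNonzero n g)) (frameAct e (rhoSphere n g)) := by
  refine ⟨fun j => ?_, fun j => ?_⟩
  · change dIncl p (TangentManifold.frameAct e (blockDiag _ _ (fixFirst n g.1, g.1)) _) =
      TangentManifold.frameAct e' (blockDiag _ _ (fixFirst n g.1, fixFirst n g.1)) _
    rw [frameAct_blockDiag_inl, frameAct_blockDiag_inl, map_sum]
    simp only [map_smul, h.1]
  · change dIncl p (TangentManifold.frameAct e (blockDiag _ _ (fixFirst n g.1, g.1)) _) =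
      TangentManifold.frameAct e' (blockDiag _ _ (fixFirst n g.1, fixFirst n g.1)) _
    rw [frameAct_blockDiag_inr, frameAct_blockDiag_inr, map_sum, Fin.sum_univ_succ,
      fixFirst_zero_succ, zero_smul, zero_add]
    simp only [map_smul, h.2, fixFirst_succ_succ]

theorem IsRestrictionOf.ext (h : IsRestrictionOf p e' e) (h' : IsRestrictionOf p e' f) : e = f := by
  funext i
  refine dIncl_injective p ?_
  rcases i with i | i
  · rw [h.1, h'.1]
  · rw [h.2, h'.2]

/-- An adapted frame is determined by its horizontal vectors. -/
theorem IsRestrictionOf.eq_of_mem (he' : e' ∈ adaptedFrames o cov p.1)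
    (hf' : f' ∈ adaptedFrames o cov p.1) (h : IsRestrictionOf p e' e)
    (h' : IsRestrictionOf p f' e) : e' = f' := by
  obtain ⟨b, -, -, hb⟩ := he'
  obtain ⟨c, -, -, hc⟩ := hf'
  have hbc : ∀ i, b i = c i := fun i => by
    rw [← dProj_hLift cov p.1 (b i), ← hb.1, ← h.1, h'.1, hc.1, dProj_hLift]
  funext i
  rcases i with i | i
  · rw [hb.1, hc.1, hbc]
  · rw [hb.2, hc.2, hbc]

/-- The vectors of an adapted frame, except for `ξ / ‖ξ‖`, are tangent to the sphere bundle. -/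
theorem exists_isRestrictionOf (ho : IsManifoldOrientation o) (hmetric : cov.IsMetricCompatible)
    (he' : e' ∈ adaptedFrames o cov p.1) :
    (∀ i, ∃ y, dIncl p y = e' (Sum.inl i)) ∧ ∀ i : Fin n, ∃ y, dIncl p y = e' (Sum.inr i.succ) := by
  obtain ⟨b, -, hb0, hb⟩ := he'
  refine ⟨fun i => ?_, fun i => ?_⟩
  · rw [mem_range_dIncl_iff (cov := cov) ho hmetric, hb.1, connMap_hLift, inner_zero_left]
  · rw [mem_range_dIncl_iff (cov := cov) ho hmetric, hb.2, connMap_vLift]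
    have h1 : (inner ℝ (b i.succ) (b 0) : ℝ) = 0 := b.orthonormal.2 (Fin.succ_ne_zero i)
    rw [hb0, real_inner_smul_right, mul_eq_zero, inv_eq_zero, norm_eq_zero] at h1
    exact h1.resolve_left p.ne_zero

theorem linearIndependent_sphereFrames (ho : IsManifoldOrientation o)
    (hcov : CovariantDerivative.ContMDiffCovariantDerivative cov ∞) (hn : 1 ≤ n)
    (he : e ∈ sphereFrames o cov p) : LinearIndependent ℝ e := by
  obtain ⟨e', he', h⟩ := he
  have h1 := (isGStructure_adaptedFrames ho hcov hn).linearIndependent p.1 p.ne_zero e' he'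
  have h2 : (dIncl p).toLinearMap ∘ e = e' ∘ Sum.map id Fin.succ := by
    funext i
    rcases i with i | i
    · exact h.1 i
    · exact h.2 i
  refine LinearIndependent.of_comp (dIncl p).toLinearMap ?_
  rw [h2]
  exact h1.comp _ (Function.Injective.sumMap Function.injective_id (Fin.succ_injective n))

theorem isGStructure_sphereFrames (ho : IsManifoldOrientation o)
    (hcov : CovariantDerivative.ContMDiffCovariantDerivative cov ∞)
    (hmetric : cov.IsMetricCompatible) (hn : 1 ≤ n) :
    IsGStructure ((𝓡 (n + 1)).prod (𝓡 n)) (rhoSphere n)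
      (fun p : SphereBundle n M s => sphereFrames o cov p) Set.univ where
  isOpen := isOpen_univ
  linearIndependent := fun p _ e he => linearIndependent_sphereFrames ho hcov hn he
  span_eq_top := fun p _ e he => by
    have : FiniteDimensional ℝ (TangentSpace ((𝓡 (n + 1)).prod (𝓡 n)) p) :=
      inferInstanceAs (FiniteDimensional ℝ
        (EuclideanSpace ℝ (Fin (n + 1)) × EuclideanSpace ℝ (Fin n)))
    have hfrS : finrank ℝ (TangentSpace ((𝓡 (n + 1)).prod (𝓡 n)) p) = (n + 1) + n :=
      (finrank_prod (R := ℝ) (M := EuclideanSpace ℝ (Fin (n + 1)))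
        (M' := EuclideanSpace ℝ (Fin n))).trans (by simp)
    refine (linearIndependent_sphereFrames ho hcov hn he).span_eq_top_of_card_eq_finrank' ?_
    rw [hfrS]
    simp
  act_mem := by
    rintro p - e ⟨e', he', h⟩ g
    exact ⟨_, (isGStructure_adaptedFrames ho hcov hn).act_mem p.1 p.ne_zero e' he' g,
      IsRestrictionOf.frameAct h g⟩
  existsUnique_act := by
    rintro p - e ⟨e', he', h⟩ f ⟨f', hf', h'⟩
    have hG := isGStructure_adaptedFrames (o := o) (cov := cov) ho hcov hn
    obtain ⟨g, hg, hgu⟩ := hG.existsUnique_act p.1 p.ne_zero e' he' f' hf'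
    refine ⟨g, ?_, fun g' hg' => hgu g' ?_⟩
    · have h1 := IsRestrictionOf.frameAct h g
      rw [← hg] at h1
      exact IsRestrictionOf.ext h' h1
    · have h1 := IsRestrictionOf.frameAct h g'
      rw [← hg'] at h1
      exact IsRestrictionOf.eq_of_mem hf' (hG.act_mem p.1 p.ne_zero e' he' g') h' h1
  exists_section := by
    intro p _
    obtain ⟨U, E, hpU, hU0, hE⟩ :=
      (isGStructure_adaptedFrames (o := o) (cov := cov) ho hcov hn).exists_section p.1 p.ne_zero
    refine ⟨(fun q : SphereBundle n M s => q.1) ⁻¹' U, fun q j =>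
      mfderiv (𝓡 (n + 1)).tangent ((𝓡 (n + 1)).prod (𝓡 n)) (radial p) q.1
        (E q.1 (Sum.map id Fin.succ j)), hpU, Set.subset_univ _,
      hE.isOpen.preimage contMDiff_incl.continuous, fun j q hq => ?_, fun q hq => ?_⟩
    · exact (contMDiffAt_mfderiv_radial p ((hE.contMDiffOn (Sum.map id Fin.succ j)).contMDiffAt
        (hE.isOpen.mem_nhds hq))).contMDiffWithinAt
    · have h := exists_isRestrictionOf ho hmetric (hE.mem q.1 hq)
      have key : ∀ z, (∃ y, dIncl q y = z) → dIncl q (mfderiv (𝓡 (n + 1)).tangent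
          ((𝓡 (n + 1)).prod (𝓡 n)) (radial p) q.1 z) = z := by
        rintro _ ⟨y, rfl⟩
        exact congrArg (dIncl q) (mfderiv_radial_dIncl p q y)
      exact ⟨_, hE.mem q.1 hq, fun i => key _ (h.1 i), fun i => key _ (h.2 i)⟩

theorem projXiPerp_hLift (u : TangentBundle (𝓡 (n + 1)) M) (w : TangentSpace (𝓡 (n + 1)) u.proj) :
    projXiPerp cov u (hLift cov u w) = hLift cov u w := by
  have h : sasaki cov u (hLift cov u w) (xi u) = 0 := by
    rw [sasaki, xi, dProj_vLift, connMap_hLift, inner_zero_right, inner_zero_left, add_zero]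
  rw [projXiPerp, h, zero_div, zero_smul, sub_zero]

theorem dIncl_leftInverse (y : TangentSpace ((𝓡 (n + 1)).prod (𝓡 n)) p) :
    (dIncl p).toLinearMap.leftInverse (dIncl p y) = y :=
  LinearMap.leftInverse_apply_of_inj (LinearMap.ker_eq_bot.2 (dIncl_injective p)) y

/-- The horizontal field `u ↦ (u / ‖u‖)^h`, which belongs to all the frames, is not parallel: its
derivative along a vertical vector `w^v` with `w ⊥ u` is `w^h / ‖u‖`, which is tangent to the sphere
bundle. -/
theorem not_isReducible_sphereFrames [Nonempty M] (ho : IsManifoldOrientation o)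
    (hcov : CovariantDerivative.ContMDiffCovariantDerivative cov ∞)
    (hmetric : cov.IsMetricCompatible) (hn : 1 ≤ n) :
    ¬ IsReducible ((𝓡 (n + 1)).prod (𝓡 n)) (fun Z (p : SphereBundle n M s) y =>
          sphereCov cov Z p y) (rhoSphere n)
        (fun p : SphereBundle n M s => sphereFrames o cov p) Set.univ := by
  intro hred
  have hs : 0 < s := Fact.out
  obtain ⟨u, hu⟩ := exists_tangent_ne_zero (n := n) (M := M)
  obtain ⟨p⟩ : Nonempty (SphereBundle n M s) := ⟨⟨⟨u.proj, (s / ‖u.2‖) • u.2⟩, by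
    have hu : ‖u.2‖ ≠ 0 := norm_ne_zero_iff.2 hu
    simp [norm_smul, abs_of_pos hs, hu]⟩⟩
  obtain ⟨w, hw0, hw⟩ := exists_orthogonal_ne_zero ho hn p.1.2
  obtain ⟨y, hy⟩ := (mem_range_dIncl_iff (cov := cov) ho hmetric p (vLift p.1 w)).2
    (by rw [connMap_vLift, hw])
  obtain ⟨U, e, hpU, -, he⟩ :=
    (isGStructure_sphereFrames (s := s) (o := o) (cov := cov) ho hcov hmetric hn).exists_section
      p trivial
  obtain ⟨A, hA, h⟩ := hred U e (Set.subset_univ _) he p hpU y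
  have h1 := congrFun h (Sum.inl 0)
  rw [frameAct_eq_zero_of_col (rhoSphere_col n) hA] at h1
  have h2 : nablaStarAlong cov ((𝓡 (n + 1)).prod (𝓡 n)) (fun q : SphereBundle n M s => q.1)
      (fun q => dIncl q (e q (Sum.inl 0))) p y = hLift cov p.1 (s⁻¹ • w) := by
    have h3 := covAlong_smul (cov := cov) (J := (𝓡 (n + 1)).prod (𝓡 n)) (p := p)
      (c := fun _ => s⁻¹) mdifferentiableAt_const (mdifferentiableAt_incl p) y
    rw [mvfderiv_const, covAlong_incl, hy, connMap_vLift, zero_apply, zero_smul, add_zero] at h3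
    rw [← h3]
    refine nablaStarAlong_hLift (cov := cov) (contMDiff_incl.mdifferentiableAt (by simp))
      (mdifferentiableAt_alongMap_smul mdifferentiableAt_const (mdifferentiableAt_incl p)) ?_ y
    filter_upwards [he.isOpen.mem_nhds hpU] with q hq
    obtain ⟨e', ⟨b, -, hb0, hb, -⟩, hee', -⟩ := he.mem q hq
    rw [hee', hb, hb0, q.2]
  have h3 : sphereCov cov (fun q => e q (Sum.inl 0)) p y =
      (dIncl p).toLinearMap.leftInverse (hLift cov p.1 (s⁻¹ • w)) := by
    rw [sphereCov, h2, projXiPerp_hLift]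
  obtain ⟨z, hz⟩ := (mem_range_dIncl_iff (cov := cov) ho hmetric p (hLift cov p.1 (s⁻¹ • w))).2
    (by rw [connMap_hLift, inner_zero_left])
  have h4 : z = 0 := by
    rw [← dIncl_leftInverse z, hz, ← h3]
    exact h1
  rw [h4, map_zero] at hz
  have h5 := congrArg (dProj p.1) hz
  rw [map_zero, dProj_hLift] at h5
  exact smul_ne_zero (inv_ne_zero hs.ne') hw0 h5.symm

end SphereStructure

end TangentManifold

end

theorem mainTheorem2 {n : ℕ} {M : Type*} [TopologicalSpace M] [T2Space M] [Nonempty M]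
    [ChartedSpace (EuclideanSpace ℝ (Fin (n + 1))) M] [IsManifold (𝓡 (n + 1)) ∞ M]
    [RiemannianBundle (TangentSpace (𝓡 (n + 1)) : M → Type _)]
    [IsContMDiffRiemannianBundle (𝓡 (n + 1)) ∞ (EuclideanSpace ℝ (Fin (n + 1)))
      (TangentSpace (𝓡 (n + 1)) : M → Type _)]
    (o : ∀ x : M, Orientation ℝ (TangentSpace (𝓡 (n + 1)) x) (Fin (n + 1)))
    (ho : IsManifoldOrientation o)
    (cov : CovariantDerivative (𝓡 (n + 1)) (EuclideanSpace ℝ (Fin (n + 1)))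
      (TangentSpace (𝓡 (n + 1)) : M → Type _))
    (hsmooth : CovariantDerivative.ContMDiffCovariantDerivative cov ∞)
    (hmetric : cov.IsMetricCompatible) :
    (IsGStructure (𝓡 (n + 1)).tangent (rhoTangent n) (tangentFrames o cov) Set.univ ∧
      IsReducible (𝓡 (n + 1)).tangent (nablaStar cov) (rhoTangent n) (tangentFrames o cov)
        Set.univ) ∧
    (1 ≤ n →
      IsGStructure (𝓡 (n + 1)).tangent (rhoNonzero n) (adaptedFrames o cov)
        {u : TangentBundle (𝓡 (n + 1)) M | u.2 ≠ 0} ∧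
      ¬ IsReducible (𝓡 (n + 1)).tangent (nablaStar cov) (rhoNonzero n) (adaptedFrames o cov)
        {u : TangentBundle (𝓡 (n + 1)) M | u.2 ≠ 0}) ∧
    (1 ≤ n → ∀ (s : ℝ) [Fact (0 < s)],
      IsGStructure ((𝓡 (n + 1)).prod (𝓡 n)) (rhoSphere n)
        (fun p : SphereBundle n M s => sphereFrames o cov p) Set.univ ∧
      ¬ IsReducible ((𝓡 (n + 1)).prod (𝓡 n)) (fun Z (p : SphereBundle n M s) y =>
          sphereCov cov Z p y) (rhoSphere n)
        (fun p : SphereBundle n M s => sphereFrames o cov p) Set.univ) := by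
  refine ⟨⟨isGStructure_tangentFrames ho hsmooth, isReducible_tangentFrames ho hmetric⟩,
    fun hn => ⟨isGStructure_adaptedFrames ho hsmooth hn,
      not_isReducible_adaptedFrames ho hsmooth hn⟩,
    fun hn s _ => ⟨isGStructure_sphereFrames ho hsmooth hmetric hn,
      not_isReducible_sphereFrames ho hsmooth hmetric hn⟩⟩
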